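/- For every integer $N\ge 2$ let $d_N\in\{0,\dots,N-1\}$ be an integer such that $N d_N$ is even, so that $d_N$-regular simple graphs on the vertex set $[N]=\{1,\dots,N\}$ exist. Let $G_N$ be uniformly distributed on the set of these graphs. Let $(\xi^{(N)}_{i,j})_{1\le i\le j\le N}$, with $\xi^{(N)}_{j,i}=\xi^{(N)}_{i,j}$, be i.i.d. real random variables, independent of $G_N$, whose common law $\nu$ does not depend on $N$ and satisfies $0<\int |x|^{2K}\,\nu(\mathrm dx)<\infty$ for all integers $K\ge 1$. Put $m_1=\int x\,\nu(\mathrm dx)$ and $m_2=\int x^2\,\nu(\mathrm dx)$. Let $A_N$ be the symmetric $N\times N$ matrix with $A_N(i,j)=\xi^{(N)}_{i,j}$ if $\{i,j\}$ is an edge of $G_N$ and $A_N(i,j)=0$ otherwise, let $J_N$ be the $N\times N$ matrix with off-diagonal entries $1$ and diagonal entries $0$, and let $$M_N=\frac{A_N-m_1\frac{d_N}{N-1}J_N}{\sqrt{d_N\left(m_2-m_1^2\frac{d_N}{N-1}\right)}}$$ (with $M_N=0$ if the denominator vanishes, which under the assumptions below happens for at most finitely many $N$). Let $\lambda_1,\dots,\lambda_N$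 be the eigenvalues of $M_N$. **Theorem (Wigner's law).** Assume that there is a constant $\eta>0$ such that, as $N\to\infty$, $$d_N\to\infty,\qquad N-d_N\to\infty,\qquad \left|\tfrac N2-d_N-\eta\sqrt{d_N}\right|\to\infty .$$ Then the mean empirical spectral distribution of $M_N$ converges in moments to the semicircle law on $[-2,2]$: for every real polynomial $P$, the random variable $\frac1N\sum_{i=1}^N P(\lambda_i)$ is integrable for every $N\ge2$, and $$\mathbb E\left[\frac1N\sum_{i=1}^N P(\lambda_i)\right]\xrightarrow[N\to\infty]{}\int_{-2}^{2}P(t)\,\frac1{2\pi}\sqrt{4-t^2}\,\mathrm dt .$$ -/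

import Mathlib

open MeasureTheory ProbabilityTheory Filter Topology Polynomial

namespace RegWigner

open Classical in
/-- The set of `d`-regular simple graphs on the `N` labelled vertices `Fin N`. -/
def regularGraphs (N d : ℕ) : Set (SimpleGraph (Fin N)) :=
  {H | H.IsRegularOfDegree d}

/-- The weight distribution `ν` (a law on the real line) admits moments of any order and is not
concentrated at zero: `0 < E[|ξ|^(2K)] < ∞` for all `K ≥ 1`. -/
def AdmissibleWeightLaw (ν : Measure ℝ) : Prop :=
  ∀ K : ℕ, 1 ≤ K → Integrable (fun x : ℝ => |x| ^ (2 * K)) ν ∧ 0 < ∫ x, |x| ^ (2 * K) ∂ν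

/-- `(G, ξ)` is a uniform `d`-regular graph on `N` vertices weighted by i.i.d. random variables of
law `ν`. The weight of the unordered pair `{i, j}` (with `i = j` allowed) is `ξ s(i, j)`. -/
structure IsUniformRegularWeightedGraph {Ω : Type*} [MeasurableSpace Ω] (N d : ℕ) (ν : Measure ℝ)
    (G : Ω → SimpleGraph (Fin N)) (ξ : Sym2 (Fin N) → Ω → ℝ) (μ : Measure Ω) : Prop where
  /-- the graph is uniformly distributed on the (nonempty) set of `d`-regular simple graphs -/
  graph_law : HasLaw G (uniformOn (regularGraphs N d)) μ
  /-- every weight has law `ν` -/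
  weight_law : ∀ e, HasLaw (ξ e) ν μ
  /-- the weights are mutually independent -/
  weight_indep : iIndepFun ξ μ
  /-- the family of weights is independent of the graph -/
  graph_indep_weight : IndepFun G (fun ω e => ξ e ω) μ

open Classical in
/-- The weighted adjacency matrix of a graph `H` with weights `w`. -/
noncomputable def weightedAdj {N : ℕ} (H : SimpleGraph (Fin N)) (w : Sym2 (Fin N) → ℝ) :
    Matrix (Fin N) (Fin N) ℝ :=
  Matrix.of fun i j => if H.Adj i j then w s(i, j) else 0

/-- The matrix whose off-diagonal entries are one and whose diagonal entries are zero. -/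
def offDiagOnes (N : ℕ) : Matrix (Fin N) (Fin N) ℝ :=
  Matrix.of fun i j => if i = j then 0 else 1

/-- The standardized weighted adjacency matrix
`(A - m₁ (d/(N-1)) J) / √(d (m₂ - m₁² d/(N-1)))`, where `m₁`, `m₂` are the first two moments of the
weight law `ν`. -/
noncomputable def standardized {N : ℕ} (d : ℕ) (ν : Measure ℝ) (H : SimpleGraph (Fin N))
    (w : Sym2 (Fin N) → ℝ) : Matrix (Fin N) (Fin N) ℝ :=
  (√((d : ℝ) * ((∫ x, x ^ 2 ∂ν) - (∫ x, x ∂ν) ^ 2 * ((d : ℝ) / ((N : ℝ) - 1)))))⁻¹ •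
    (weightedAdj H w - ((∫ x, x ∂ν) * ((d : ℝ) / ((N : ℝ) - 1))) • offDiagOnes N)

theorem standardized_isHermitian {N : ℕ} (d : ℕ) (ν : Measure ℝ) (H : SimpleGraph (Fin N))
    (w : Sym2 (Fin N) → ℝ) : (standardized d ν H w).IsHermitian := by
  ext i j
  have h : H.Adj j i ↔ H.Adj i j := H.adj_comm j i
  have h' : (j = i) ↔ (i = j) := eq_comm
  by_cases hij : H.Adj i j <;>
    simp [standardized, weightedAdj, offDiagOnes, Matrix.conjTranspose_apply, h, h', hij,
      Sym2.eq_swap (a := j) (b := i)]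

/-- The integral `(1/N) ∑ᵢ P(λᵢ)` of a polynomial `P` against the empirical spectral distribution
of the standardized matrix, whose eigenvalues are `λ₁, …, λ_N`. -/
noncomputable def esdIntegral {N : ℕ} (d : ℕ) (ν : Measure ℝ) (H : SimpleGraph (Fin N))
    (w : Sym2 (Fin N) → ℝ) (P : ℝ[X]) : ℝ :=
  (1 / (N : ℝ)) * ∑ i, P.eval ((standardized_isHermitian d ν H w).eigenvalues i)

end RegWigner

/-! Notation: m and v are the mean and variance of ν, σ = d(1 − d/N) is `rowVar`, and θ is the
inverse square root of `scaleSq`. The standardized matrix splits as M = θ(Z + mY + R). Here Z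
carries the centered weights on the edges, Y is the adjacency matrix centered to have zero row sums,
and R is deterministic with bounded row sums. The semicircle moments c_a satisfy c_0 = 1, c_1 = 0
and c_{n+2} = ∑ c_a c_{n−a}, the sum over a ≤ n (`semicircleMoment_recursion`). The heart of the
proof is that E ∑_i ((M^a)_ii − c_a)² = o(N) for every a, by strong induction on a
(`tendsto_fluctuation_div`). Cauchy–Schwarz then gives convergence of the mean trace moments, and
linearity handles all polynomials.

Induction step (`exists_fluctuation_le_of_recursion`). Put g_i = (M^{n+2})_ii − c_{n+2} and F_ij =
(M^{n+1})_ij g_i, so that ∑ g_i² = ∑ M_ij F_ij − c_{n+2} ∑ g_i. Both random parts of M_ij allow an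
integration by parts. For Z, the weight of an edge is exchanged with an independent spare weight
(`integral_resample`). For Y, the number of alternating four-cycles having ij as an edge, minus the
number having ij as a non-edge, is NσY_ij up to a small error
(`IsRegularAdj.abs_sum_altCycle_sub_le`). Switching along such cycles preserves the uniform law and
interchanges the two counts (`integral_sum_altCycle_sub_mul`). In both cases F_ij is replaced by its
increment under a move that changes a few entries of M by O(θ).

To first order this increment is the change of M_ij times ∑ (M^a)_ii (M^{n−a})_jj g_i. All other
terms contain an off-diagonal entry of a power of M; the squares of these entries over all pairs sum
only to tr M^{2a}, which is O(N) on average (`exists_abs_increment_sub_le`). By induction the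
diagonal entries may be replaced by the c_a, and the sum becomes c_{n+2} g_i. The two contributions
have weights θ²dv and θ²m²σ, whose sum tends to 1, so the main term cancels c_{n+2} E ∑ g_i and only
the error is left. It vanishes relative to N because σ → ∞, which follows from d → ∞ and N − d → ∞.

The estimates rest on the a priori bound E tr M^{2n} ≤ CN
(`exists_integral_trace_standardized_pow_le`). It comes from the same two integrations by parts,
tested against Y^{2n−1} and Z^{2n−1}: for a suitable cutoff the increments are absorbed by the trace
moment itself. -/

namespace RegWigner

/-! ### Spectral inequalities for real symmetric matrices. -/

section Spectral

variable {V : Type*} [Fintype V] [DecidableEq V]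

theorem exists_spectral_decomposition {M : Matrix V V ℝ} (hM : M.IsSymm) :
    ∃ (l : V → ℝ) (u : V → V → ℝ),
      (∀ n x y, (M ^ n) x y = ∑ i, l i ^ n * (u i x * u i y)) ∧
      (∀ i j, ∑ x, u i x * u j x = if i = j then 1 else 0) ∧
      (∀ x y, ∑ i, u i x * u i y = if x = y then 1 else 0) := by
  have hH : M.IsHermitian := by
    rw [Matrix.IsHermitian, Matrix.conjTranspose_eq_transpose_of_trivial]; exact hM
  set W : Matrix V V ℝ := (hH.eigenvectorUnitary : Matrix V V ℝ) with hW
  have h1 : W * W.transpose = 1 := by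
    have := Unitary.coe_mul_star_self hH.eigenvectorUnitary
    rwa [Unitary.coe_star, Matrix.star_eq_conjTranspose,
      Matrix.conjTranspose_eq_transpose_of_trivial] at this
  have h2 : W.transpose * W = 1 := by
    have := Unitary.coe_star_mul_self hH.eigenvectorUnitary
    rwa [Matrix.star_eq_conjTranspose,
      Matrix.conjTranspose_eq_transpose_of_trivial] at this
  have hspec : M = W * Matrix.diagonal hH.eigenvalues * W.transpose := by
    have := hH.spectral_theorem
    rw [Unitary.conjStarAlgAut_apply, Matrix.star_eq_conjTranspose,
      Matrix.conjTranspose_eq_transpose_of_trivial] at this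
    simpa using this
  have hpow : ∀ n, M ^ n = W * Matrix.diagonal (fun i => hH.eigenvalues i ^ n) * W.transpose := by
    intro n
    induction n with
    | zero => simp [h1]
    | succ n ih =>
      rw [pow_succ, ih]
      nth_rewrite 2 [hspec]
      calc _ = W * Matrix.diagonal (fun i => hH.eigenvalues i ^ n) * (W.transpose * W) *
            Matrix.diagonal hH.eigenvalues * W.transpose := by simp only [Matrix.mul_assoc]
        _ = _ := by
          rw [h2, Matrix.mul_one, Matrix.mul_assoc W, Matrix.diagonal_mul_diagonal]
          simp only [pow_succ]
  refine ⟨hH.eigenvalues, fun i x => W x i, ?_, ?_, ?_⟩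
  · intro n x y
    rw [hpow, Matrix.mul_apply]
    refine Finset.sum_congr rfl fun i _ => ?_
    rw [Matrix.mul_diagonal, Matrix.transpose_apply]; ring
  · intro i j
    have := congrFun (congrFun h2 i) j
    rw [Matrix.mul_apply, Matrix.one_apply] at this
    simpa [Matrix.transpose_apply] using this
  · intro i j
    have := congrFun (congrFun h1 i) j
    rw [Matrix.mul_apply, Matrix.one_apply] at this
    simpa [Matrix.transpose_apply] using this

theorem isSymm_pow {M : Matrix V V ℝ} (hM : M.IsSymm) (n : ℕ) : (M ^ n).IsSymm := by
  rw [Matrix.IsSymm, Matrix.transpose_pow, hM.eq]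

theorem sum_sq_pow_apply {M : Matrix V V ℝ} (hM : M.IsSymm) (n : ℕ) (x : V) :
    ∑ y, (M ^ n) x y ^ 2 = (M ^ (2 * n)) x x := by
  rw [two_mul, pow_add, Matrix.mul_apply]
  refine Finset.sum_congr rfl fun y _ => ?_
  rw [(isSymm_pow hM n).apply x y, sq]

theorem pow_two_mul_apply_nonneg {M : Matrix V V ℝ} (hM : M.IsSymm) (n : ℕ) (x : V) :
    0 ≤ (M ^ (2 * n)) x x := by
  rw [← sum_sq_pow_apply hM]; positivity

theorem trace_pow_two_mul_nonneg {M : Matrix V V ℝ} (hM : M.IsSymm) (n : ℕ) :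
    0 ≤ (M ^ (2 * n)).trace :=
  Finset.sum_nonneg fun x _ => pow_two_mul_apply_nonneg hM n x

theorem sum_sum_sq_pow_apply {M : Matrix V V ℝ} (hM : M.IsSymm) (n : ℕ) :
    ∑ x, ∑ y, (M ^ n) x y ^ 2 = (M ^ (2 * n)).trace := by
  simp only [sum_sq_pow_apply hM, Matrix.trace, Matrix.diag]

/-- Entries of powers are integrals against spectral measures, and |λ|^a ≤ r^a (1 + (λ/r)^{2K}) for
a ≤ 2K. One high diagonal moment at x and at y therefore controls all lower powers, off-diagonal
entries included. The later entrywise bounds come from here. -/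
theorem abs_pow_apply_le {M : Matrix V V ℝ} (hM : M.IsSymm) {r : ℝ} (hr : 0 < r) {a K : ℕ}
    (ha : a ≤ 2 * K) {x y : V} (hx : (M ^ (2 * K)) x x ≤ r ^ (2 * K))
    (hy : (M ^ (2 * K)) y y ≤ r ^ (2 * K)) : |(M ^ a) x y| ≤ 2 * r ^ a := by
  obtain ⟨l, u, h, -, h1⟩ := exists_spectral_decomposition hM
  have hb : ∀ i, |l i| ^ a ≤ r ^ a * (1 + (l i / r) ^ (2 * K)) := by
    intro i
    have h3 : (|l i| / r) ^ a ≤ 1 + (l i / r) ^ (2 * K) := by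
      have h4 : (l i / r) ^ (2 * K) = (|l i| / r) ^ (2 * K) := by
        rw [pow_mul, pow_mul, div_pow, div_pow |l i|, sq_abs]
      rw [h4]
      rcases le_total (|l i| / r) 1 with h5 | h5
      · have := pow_le_one₀ (n := a) (by positivity) h5
        have : 0 ≤ (|l i| / r) ^ (2 * K) := by positivity
        linarith
      · have := pow_le_pow_right₀ h5 ha
        linarith
    rw [div_pow, div_le_iff₀ (by positivity)] at h3
    linarith
  have hq : ∀ i, |u i x * u i y| ≤ (u i x * u i x + u i y * u i y) / 2 := by
    intro i
    rw [abs_le]; constructor <;> nlinarith [sq_nonneg (u i x + u i y), sq_nonneg (u i x - u i y)]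
  rw [h]
  have hS : ∀ z, ∑ i, (l i / r) ^ (2 * K) * (u i z * u i z) =
      (M ^ (2 * K)) z z / r ^ (2 * K) := by
    intro z
    rw [h, Finset.sum_div]
    refine Finset.sum_congr rfl fun i _ => ?_
    rw [div_pow]; ring
  have hS' : ∀ z, (M ^ (2 * K)) z z ≤ r ^ (2 * K) →
      ∑ i, (l i / r) ^ (2 * K) * (u i z * u i z) ≤ 1 := by
    intro z hz
    rw [hS, div_le_one (by positivity)]; exact hz
  calc |∑ i, l i ^ a * (u i x * u i y)| ≤ ∑ i, |l i ^ a * (u i x * u i y)| :=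
        Finset.abs_sum_le_sum_abs _ _
    _ ≤ ∑ i, r ^ a * (1 + (l i / r) ^ (2 * K)) * ((u i x * u i x + u i y * u i y) / 2) := by
        refine Finset.sum_le_sum fun i _ => ?_
        rw [abs_mul, abs_pow]
        exact mul_le_mul (hb i) (hq i) (abs_nonneg _) ((by positivity : (0:ℝ) ≤ |l i| ^ a).trans (hb i))
    _ = r ^ a / 2 * (∑ i, u i x * u i x + ∑ i, u i y * u i y +
          ∑ i, (l i / r) ^ (2 * K) * (u i x * u i x) +
          ∑ i, (l i / r) ^ (2 * K) * (u i y * u i y)) := by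
        rw [← Finset.sum_add_distrib, ← Finset.sum_add_distrib, ← Finset.sum_add_distrib,
          Finset.mul_sum]
        refine Finset.sum_congr rfl fun i _ => ?_
        ring
    _ ≤ r ^ a / 2 * (1 + 1 + 1 + 1) := by
        have e1 := h1 x x
        have e2 := h1 y y
        rw [if_pos rfl] at e1 e2
        rw [e1, e2]
        have := hS' x hx
        have := hS' y hy
        gcongr
    _ = 2 * r ^ a := by ring

/-- In an orthonormal eigenbasis v_i of A + B, the eigenvalue is ⟨v_i, A v_i⟩ + ⟨v_i, B v_i⟩.
Convexity of t^{2n} separates the two summands. Jensen's inequality for the spectral measure of A at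
v_i gives ⟨v_i, A v_i⟩^{2n} ≤ ⟨v_i, A^{2n} v_i⟩, and summation over i restores the trace. -/
theorem trace_add_pow_two_mul_le {A B : Matrix V V ℝ} (hA : A.IsSymm) (hB : B.IsSymm) (n : ℕ) :
    ((A + B) ^ (2 * n)).trace ≤
      2 ^ (2 * n - 1) * ((A ^ (2 * n)).trace + (B ^ (2 * n)).trace) := by
  obtain ⟨l, v, h, ho, ho'⟩ := exists_spectral_decomposition (hA.add hB)
  have htr : ∀ C : Matrix V V ℝ, ∑ i, ∑ x, ∑ y, v i x * C x y * v i y = C.trace := by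
    intro C
    rw [Finset.sum_comm]
    calc _ = ∑ x, ∑ y, C x y * ∑ i, v i x * v i y := by
          refine Finset.sum_congr rfl fun x _ => ?_
          rw [Finset.sum_comm]
          refine Finset.sum_congr rfl fun y _ => ?_
          rw [Finset.mul_sum]
          exact Finset.sum_congr rfl fun i _ => by ring
      _ = _ := by simp [ho', Matrix.trace]
  have hjen : ∀ {C : Matrix V V ℝ}, C.IsSymm → ∀ i,
      (∑ x, ∑ y, v i x * C x y * v i y) ^ (2 * n) ≤ ∑ x, ∑ y, v i x * (C ^ (2 * n)) x y * v i y := by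
    intro C hC i
    obtain ⟨k, u, hk, -, hu⟩ := exists_spectral_decomposition hC
    have key : ∀ m, ∑ x, ∑ y, v i x * (C ^ m) x y * v i y =
        ∑ j, (∑ x, u j x * v i x) ^ 2 * k j ^ m := by
      intro m
      calc _ = ∑ x, ∑ y, ∑ j, k j ^ m * ((u j x * v i x) * (u j y * v i y)) := by
            refine Finset.sum_congr rfl fun x _ => Finset.sum_congr rfl fun y _ => ?_
            rw [hk, Finset.mul_sum, Finset.sum_mul]
            exact Finset.sum_congr rfl fun j _ => by ring
        _ = ∑ j, ∑ x, ∑ y, k j ^ m * ((u j x * v i x) * (u j y * v i y)) := by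
            rw [Finset.sum_comm (γ := V) (s := Finset.univ (α := V))
              (f := fun j x => ∑ y, k j ^ m * ((u j x * v i x) * (u j y * v i y)))]
            exact Finset.sum_congr rfl fun x _ => Finset.sum_comm
        _ = _ := by
            refine Finset.sum_congr rfl fun j _ => ?_
            rw [sq, Finset.sum_mul_sum, Finset.sum_mul]
            refine Finset.sum_congr rfl fun x _ => ?_
            rw [Finset.sum_mul]
            exact Finset.sum_congr rfl fun y _ => by ring
    have hw : ∑ j, (∑ x, u j x * v i x) ^ 2 = 1 := by
      have := key 0
      simp only [pow_zero, mul_one, Matrix.one_apply] at this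
      rw [← this]
      simpa using ho i i
    have := Real.pow_arith_mean_le_arith_mean_pow_of_even Finset.univ
      (fun j => (∑ x, u j x * v i x) ^ 2) k (fun j _ => sq_nonneg _) hw (even_two_mul n)
    rw [key (2 * n)]
    have h1 := key 1
    simp only [pow_one] at h1
    rw [h1]; exact this
  have hl : ∀ i, l i = (∑ x, ∑ y, v i x * A x y * v i y) + ∑ x, ∑ y, v i x * B x y * v i y := by
    intro i
    have e1 : ∀ x y, A x y + B x y = ∑ j, l j * (v j x * v j y) := by
      intro x y
      have := h 1 x y
      simpa using this
    calc l i = ∑ j, l j * ((∑ x, v i x * v j x) * (∑ y, v j y * v i y)) := by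
          simp [ho]
      _ = ∑ j, ∑ x, ∑ y, v i x * (l j * (v j x * v j y)) * v i y := by
          refine Finset.sum_congr rfl fun j _ => ?_
          rw [Finset.sum_mul_sum, Finset.mul_sum]
          refine Finset.sum_congr rfl fun x _ => ?_
          rw [Finset.mul_sum]
          exact Finset.sum_congr rfl fun y _ => by ring
      _ = ∑ x, ∑ y, v i x * (A x y + B x y) * v i y := by
          rw [Finset.sum_comm]
          refine Finset.sum_congr rfl fun x _ => ?_
          rw [Finset.sum_comm]
          refine Finset.sum_congr rfl fun y _ => ?_
          rw [e1, Finset.mul_sum, Finset.sum_mul]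
      _ = _ := by
          rw [← Finset.sum_add_distrib]
          refine Finset.sum_congr rfl fun x _ => ?_
          rw [← Finset.sum_add_distrib]
          exact Finset.sum_congr rfl fun y _ => by ring
  have ht : ((A + B) ^ (2 * n)).trace = ∑ i, l i ^ (2 * n) := by
    simp only [Matrix.trace, Matrix.diag, h]
    rw [Finset.sum_comm]
    refine Finset.sum_congr rfl fun i _ => ?_
    rw [← Finset.mul_sum, ho, if_pos rfl, mul_one]
  rw [ht, ← htr (A ^ (2 * n)), ← htr (B ^ (2 * n)), ← Finset.sum_add_distrib, Finset.mul_sum]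
  refine Finset.sum_le_sum fun i _ => ?_
  rw [hl i]
  refine ((even_two_mul n).add_pow_le).trans ?_
  have := hjen hA i
  have := hjen hB i
  gcongr

/-- Telescoping; the starting point of the perturbation estimates, since the middle factor B − A
will be supported at few positions. -/
theorem pow_sub_pow_eq_sum (A B : Matrix V V ℝ) (n : ℕ) :
    B ^ n - A ^ n = ∑ a ∈ Finset.range n, A ^ a * (B - A) * B ^ (n - 1 - a) := by
  induction n with
  | zero => simp
  | succ n ih =>
    rw [Finset.sum_range_succ]
    have : ∀ a ∈ Finset.range n, A ^ a * (B - A) * B ^ (n + 1 - 1 - a) =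
        (A ^ a * (B - A) * B ^ (n - 1 - a)) * B := by
      intro a ha
      rw [Finset.mem_range] at ha
      rw [Matrix.mul_assoc _ _ B, ← pow_succ]
      congr 2; omega
    rw [Finset.sum_congr rfl this, ← Finset.sum_mul, ← ih]
    simp [pow_succ, sub_mul, mul_sub]

end Spectral

/-! ### Regular adjacency matrices and counts of alternating four-cycles. -/

/-- `X` is the real adjacency matrix of a `d`-regular simple graph. -/
structure IsRegularAdj {N : ℕ} (X : Matrix (Fin N) (Fin N) ℝ) (d : ℝ) : Prop where
  symm : ∀ i j, X i j = X j i
  zero_or_one : ∀ i j, X i j = 0 ∨ X i j = 1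
  diag : ∀ i, X i i = 0
  row_sum : ∀ i, ∑ j, X i j = d

/-- The all-ones matrix. -/
def onesMat (N : ℕ) : Matrix (Fin N) (Fin N) ℝ := Matrix.of fun _ _ => 1

/-- The adjacency matrix of the complementary graph. -/
def coAdj {N : ℕ} (X : Matrix (Fin N) (Fin N) ℝ) : Matrix (Fin N) (Fin N) ℝ := onesMat N - 1 - X

/-- The variance scale `d (1 - d / N)` of a row of a centered regular adjacency matrix. -/
noncomputable def rowVar (N : ℕ) (d : ℝ) : ℝ := d * (N - d) / N

/-- The adjacency matrix centered so that its rows sum to zero. -/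
noncomputable def centered {N : ℕ} (d : ℝ) (X : Matrix (Fin N) (Fin N) ℝ) :
    Matrix (Fin N) (Fin N) ℝ := X - (d / N) • onesMat N

/-- The indicator that `i ~ j` and `k ~ l` are edges while `j k` and `l i` are non-adjacent pairs of
distinct vertices. -/
def altCycle {N : ℕ} (X : Matrix (Fin N) (Fin N) ℝ) (i j k l : Fin N) : ℝ :=
  X i j * coAdj X j k * (X k l * coAdj X l i)

@[simp] theorem onesMat_apply {N : ℕ} (i j : Fin N) : onesMat N i j = 1 := rfl

theorem onesMat_mul_onesMat (N : ℕ) : onesMat N * onesMat N = (N : ℝ) • onesMat N := by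
  ext i j; simp [Matrix.mul_apply]

namespace IsRegularAdj

variable {N : ℕ} {X : Matrix (Fin N) (Fin N) ℝ} {d : ℝ}

theorem nonneg (h : IsRegularAdj X d) (i j : Fin N) : 0 ≤ X i j := by
  rcases h.zero_or_one i j with h | h <;> simp [h]

theorem le_one (h : IsRegularAdj X d) (i j : Fin N) : X i j ≤ 1 := by
  rcases h.zero_or_one i j with h | h <;> simp [h]

theorem isSymm (h : IsRegularAdj X d) : X.IsSymm := by
  ext i j; exact h.symm j i

theorem coAdj_apply (X : Matrix (Fin N) (Fin N) ℝ) (i j : Fin N) :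
    coAdj X i j = 1 - (if i = j then 1 else 0) - X i j := by
  simp [coAdj, Matrix.one_apply]

theorem coAdj_self (h : IsRegularAdj X d) (i : Fin N) : coAdj X i i = 0 := by
  simp [coAdj_apply, h.diag]

theorem coAdj_zero_or_one (h : IsRegularAdj X d) (i j : Fin N) :
    coAdj X i j = 0 ∨ coAdj X i j = 1 := by
  rw [coAdj_apply]
  by_cases hij : i = j
  · subst hij; simp [h.diag]
  · rcases h.zero_or_one i j with h | h <;> simp [h, hij]

theorem coAdj_symm (h : IsRegularAdj X d) (i j : Fin N) : coAdj X i j = coAdj X j i := by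
  rw [coAdj_apply, coAdj_apply, h.symm i j]; simp [eq_comm]

theorem coAdj_nonneg (h : IsRegularAdj X d) (i j : Fin N) : 0 ≤ coAdj X i j := by
  rcases h.coAdj_zero_or_one i j with h | h <;> simp [h]

theorem coAdj_le_one (h : IsRegularAdj X d) (i j : Fin N) : coAdj X i j ≤ 1 := by
  rcases h.coAdj_zero_or_one i j with h | h <;> simp [h]

theorem d_nonneg (h : IsRegularAdj X d) (hN : 0 < N) : 0 ≤ d := by
  rw [← h.row_sum ⟨0, hN⟩]; exact Finset.sum_nonneg fun j _ => h.nonneg _ _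

theorem d_le (h : IsRegularAdj X d) (hN : 0 < N) : d ≤ N := by
  rw [← h.row_sum ⟨0, hN⟩]
  refine (Finset.sum_le_sum fun j _ => h.le_one _ _).trans ?_
  simp

theorem row_sum_coAdj (h : IsRegularAdj X d) (i : Fin N) : ∑ j, coAdj X i j = N - 1 - d := by
  simp [coAdj_apply, Finset.sum_sub_distrib, h.row_sum]

theorem mul_onesMat (h : IsRegularAdj X d) : X * onesMat N = d • onesMat N := by
  ext i j; simp [Matrix.mul_apply, h.row_sum]

theorem onesMat_mul (h : IsRegularAdj X d) : onesMat N * X = d • onesMat N := by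
  ext i j
  simp only [Matrix.mul_apply, onesMat_apply, one_mul, Matrix.smul_apply, smul_eq_mul, mul_one]
  rw [← h.row_sum j]
  exact Finset.sum_congr rfl fun k _ => h.symm k j

theorem mul_coAdj (h : IsRegularAdj X d) : X * coAdj X = d • onesMat N - X - X * X := by
  rw [coAdj, mul_sub, mul_sub, h.mul_onesMat, mul_one]

theorem mul_coAdj_nonneg (h : IsRegularAdj X d) (x y : Fin N) : 0 ≤ (X * coAdj X) x y := by
  rw [Matrix.mul_apply]
  exact Finset.sum_nonneg fun l _ => mul_nonneg (h.nonneg _ _) (h.coAdj_nonneg _ _)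

/-- The count is at most min(d, N − d), and this is at most 2d(N − d)/N because the larger of d and
N − d is at least N/2. Bounding by σ treats sparse and dense graphs alike. -/
theorem mul_coAdj_le (h : IsRegularAdj X d) (x y : Fin N) :
    (X * coAdj X) x y ≤ 2 * rowVar N d := by
  have hN : 0 < N := x.pos
  have hN' : (0 : ℝ) < N := by exact_mod_cast hN
  have h0 := h.d_nonneg hN
  have h1 := h.d_le hN
  have e1 : (X * coAdj X) x y ≤ d := by
    rw [Matrix.mul_apply, ← h.row_sum x]
    exact Finset.sum_le_sum fun l _ =>
      mul_le_of_le_one_right (h.nonneg _ _) (h.coAdj_le_one _ _)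
  have e2 : (X * coAdj X) x y ≤ N - d := by
    have := h.row_sum_coAdj y
    rw [Matrix.mul_apply]
    refine (Finset.sum_le_sum (g := fun l => coAdj X y l) fun l _ => ?_).trans (by linarith)
    rw [h.coAdj_symm y l]
    exact mul_le_of_le_one_left (h.coAdj_nonneg _ _) (h.le_one _ _)
  rw [rowVar, ← mul_div_assoc, le_div_iff₀ hN']
  rcases le_total d (N - d) with h2 | h2 <;> nlinarith

theorem rowVar_nonneg (h : IsRegularAdj X d) (hN : 0 < N) : 0 ≤ rowVar N d :=
  div_nonneg (mul_nonneg (h.d_nonneg hN) (sub_nonneg.2 (h.d_le hN))) (Nat.cast_nonneg _)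

theorem two_mul_rowVar_le (hN : 0 < N) : 2 * rowVar N d ≤ N := by
  have hN' : (0 : ℝ) < N := by exact_mod_cast hN
  rw [rowVar, ← mul_div_assoc, div_le_iff₀ hN']
  nlinarith [sq_nonneg ((N : ℝ) - 2 * d)]

theorem rowVar_le (h : IsRegularAdj X d) (hN : 0 < N) : rowVar N d ≤ d := by
  have hN' : (0 : ℝ) < N := by exact_mod_cast hN
  have := h.d_nonneg hN
  rw [rowVar, div_le_iff₀ hN']
  nlinarith

theorem rowVar_eq (hN : 0 < N) : rowVar N d = d - d ^ 2 / N := by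
  have hN' : (N : ℝ) ≠ 0 := by positivity
  rw [rowVar]; field_simp

theorem centered_isSymm (h : IsRegularAdj X d) : (centered d X).IsSymm := by
  ext i j; simp [centered, h.symm i j]

/-- This orthogonality lets polynomials in X be rewritten in Y up to multiples of the all-ones
matrix. -/
theorem centered_mul_onesMat (h : IsRegularAdj X d) : centered d X * onesMat N = 0 := by
  rcases Nat.eq_zero_or_pos N with h0 | hN
  · subst h0; ext i; exact i.elim0
  have hN' : (N : ℝ) ≠ 0 := by positivity
  rw [centered, sub_mul, h.mul_onesMat, smul_mul_assoc, onesMat_mul_onesMat, smul_smul,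
    div_mul_cancel₀ _ hN', sub_self]

theorem onesMat_mul_centered (h : IsRegularAdj X d) : onesMat N * centered d X = 0 := by
  have := congrArg Matrix.transpose h.centered_mul_onesMat
  rw [Matrix.transpose_mul, h.centered_isSymm.eq, Matrix.transpose_zero] at this
  exact this

theorem centered_pow_two (h : IsRegularAdj X d) :
    centered d X ^ 2 = X * X - (d ^ 2 / N) • onesMat N := by
  rw [sq]
  nth_rewrite 2 [centered]
  rw [mul_sub, mul_smul_comm, h.centered_mul_onesMat, smul_zero, sub_zero, centered, sub_mul,
    smul_mul_assoc, h.onesMat_mul, smul_smul]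
  congr 2; ring

theorem centered_pow_three (h : IsRegularAdj X d) :
    centered d X ^ 3 = X * X * X - (d ^ 3 / N) • onesMat N := by
  rw [pow_succ]
  nth_rewrite 2 [centered]
  rw [mul_sub, mul_smul_comm, sq (centered d X), mul_assoc _ _ (onesMat N), h.centered_mul_onesMat,
    mul_zero, smul_zero, sub_zero, ← sq (centered d X), h.centered_pow_two, sub_mul, smul_mul_assoc,
    h.onesMat_mul, smul_smul]
  congr 2; ring

theorem mul_coAdj_eq_centered (h : IsRegularAdj X d) (hN : 0 < N) :
    X * coAdj X = (rowVar N d - d / N) • onesMat N - centered d X - centered d X ^ 2 := by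
  rw [h.mul_coAdj, h.centered_pow_two, rowVar_eq hN, centered]
  ext i j; simp; ring

theorem sq_apply_self (h : IsRegularAdj X d) (i : Fin N) : (X * X) i i = d := by
  rw [Matrix.mul_apply, ← h.row_sum i]
  refine Finset.sum_congr rfl fun j _ => ?_
  rw [h.symm j i]
  rcases h.zero_or_one i j with h | h <;> simp [h]

theorem centered_sq_apply_self (h : IsRegularAdj X d) (i : Fin N) :
    (centered d X ^ 2) i i = rowVar N d := by
  rw [h.centered_pow_two, rowVar_eq i.pos]
  simp [h.sq_apply_self]

theorem abs_centered_le (h : IsRegularAdj X d) (i j : Fin N) : |centered d X i j| ≤ 1 := by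
  have hN' : (0 : ℝ) < N := by exact_mod_cast i.pos
  have h1 : 0 ≤ d / N := div_nonneg (h.d_nonneg i.pos) hN'.le
  have h2 : d / N ≤ 1 := (div_le_one hN').2 (h.d_le i.pos)
  simp only [centered, Matrix.sub_apply, Matrix.smul_apply, onesMat_apply, smul_eq_mul, mul_one]
  rcases h.zero_or_one i j with h | h <;> rw [h, abs_le] <;> constructor <;> linarith

theorem abs_centered_sq_le (h : IsRegularAdj X d) (i j : Fin N) :
    |(centered d X ^ 2) i j| ≤ rowVar N d + 1 := by
  have e : (centered d X ^ 2) i j = rowVar N d - X i j - (X * coAdj X) i j := by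
    rw [h.mul_coAdj_eq_centered i.pos, centered]; simp
  have h1 := h.mul_coAdj_nonneg i j
  have h2 := h.mul_coAdj_le i j
  have h3 := h.nonneg i j
  have h4 := h.le_one i j
  rw [e, abs_le]; constructor <;> linarith

theorem sum_altCycle_eq (h : IsRegularAdj X d) (i j : Fin N) :
    ∑ k, ∑ l, altCycle X i j k l = X i j * (coAdj X * X * coAdj X) i j := by
  rw [mul_assoc, Matrix.mul_apply, Finset.mul_sum, Finset.sum_comm]
  simp only [Matrix.mul_apply, Finset.mul_sum]
  refine Finset.sum_congr rfl fun l _ => Finset.sum_congr rfl fun k _ => ?_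
  rw [altCycle, h.coAdj_symm j k, h.symm k l, h.coAdj_symm l i]; ring

theorem sum_altCycle_swap_eq (h : IsRegularAdj X d) (i j : Fin N) :
    ∑ k, ∑ l, altCycle X i l k j = coAdj X i j * (X * coAdj X * X) i j := by
  rw [mul_assoc, Matrix.mul_apply, Finset.mul_sum, Finset.sum_comm]
  simp only [Matrix.mul_apply, Finset.mul_sum]
  refine Finset.sum_congr rfl fun l _ => Finset.sum_congr rfl fun k _ => ?_
  rw [altCycle, h.coAdj_symm j i]; ring

/-- Both counts are polynomials in X, hence in Y up to multiples of the all-ones matrix. Their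
difference is κY_ij + (Y³)_ij up to O(σ), with κ = Nσ + 1 − d − σ. The imbalance between switchings
destroying and creating the edge ij is thus essentially proportional to Y_ij, which opens Y to
integration by parts. On the diagonal the counts vanish and the polynomial is bounded crudely,
whence the term N. -/
theorem abs_sum_altCycle_sub_le (h : IsRegularAdj X d) (hσ : 1 ≤ rowVar N d) (i j : Fin N) :
    |∑ k, ∑ l, (altCycle X i j k l - altCycle X i l k j) -
      ((N * rowVar N d + 1 - d - rowVar N d) * centered d X i j + (centered d X ^ 3) i j)| ≤
      6 * rowVar N d * (1 + if i = j then (N : ℝ) else 0) := by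
  have hN := i.pos
  have hN' : (1 : ℝ) ≤ N := by exact_mod_cast hN
  have hd0 := h.d_nonneg hN
  have hd1 := h.d_le hN
  simp only [Finset.sum_sub_distrib, h.sum_altCycle_eq, h.sum_altCycle_swap_eq]
  have hp0 : 0 ≤ d / N := by positivity
  have hp1 : d / N ≤ 1 := (div_le_one (by linarith)).2 hd1
  have hy2 := abs_le.1 (h.abs_centered_sq_le i j)
  by_cases hij : i = j
  · subst hij
    rw [h.diag, h.coAdj_self, zero_mul, zero_mul, if_pos rfl, sub_zero, zero_sub, abs_neg]
    have e3 : |(centered d X ^ 3) i i| ≤ N * (rowVar N d + 1) := by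
      rw [pow_succ', Matrix.mul_apply]
      refine (Finset.abs_sum_le_sum_abs _ _).trans ?_
      refine (Finset.sum_le_sum (g := fun _ => rowVar N d + 1) fun k _ => ?_).trans (by
        simp [mul_add])
      rw [abs_mul]
      exact (mul_le_of_le_one_left (abs_nonneg _) (h.abs_centered_le _ _)).trans
        (h.abs_centered_sq_le _ _)
    have e1 : |(N * rowVar N d + 1 - d - rowVar N d) * centered d X i i| ≤
        N * rowVar N d + 1 + d + rowVar N d := by
      rw [abs_mul]
      refine (mul_le_of_le_one_right (abs_nonneg _) (h.abs_centered_le _ _)).trans ?_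
      rw [abs_le]; constructor <;> nlinarith
    refine (abs_add_le _ _).trans ?_
    nlinarith
  · rw [if_neg hij, add_zero, mul_one]
    have c1 : (coAdj X * X * coAdj X) i j = d * (N - 1 - d) - d - d ^ 2 + X i j +
        2 * (X * X) i j + (X * X * X) i j := by
      have hcx : coAdj X * X = d • onesMat N - X - X * X := by
        rw [coAdj, sub_mul, sub_mul, h.onesMat_mul, one_mul]
      have hUc : onesMat N * coAdj X = (N - 1 - d) • onesMat N := by
        rw [coAdj, mul_sub, mul_sub, onesMat_mul_onesMat, mul_one, h.onesMat_mul]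
        ext a b; simp
      rw [hcx, sub_mul, sub_mul, smul_mul_assoc, hUc, mul_assoc X X, h.mul_coAdj, mul_sub, mul_sub,
        mul_smul_comm, h.mul_onesMat]
      simp [mul_assoc]; ring
    have c2 : (X * coAdj X * X) i j = d ^ 2 - (X * X) i j - (X * X * X) i j := by
      rw [h.mul_coAdj, sub_mul, sub_mul, smul_mul_assoc, h.onesMat_mul]
      simp; ring
    have c3 : coAdj X i j = 1 - X i j := by simp [coAdj_apply, hij]
    have c4 : (X * X) i j = (centered d X ^ 2) i j + d ^ 2 / N := by
      rw [h.centered_pow_two]; simp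
    have c5 : (X * X * X) i j = (centered d X ^ 3) i j + d ^ 3 / N := by
      rw [h.centered_pow_three]; simp
    have c6 : centered d X i j = X i j - d / N := by simp [centered]
    have hX : X i j * X i j = X i j := by
      rcases h.zero_or_one i j with h | h <;> simp [h]
    -- After cancellation only multiples of (Y²)_ij and a scalar of size at most σ survive, and
    -- (Y²)_ij is O(σ).
    have key : X i j * (coAdj X * X * coAdj X) i j - coAdj X i j * (X * coAdj X * X) i j -
        ((N * rowVar N d + 1 - d - rowVar N d) * centered d X i j + (centered d X ^ 3) i j) =
        X i j * (centered d X ^ 2) i j + (centered d X ^ 2) i j + d / N * (1 - rowVar N d) := by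
      rw [c1, c2, c3, c5, c4, c6, rowVar_eq hN]
      generalize (centered d X ^ 2) i j = y2
      generalize (centered d X ^ 3) i j = y3
      have hN0 : (N : ℝ) ≠ 0 := by positivity
      rcases h.zero_or_one i j with h | h <;> rw [h] <;> field_simp <;> ring
    rw [key]
    have hx0 := h.nonneg i j
    have hx1 := h.le_one i j
    have h5 : |X i j * (centered d X ^ 2) i j| ≤ rowVar N d + 1 := by
      rw [abs_mul]
      exact (mul_le_of_le_one_left (abs_nonneg _) (by rw [abs_le]; constructor <;> linarith)).trans
        (h.abs_centered_sq_le _ _)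
    have h6 : |d / N * (1 - rowVar N d)| ≤ rowVar N d := by
      rw [abs_mul]
      exact (mul_le_of_le_one_left (abs_nonneg _) (by rw [abs_le]; constructor <;> linarith)).trans
        (by rw [abs_le]; constructor <;> linarith)
    refine (abs_add_le _ _).trans ((add_le_add (abs_add_le _ _) le_rfl).trans ?_)
    have := h.abs_centered_sq_le i j
    linarith

/-- The sum is a diagonal entry of the square of `X * coAdj X` = αU − Y − Y², where U is the
all-ones matrix, α = σ − d/N and UY = YU = 0. The square of αU gives the leading term. The odd entry
(Y³)_ii is absorbed by (Y²)_ii and (Y⁴)_ii through 2ab ≤ a² + b². -/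
theorem abs_sum_altCycle_sub_rowVar_sq_le (h : IsRegularAdj X d) (hσ : 1 ≤ rowVar N d)
    (i : Fin N) :
    |∑ j, ∑ k, ∑ l, altCycle X i j k l - N * rowVar N d ^ 2| ≤
      5 * (N * rowVar N d) + 2 * (centered d X ^ 4) i i := by
  have hN := i.pos
  have hN' : (1 : ℝ) ≤ N := by exact_mod_cast hN
  have hd0 := h.d_nonneg hN
  have hd1 := h.d_le hN
  have hp0 : 0 ≤ d / N := by positivity
  have hp1 : d / N ≤ 1 := (div_le_one (by linarith)).2 hd1
  have e1 : ∑ j, ∑ k, ∑ l, altCycle X i j k l = (X * coAdj X * (X * coAdj X)) i i := by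
    rw [Matrix.mul_apply]
    simp only [Matrix.mul_apply, Finset.sum_mul_sum]
    rw [Finset.sum_comm]
    rfl
  have e2 : (X * coAdj X * (X * coAdj X)) i i = N * (rowVar N d - d / N) ^ 2 + rowVar N d +
      2 * (centered d X ^ 3) i i + (centered d X ^ 4) i i := by
    have hs := h.centered_sq_apply_self i
    rw [h.mul_coAdj_eq_centered hN]
    set Y := centered d X
    set U := onesMat N
    have h1 : Y * U = 0 := h.centered_mul_onesMat
    have h2 : U * Y = 0 := h.onesMat_mul_centered
    have h3 : U * U = (N : ℝ) • U := onesMat_mul_onesMat N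
    generalize rowVar N d - d / N = α
    have : (α • U - Y - Y ^ 2) * (α • U - Y - Y ^ 2) =
        (α ^ 2 * N) • U + Y ^ 2 + (2 : ℝ) • Y ^ 3 + Y ^ 4 := by
      have h4 : Y ^ 2 * U = 0 := by rw [sq, mul_assoc, h1, mul_zero]
      have h5 : U * Y ^ 2 = 0 := by rw [sq, ← mul_assoc, h2, zero_mul]
      simp only [sub_mul, mul_sub, smul_mul_assoc, mul_smul_comm, h1, h2, h3, h4, h5, smul_zero,
        smul_smul, sub_zero, zero_sub]
      rw [← pow_succ, ← pow_succ', ← pow_add, ← sq, two_smul]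
      rw [show α * (α * N) = α ^ 2 * N by ring]
      abel
    rw [this, ← hs]
    simp [U]; ring
  have e3 : |2 * (centered d X ^ 3) i i| ≤ rowVar N d + (centered d X ^ 4) i i := by
    have hs := h.centered_isSymm
    have q1 := sum_sq_pow_apply hs 1 i
    have q2 := sum_sq_pow_apply hs 2 i
    have q3 : (centered d X ^ 3) i i = ∑ y, centered d X i y * (centered d X ^ 2) i y := by
      rw [pow_succ', Matrix.mul_apply]
      exact Finset.sum_congr rfl fun y _ => by rw [(isSymm_pow hs 2).apply i y]
    rw [pow_one, mul_one, h.centered_sq_apply_self] at q1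
    rw [← q1, show 4 = 2 * 2 from rfl, ← q2, q3, ← Finset.sum_add_distrib, Finset.mul_sum]
    refine (Finset.abs_sum_le_sum_abs _ _).trans (Finset.sum_le_sum fun y _ => ?_)
    rw [abs_le]
    constructor <;> nlinarith [sq_nonneg (centered d X i y + (centered d X ^ 2) i y),
      sq_nonneg (centered d X i y - (centered d X ^ 2) i y)]
  rw [e1, e2]
  rw [abs_le] at e3 ⊢
  have e4 : N * (rowVar N d - d / N) ^ 2 = N * rowVar N d ^ 2 - 2 * (d / N) * (N * rowVar N d)
    + (d / N) ^ 2 * N := by ring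
  have h7 : d / N * (N * rowVar N d) ≤ N * rowVar N d :=
    mul_le_of_le_one_left (by positivity) hp1
  have h8 : 0 ≤ d / N * (N * rowVar N d) := by positivity
  have h9 : (d / N) ^ 2 * N ≤ N * rowVar N d := by
    have : (d / N) ^ 2 ≤ 1 := pow_le_one₀ hp0 hp1
    nlinarith
  have h10 : 0 ≤ (d / N) ^ 2 * N := by positivity
  have h11 : rowVar N d ≤ N * rowVar N d := le_mul_of_one_le_left (by linarith) hN'
  constructor <;> linarith [e3.1, e3.2]

/-- Sums weighted by `altCycle` are invariant under the reflection of quadruples. -/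
theorem sum_altCycle_mul_swap (h : IsRegularAdj X d) (F : Fin N → Fin N → Fin N → Fin N → ℝ) :
    ∑ i, ∑ j, ∑ k, ∑ l, altCycle X i j k l * F i j k l =
      ∑ i, ∑ j, ∑ k, ∑ l, altCycle X i j k l * F j i l k := by
  rw [Finset.sum_comm]
  refine Finset.sum_congr rfl fun i _ => Finset.sum_congr rfl fun j _ => ?_
  rw [Finset.sum_comm]
  refine Finset.sum_congr rfl fun k _ => Finset.sum_congr rfl fun l _ => ?_
  rw [altCycle, altCycle, h.symm j i, h.symm l k, h.coAdj_symm i l, h.coAdj_symm k j]; ring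

/-- Together with the reflection, this rotation by two steps moves any corner to any other while
respecting the alternation, so estimates are needed at one corner only. -/
theorem sum_altCycle_mul_rotate (F : Fin N → Fin N → Fin N → Fin N → ℝ) :
    ∑ i, ∑ j, ∑ k, ∑ l, altCycle X i j k l * F i j k l =
      ∑ i, ∑ j, ∑ k, ∑ l, altCycle X i j k l * F k l i j := by
  have : ∀ G : Fin N → Fin N → Fin N → Fin N → ℝ,
      ∑ i, ∑ j, ∑ k, ∑ l, G i j k l = ∑ p : Fin N × Fin N, ∑ q : Fin N × Fin N,
        G p.1 p.2 q.1 q.2 := by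
    intro G; simp only [Fintype.sum_prod_type]
  rw [this, this, Finset.sum_comm]
  refine Finset.sum_congr rfl fun p _ => Finset.sum_congr rfl fun q _ => ?_
  rw [altCycle, altCycle]; ring

theorem sum_coAdj_mul_le (h : IsRegularAdj X d) (k i : Fin N) :
    ∑ l, X k l * coAdj X l i ≤ 2 * rowVar N d := by
  have := h.mul_coAdj_le k i
  rwa [Matrix.mul_apply] at this

/-- For fixed opposite corners the sums over the other two decouple, and each is an entry of `X *
coAdj X`, at most 2σ. -/
theorem sum_altCycle_opposite_le (h : IsRegularAdj X d) {f : Fin N → Fin N → ℝ}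
    (hf : ∀ x y, 0 ≤ f x y) :
    ∑ i, ∑ j, ∑ k, ∑ l, altCycle X i j k l * f i k ≤
      (2 * rowVar N d) ^ 2 * ∑ x, ∑ y, f x y := by
  rw [Finset.mul_sum]
  refine Finset.sum_le_sum fun i _ => ?_
  rw [Finset.sum_comm, Finset.mul_sum]
  refine Finset.sum_le_sum fun k _ => ?_
  have hσ := h.rowVar_nonneg i.pos
  calc ∑ j, ∑ l, altCycle X i j k l * f i k
      = (∑ j, X i j * coAdj X j k) * (∑ l, X k l * coAdj X l i) * f i k := by
        rw [Finset.sum_mul_sum, Finset.sum_mul]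
        refine Finset.sum_congr rfl fun j _ => ?_
        rw [Finset.sum_mul]; rfl
    _ ≤ (2 * rowVar N d) * (2 * rowVar N d) * f i k := by
        refine mul_le_mul_of_nonneg_right ?_ (hf _ _)
        exact mul_le_mul (h.sum_coAdj_mul_le _ _) (h.sum_coAdj_mul_le _ _)
          (Finset.sum_nonneg fun l _ => mul_nonneg (h.nonneg _ _) (h.coAdj_nonneg _ _))
          (by linarith)
    _ = _ := by ring

theorem mul_coAdj_apply_nonneg (h : IsRegularAdj X d) (k i : Fin N) :
    0 ≤ ∑ l, X k l * coAdj X l i :=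
  Finset.sum_nonneg fun _ _ => mul_nonneg (h.nonneg _ _) (h.coAdj_nonneg _ _)

theorem sum_altCycle_vertex_le (h : IsRegularAdj X d) {f : Fin N → ℝ} (hf : ∀ x, 0 ≤ f x) :
    ∑ i, ∑ j, ∑ k, ∑ l, altCycle X i j k l * f i ≤
      4 * (N * rowVar N d ^ 2) * ∑ x, f x := by
  refine (h.sum_altCycle_opposite_le (f := fun x _ => f x) fun x _ => hf x).trans (le_of_eq ?_)
  simp only [Finset.sum_const, Finset.card_univ, Fintype.card_fin, nsmul_eq_mul]
  rw [← Finset.mul_sum]; ring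

/-- With i and j fixed, k is free and l contributes at most 2σ. The rate 2Nσ at a pair is smaller
than the rate 4Nσ² at a vertex by the factor 2σ; this gain later makes off-diagonal terms
negligible. -/
theorem sum_altCycle_edge_le (h : IsRegularAdj X d) {f : Fin N → Fin N → ℝ}
    (hf : ∀ x y, 0 ≤ f x y) :
    ∑ i, ∑ j, ∑ k, ∑ l, altCycle X i j k l * f i j ≤
      2 * (N * rowVar N d) * ∑ x, ∑ y, f x y := by
  rw [Finset.mul_sum]
  refine Finset.sum_le_sum fun i _ => ?_
  rw [Finset.mul_sum]
  refine Finset.sum_le_sum fun j _ => ?_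
  have hσ := h.rowVar_nonneg i.pos
  calc ∑ k, ∑ l, altCycle X i j k l * f i j
      = (∑ k, X i j * coAdj X j k * (∑ l, X k l * coAdj X l i)) * f i j := by
        rw [Finset.sum_mul]
        refine Finset.sum_congr rfl fun j _ => ?_
        rw [Finset.mul_sum, Finset.sum_mul]; rfl
    _ ≤ (∑ k : Fin N, 2 * rowVar N d) * f i j := by
        refine mul_le_mul_of_nonneg_right (Finset.sum_le_sum fun k _ => ?_) (hf _ _)
        refine (mul_le_of_le_one_left (h.mul_coAdj_apply_nonneg k i) ?_).trans
          (h.sum_coAdj_mul_le _ _)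
        exact mul_le_one₀ (h.le_one _ _) (h.coAdj_nonneg _ _) (h.coAdj_le_one _ _)
    _ = _ := by rw [Finset.sum_const, Finset.card_univ, Fintype.card_fin, nsmul_eq_mul]; ring

theorem sum_altCycle_nonedge_le (h : IsRegularAdj X d) {f : Fin N → Fin N → ℝ}
    (hf : ∀ x y, 0 ≤ f x y) :
    ∑ i, ∑ j, ∑ k, ∑ l, altCycle X i j k l * f i l ≤
      2 * (N * rowVar N d) * ∑ x, ∑ y, f x y := by
  rw [Finset.mul_sum]
  refine Finset.sum_le_sum fun i _ => ?_
  rw [Finset.mul_sum, Finset.sum_congr rfl fun j _ => Finset.sum_comm, Finset.sum_comm]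
  refine Finset.sum_le_sum fun l _ => ?_
  have hσ := h.rowVar_nonneg i.pos
  calc ∑ j, ∑ k, altCycle X i j k l * f i l
      = (∑ k, (X k l * coAdj X l i) * (∑ j, X i j * coAdj X j k)) * f i l := by
        rw [Finset.sum_comm, Finset.sum_mul]
        refine Finset.sum_congr rfl fun k _ => ?_
        rw [Finset.mul_sum, Finset.sum_mul]
        exact Finset.sum_congr rfl fun j _ => by rw [altCycle]; ring
    _ ≤ (∑ k : Fin N, 2 * rowVar N d) * f i l := by
        refine mul_le_mul_of_nonneg_right (Finset.sum_le_sum fun k _ => ?_) (hf _ _)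
        refine (mul_le_of_le_one_left (h.mul_coAdj_apply_nonneg i k) ?_).trans
          (h.sum_coAdj_mul_le _ _)
        exact mul_le_one₀ (h.le_one _ _) (h.coAdj_nonneg _ _) (h.coAdj_le_one _ _)
    _ = _ := by rw [Finset.sum_const, Finset.card_univ, Fintype.card_fin, nsmul_eq_mul]; ring

end IsRegularAdj

/-- The four corners of a quadruple of vertices. -/
def corner {N : ℕ} (q : Fin N × Fin N × Fin N × Fin N) : Fin 4 → Fin N :=
  ![q.1, q.2.1, q.2.2.1, q.2.2.2]

/-- `altCycle` as a function of a quadruple. -/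
def altWeight {N : ℕ} (X : Matrix (Fin N) (Fin N) ℝ) (q : Fin N × Fin N × Fin N × Fin N) : ℝ :=
  altCycle X q.1 q.2.1 q.2.2.1 q.2.2.2

namespace IsRegularAdj

variable {N : ℕ} {X : Matrix (Fin N) (Fin N) ℝ} {d : ℝ}

theorem sum_altWeight_vertex_le (h : IsRegularAdj X d) {f : Fin N → ℝ} (hf : ∀ x, 0 ≤ f x)
    (a : Fin 4) :
    ∑ q, altWeight X q * f (corner q a) ≤ 4 * (N * rowVar N d ^ 2) * ∑ x, f x := by
  have h0 := h.sum_altCycle_vertex_le hf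
  have h1 := h0
  rw [h.sum_altCycle_mul_swap fun i _ _ _ => f i] at h1
  have h2 := h0
  rw [IsRegularAdj.sum_altCycle_mul_rotate fun i _ _ _ => f i] at h2
  have h3 := h1
  rw [IsRegularAdj.sum_altCycle_mul_rotate fun _ j _ _ => f j] at h3
  simp only [Fintype.sum_prod_type, altWeight, corner]
  fin_cases a
  · exact h0
  · exact h1
  · exact h2
  · exact h3

theorem sum_altWeight_pair_le (h : IsRegularAdj X d) {f : Fin N → Fin N → ℝ}
    (hf : ∀ x y, 0 ≤ f x y) {a b : Fin 4} (hab : a ≠ b) :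
    ∑ q, altWeight X q * f (corner q a) (corner q b) ≤
      2 * (N * rowVar N d) * ∑ x, ∑ y, f x y := by
  simp only [Fintype.sum_prod_type, altWeight, corner]
  have e0 := h.sum_altCycle_edge_le hf
  have n0 := h.sum_altCycle_nonedge_le hf
  have o0 : ∑ i, ∑ j, ∑ k, ∑ l, altCycle X i j k l * f i k ≤
      2 * (N * rowVar N d) * ∑ x, ∑ y, f x y := by
    rcases Nat.eq_zero_or_pos N with h0 | hN
    · subst h0; simp
    -- Opposite corners carry at most 4σ², which is below 2Nσ since 2σ ≤ N; so all pairs of corners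
    -- share one bound.
    refine (h.sum_altCycle_opposite_le hf).trans
      (mul_le_mul_of_nonneg_right ?_ (Finset.sum_nonneg fun x _ => Finset.sum_nonneg fun y _ => hf _ _))
    nlinarith [two_mul_rowVar_le (d := d) hN, h.rowVar_nonneg hN]
  have e1 := e0
  rw [h.sum_altCycle_mul_swap fun i j _ _ => f i j] at e1
  have e2 := e0
  rw [IsRegularAdj.sum_altCycle_mul_rotate fun i j _ _ => f i j] at e2
  have e3 := e1
  rw [IsRegularAdj.sum_altCycle_mul_rotate fun i j _ _ => f j i] at e3
  have n1 := n0
  rw [h.sum_altCycle_mul_swap fun i _ _ l => f i l] at n1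
  have n2 := n0
  rw [IsRegularAdj.sum_altCycle_mul_rotate fun i _ _ l => f i l] at n2
  have n3 := n1
  rw [IsRegularAdj.sum_altCycle_mul_rotate fun _ j k _ => f j k] at n3
  have o1 := o0
  rw [h.sum_altCycle_mul_swap fun i _ k _ => f i k] at o1
  have o2 := o0
  rw [IsRegularAdj.sum_altCycle_mul_rotate fun i _ k _ => f i k] at o2
  have o3 := o1
  rw [IsRegularAdj.sum_altCycle_mul_rotate fun _ j _ l => f j l] at o3
  fin_cases a <;> fin_cases b <;> first | exact absurd rfl hab | assumption

end IsRegularAdj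

/-! ### Functions with finite moments of all orders. -/

section Tame

variable {S : Type*} [MeasurableSpace S] {μ : Measure S}

/-- A measurable function whose absolute moments of all orders are finite. -/
@[fun_prop]
def Tame (f : S → ℝ) (μ : Measure S) : Prop :=
  Measurable f ∧ ∀ k : ℕ, Integrable (fun s => |f s| ^ k) μ

theorem Tame.integrable {f : S → ℝ} (hf : Tame f μ) : Integrable f μ := by
  have := hf.2 1
  simp only [pow_one] at this
  exact (integrable_norm_iff hf.1.aestronglyMeasurable).1 this

@[fun_prop]
theorem Tame.const [IsFiniteMeasure μ] (c : ℝ) : Tame (fun _ : S => c) μ :=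
  ⟨measurable_const, fun _ => integrable_const _⟩

-- Requiring all moments, rather than a single one, makes the class closed under products;
-- polynomials in the weights are then integrable without further estimates.
@[fun_prop]
theorem Tame.mul {f g : S → ℝ} (hf : Tame f μ) (hg : Tame g μ) :
    Tame (fun s => f s * g s) μ := by
  refine ⟨hf.1.mul hg.1, fun k => ?_⟩
  refine ((hf.2 (2 * k)).add (hg.2 (2 * k))).mono'
    ((hf.1.mul hg.1).abs.pow_const k).aestronglyMeasurable (ae_of_all _ fun s => ?_)
  simp only [Pi.add_apply]
  rw [Real.norm_eq_abs, abs_of_nonneg (by positivity), abs_mul, mul_pow, two_mul, pow_add, pow_add]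
  nlinarith [sq_nonneg (|f s| ^ k - |g s| ^ k), sq_nonneg (|f s| ^ k), sq_nonneg (|g s| ^ k)]

@[fun_prop]
theorem Tame.add {f g : S → ℝ} (hf : Tame f μ) (hg : Tame g μ) :
    Tame (fun s => f s + g s) μ := by
  refine ⟨hf.1.add hg.1, fun k => ?_⟩
  refine (((hf.2 k).add (hg.2 k)).const_mul (2 ^ (k - 1))).mono'
    ((hf.1.add hg.1).abs.pow_const k).aestronglyMeasurable (ae_of_all _ fun s => ?_)
  simp only [Pi.add_apply]
  rw [Real.norm_eq_abs, abs_of_nonneg (by positivity)]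
  exact (pow_le_pow_left₀ (abs_nonneg _) (abs_add_le _ _) k).trans
    (add_pow_le (abs_nonneg _) (abs_nonneg _) k)

@[fun_prop]
theorem Tame.neg {f : S → ℝ} (hf : Tame f μ) : Tame (fun s => -f s) μ :=
  ⟨hf.1.neg, fun k => by simpa using hf.2 k⟩

@[fun_prop]
theorem Tame.sub {f g : S → ℝ} (hf : Tame f μ) (hg : Tame g μ) :
    Tame (fun s => f s - g s) μ := by
  simp only [sub_eq_add_neg]; exact hf.add hg.neg

@[fun_prop]
theorem Tame.abs {f : S → ℝ} (hf : Tame f μ) : Tame (fun s => |f s|) μ :=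
  ⟨hf.1.abs, fun k => by simpa using hf.2 k⟩

@[fun_prop]
theorem Tame.pow {f : S → ℝ} (hf : Tame f μ) (n : ℕ) : Tame (fun s => f s ^ n) μ :=
  ⟨hf.1.pow_const n, fun k => by simpa [← pow_mul] using hf.2 (n * k)⟩

@[fun_prop]
theorem Tame.sum [IsFiniteMeasure μ] {ι : Type*} (A : Finset ι) {f : ι → S → ℝ}
    (hf : ∀ i, Tame (f i) μ) : Tame (fun s => ∑ i ∈ A, f i s) μ := by
  classical
  induction A using Finset.induction_on with
  | empty => simpa using Tame.const (μ := μ) 0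
  | insert a A ha ih => simp only [Finset.sum_insert ha]; exact (hf a).add ih

theorem Tame.comp {S' : Type*} [MeasurableSpace S'] {μ' : Measure S'} {T : S' → S} {f : S → ℝ}
    (hf : Tame f μ) (hT : MeasurePreserving T μ' μ) : Tame (fun s => f (T s)) μ' :=
  ⟨hf.1.comp hT.measurable, fun k => (hT.integrable_comp_of_integrable (hf.2 k) :)⟩

theorem Tame.matrix_pow [IsFiniteMeasure μ] {V : Type*} [Fintype V] [DecidableEq V]
    {M : S → Matrix V V ℝ}
    (hM : ∀ i j, Tame (fun s => M s i j) μ) (n : ℕ) :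
    ∀ i j, Tame (fun s => (M s ^ n) i j) μ := by
  induction n with
  | zero => intro i j; simp only [pow_zero]; exact Tame.const _
  | succ n ih =>
    intro i j
    simp only [pow_succ, Matrix.mul_apply]
    fun_prop

theorem Tame.trace_matrix_pow [IsFiniteMeasure μ] {V : Type*} [Fintype V] [DecidableEq V]
    {M : S → Matrix V V ℝ}
    (hM : ∀ i j, Tame (fun s => M s i j) μ) (n : ℕ) :
    Tame (fun s => (M s ^ n).trace) μ := by
  simp only [Matrix.trace, Matrix.diag]
  have := fun i j => Tame.matrix_pow hM n i j
  fun_prop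

theorem integral_comp_preserving {S' : Type*} [MeasurableSpace S'] {μ' : Measure S'} {T : S' → S}
    {f : S → ℝ} (hf : Measurable f) (hT : MeasurePreserving T μ' μ) :
    ∫ s, f (T s) ∂μ' = ∫ s, f s ∂μ := by
  rw [← hT.map_eq, integral_map hT.measurable.aemeasurable]
  exact hf.aestronglyMeasurable

end Tame

/-! ### Switchings of regular graphs. -/

instance instDiscreteMeasurableSpaceSimpleGraphFin (N : ℕ) :
    DiscreteMeasurableSpace (SimpleGraph (Fin N)) := by
  have : MeasurableSingletonClass (SimpleGraph (Fin N)) := by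
    refine ⟨fun H => ⟨{H.Adj}, measurableSet_singleton _, ?_⟩⟩
    ext K
    simp only [Set.mem_preimage, Set.mem_singleton_iff]
    exact ⟨fun h => SimpleGraph.ext h, fun h => by rw [h]⟩
  infer_instance

open Classical in
/-- The real adjacency matrix of a graph. -/
noncomputable def adj {N : ℕ} (H : SimpleGraph (Fin N)) : Matrix (Fin N) (Fin N) ℝ :=
  Matrix.of fun i j => if H.Adj i j then 1 else 0

theorem adj_row_sum {N : ℕ} (H : SimpleGraph (Fin N)) [H.LocallyFinite] (i : Fin N) :
    ∑ j, adj H i j = H.degree i := by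
  classical
  simp only [adj, Matrix.of_apply, Finset.sum_boole]
  rw [← SimpleGraph.card_neighborFinset_eq_degree]
  congr 2
  ext j; simp

theorem isRegularAdj_iff {N d : ℕ} (H : SimpleGraph (Fin N)) :
    IsRegularAdj (adj H) d ↔ H ∈ regularGraphs N d := by
  classical
  constructor
  · intro h i
    have := h.row_sum i
    rw [adj_row_sum] at this
    exact_mod_cast this
  · intro h
    refine ⟨fun i j => ?_, fun i j => ?_, fun i => ?_, fun i => ?_⟩
    · simp [adj, H.adj_comm]
    · by_cases hij : H.Adj i j <;> simp [adj, hij]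
    · simp [adj]
    · rw [adj_row_sum]
      exact_mod_cast h i

/-- The four sides of a quadruple of vertices, as a graph. -/
def fourCycle {N : ℕ} (q : Fin N × Fin N × Fin N × Fin N) : SimpleGraph (Fin N) :=
  SimpleGraph.fromEdgeSet {s(q.1, q.2.1), s(q.2.1, q.2.2.1), s(q.2.2.1, q.2.2.2), s(q.2.2.2, q.1)}

/-- Reverse the cyclic order of a quadruple. -/
def flip {N : ℕ} (q : Fin N × Fin N × Fin N × Fin N) : Fin N × Fin N × Fin N × Fin N :=
  (q.1, q.2.2.2, q.2.2.1, q.2.1)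

@[simp] theorem flip_flip {N : ℕ} (q : Fin N × Fin N × Fin N × Fin N) : flip (flip q) = q := rfl

open Classical in
/-- The switching of a graph along a quadruple of vertices: if the sides of the quadruple are
alternately edges and non-edges, then exchange the former and the latter. -/
noncomputable def switch {N : ℕ} (q : Fin N × Fin N × Fin N × Fin N) (H : SimpleGraph (Fin N)) :
    SimpleGraph (Fin N) :=
  if altWeight (adj H) q = 1 ∨ altWeight (adj H) (flip q) = 1 then symmDiff H (fourCycle q) else H

/-- The signed adjacency matrix of a quadruple. -/
def signedCycle {N : ℕ} (q : Fin N × Fin N × Fin N × Fin N) : Matrix (Fin N) (Fin N) ℝ :=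
  ∑ a : Fin 4, ((-1) ^ (a : ℕ)) • (Matrix.single (corner q a) (corner q (a + 1)) 1 +
    Matrix.single (corner q (a + 1)) (corner q a) 1)

/-- The diagonals need no separate condition: if i = k then jk would be the edge ij, and if j = l
then li would be. -/
theorem altWeight_eq_one_iff {N : ℕ} (H : SimpleGraph (Fin N))
    (i j k l : Fin N) :
    altWeight (adj H) (i, j, k, l) = 1 ↔ H.Adj i j ∧ H.Adj k l ∧
      ¬ H.Adj j k ∧ ¬ H.Adj l i ∧ i ≠ j ∧ j ≠ k ∧ k ≠ l ∧ l ≠ i ∧ i ≠ k ∧ j ≠ l := by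
  classical
  simp only [altWeight, altCycle, adj, IsRegularAdj.coAdj_apply, Matrix.of_apply]
  constructor
  · intro h
    have h1 : H.Adj i j := by by_contra h1; simp [h1] at h
    have h2 : H.Adj k l := by by_contra h2; simp [h2] at h
    have h3 : j ≠ k := by rintro rfl; simp at h
    have h4 : l ≠ i := by rintro rfl; simp at h
    have h5 : ¬ H.Adj j k := by intro h5; simp [h5, h3] at h
    have h6 : ¬ H.Adj l i := by intro h6; simp [h6, h4] at h
    refine ⟨h1, h2, h5, h6, h1.ne, h3, h2.ne, h4, ?_, ?_⟩
    · rintro rfl; exact h5 h1.symm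
    · rintro rfl; exact h6 h1.symm
  · rintro ⟨h1, h2, h3, h4, -, h5, -, h6, -⟩
    simp [h1, h2, h3, h4, h5, h6]

theorem altWeight_zero_or_one {N : ℕ} (H : SimpleGraph (Fin N))
    (q : Fin N × Fin N × Fin N × Fin N) :
    altWeight (adj H) q = 0 ∨ altWeight (adj H) q = 1 := by
  classical
  have h : ∀ i j, adj H i j = 0 ∨ adj H i j = 1 := by
    intro i j; by_cases hij : H.Adj i j <;> simp [adj, hij]
  have h' : ∀ i j, coAdj (adj H) i j = 0 ∨ coAdj (adj H) i j = 1 := by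
    intro i j
    rw [IsRegularAdj.coAdj_apply]
    by_cases hij : i = j
    · subst hij; simp [adj]
    · rcases h i j with h | h <;> simp [h, hij]
  rw [altWeight, altCycle]
  rcases h q.1 q.2.1 with h1 | h1 <;> rcases h q.2.2.1 q.2.2.2 with h2 | h2 <;>
    rcases h' q.2.1 q.2.2.1 with h3 | h3 <;> rcases h' q.2.2.2 q.1 with h4 | h4 <;>
    simp [h1, h2, h3, h4]

theorem fourCycle_flip {N : ℕ} (q : Fin N × Fin N × Fin N × Fin N) :
    fourCycle (flip q) = fourCycle q := by
  obtain ⟨i, j, k, l⟩ := q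
  simp only [fourCycle, flip]
  congr 1
  ext e
  simp only [Set.mem_insert_iff, Set.mem_singleton_iff, Sym2.eq_swap (a := i) (b := l),
    Sym2.eq_swap (a := l) (b := k), Sym2.eq_swap (a := k) (b := j), Sym2.eq_swap (a := j) (b := i)]
  tauto

theorem fourCycle_adj {N : ℕ} (i j k l a b : Fin N) :
    (fourCycle (i, j, k, l)).Adj a b ↔ ((a = i ∧ b = j ∨ a = j ∧ b = i) ∨
      (a = j ∧ b = k ∨ a = k ∧ b = j) ∨ (a = k ∧ b = l ∨ a = l ∧ b = k) ∨
      (a = l ∧ b = i ∨ a = i ∧ b = l)) ∧ a ≠ b := by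
  simp [fourCycle, SimpleGraph.fromEdgeSet_adj]

theorem symmDiff_adj {N : ℕ} (H C : SimpleGraph (Fin N)) (a b : Fin N) :
    (symmDiff H C).Adj a b ↔ (H.Adj a b ∧ ¬ C.Adj a b ∨ C.Adj a b ∧ ¬ H.Adj a b) := by
  simp [symmDiff, SimpleGraph.sup_adj, SimpleGraph.sdiff_adj]

/-- Toggling the four sides interchanges edges and non-edges around the cycle, so the quadruple
alternates again when read in the reverse order. -/
theorem altWeight_symmDiff {N : ℕ} {H : SimpleGraph (Fin N)}
    {q : Fin N × Fin N × Fin N × Fin N} (h : altWeight (adj H) q = 1) :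
    altWeight (adj (symmDiff H (fourCycle q))) (flip q) = 1 := by
  obtain ⟨i, j, k, l⟩ := q
  rw [altWeight_eq_one_iff] at h
  obtain ⟨h1, h2, h3, h4, h5, h6, h7, h8, h9, h10⟩ := h
  simp only [flip, altWeight_eq_one_iff, symmDiff_adj, fourCycle_adj]
  have h1' := h1.symm
  have h2' := h2.symm
  have h3' : ¬ H.Adj k j := fun h => h3 h.symm
  have h4' : ¬ H.Adj i l := fun h => h4 h.symm
  simp [h1', h2', h3', h4', h5, h6, h7, h8, h9, h10, h5.symm, h6.symm, h7.symm, h8.symm, h9.symm,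
    h10.symm]

theorem signedCycle_flip {N : ℕ} (q : Fin N × Fin N × Fin N × Fin N) :
    signedCycle (flip q) = - signedCycle q := by
  obtain ⟨i, j, k, l⟩ := q
  simp only [signedCycle, flip, corner, Fin.sum_univ_four]
  ext a b
  simp
  ring

theorem adj_symmDiff {N : ℕ} {H : SimpleGraph (Fin N)}
    {q : Fin N × Fin N × Fin N × Fin N} (h : altWeight (adj H) q = 1) :
    adj (symmDiff H (fourCycle q)) = adj H - signedCycle q := by
  classical
  obtain ⟨i, j, k, l⟩ := q
  rw [altWeight_eq_one_iff] at h
  obtain ⟨h1, h2, h3, h4, h5, h6, h7, h8, h9, h10⟩ := h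
  have h1' := h1.symm
  have h2' := h2.symm
  have h3' : ¬ H.Adj k j := fun h => h3 h.symm
  have h4' : ¬ H.Adj i l := fun h => h4 h.symm
  ext a b
  have e : adj (symmDiff H (fourCycle (i, j, k, l))) a b =
      if (H.Adj a b ∧ ¬ (fourCycle (i, j, k, l)).Adj a b ∨
        (fourCycle (i, j, k, l)).Adj a b ∧ ¬ H.Adj a b) then 1 else 0 := by
    simp only [adj, Matrix.of_apply, symmDiff_adj]
  have e' : signedCycle (i, j, k, l) a b =
      ((if i = a ∧ j = b then 1 else 0) + (if j = a ∧ i = b then 1 else 0)) -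
      ((if j = a ∧ k = b then 1 else 0) + (if k = a ∧ j = b then 1 else 0)) +
      ((if k = a ∧ l = b then 1 else 0) + (if l = a ∧ k = b then 1 else 0)) -
      ((if l = a ∧ i = b then 1 else 0) + (if i = a ∧ l = b then 1 else 0)) := by
    simp only [signedCycle, corner, Fin.sum_univ_four]
    simp [Matrix.single_apply]
    ring
  rw [e, Matrix.sub_apply, e']
  simp only [fourCycle_adj, adj, Matrix.of_apply]
  -- Once it is known which of the four distinct corners a and b are, both sides are explicit
  -- numbers.
  by_cases hai : a = i <;> by_cases haj : a = j <;> by_cases hak : a = k <;>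
    by_cases hal : a = l <;> by_cases hbi : b = i <;> by_cases hbj : b = j <;>
    by_cases hbk : b = k <;> by_cases hbl : b = l <;> grind

theorem switch_flip {N : ℕ} (q : Fin N × Fin N × Fin N × Fin N) (H : SimpleGraph (Fin N)) :
    switch (flip q) H = switch q H := by
  simp only [switch, flip_flip, fourCycle_flip, or_comm]

theorem switch_eq_of_altWeight {N : ℕ} {q : Fin N × Fin N × Fin N × Fin N}
    {H : SimpleGraph (Fin N)} (h : altWeight (adj H) q = 1) :
    switch q H = symmDiff H (fourCycle q) := if_pos (Or.inl h)

theorem altWeight_switch {N : ℕ} {q : Fin N × Fin N × Fin N × Fin N}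
    {H : SimpleGraph (Fin N)} (h : altWeight (adj H) q = 1) :
    altWeight (adj (switch q H)) (flip q) = 1 := by
  rw [switch_eq_of_altWeight h]; exact altWeight_symmDiff h

/-- The condition in `switch` is symmetric under reversal of the quadruple, so a switched graph is
again eligible and is switched back; an ineligible one is never changed. -/
theorem switch_switch {N : ℕ} (q : Fin N × Fin N × Fin N × Fin N) (H : SimpleGraph (Fin N)) :
    switch q (switch q H) = H := by
  have key : ∀ q : Fin N × Fin N × Fin N × Fin N, altWeight (adj H) q = 1 →
      switch q (switch q H) = H := by
    intro q h
    rw [← switch_flip, switch_eq_of_altWeight (altWeight_switch h), switch_eq_of_altWeight h,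
      fourCycle_flip, symmDiff_symmDiff_cancel_right]
  by_cases h : altWeight (adj H) q = 1
  · exact key q h
  by_cases h' : altWeight (adj H) (flip q) = 1
  · have := key _ h'
    rwa [switch_flip, switch_flip] at this
  · have : switch q H = H := if_neg (by tauto)
    rw [this, this]

/-- Detailed balance: the switching interchanges the graphs for which ij is one of the edges of the
alternating quadruple and those for which it is one of the non-edges. -/
theorem altWeight_switch_eq {N : ℕ} (q : Fin N × Fin N × Fin N × Fin N)
    (H : SimpleGraph (Fin N)) :
    altWeight (adj (switch q H)) q = altWeight (adj H) (flip q) := by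
  have h1 : altWeight (adj H) (flip q) = 1 → altWeight (adj (switch q H)) q = 1 := by
    intro h
    have := altWeight_switch h
    rwa [switch_flip, flip_flip] at this
  have h2 : altWeight (adj (switch q H)) q = 1 → altWeight (adj H) (flip q) = 1 := by
    intro h
    have := altWeight_switch h
    rwa [switch_switch] at this
  rcases altWeight_zero_or_one H (flip q) with h | h
  · rw [h]
    rcases altWeight_zero_or_one (switch q H) q with h' | h'
    · exact h'
    · rw [h2 h'] at h; exact absurd h one_ne_zero
  · rw [h, h1 h]

theorem adj_switch {N : ℕ} {q : Fin N × Fin N × Fin N × Fin N} {H : SimpleGraph (Fin N)}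
    (h : altWeight (adj H) (flip q) = 1) : adj (switch q H) = adj H + signedCycle q := by
  rw [← switch_flip, switch_eq_of_altWeight h, adj_symmDiff h, signedCycle_flip, sub_neg_eq_add]

/-- Each corner lies on two consecutive sides of opposite signs; hence a switching preserves
degrees. -/
theorem signedCycle_row_sum {N : ℕ} (q : Fin N × Fin N × Fin N × Fin N) (x : Fin N) :
    ∑ y, signedCycle q x y = 0 := by
  obtain ⟨i, j, k, l⟩ := q
  simp only [signedCycle, corner, Fin.sum_univ_four]
  simp [Matrix.single_apply, Finset.sum_add_distrib, Finset.sum_neg_distrib, ite_and]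

theorem switch_mem_regularGraphs {N d : ℕ} (q : Fin N × Fin N × Fin N × Fin N)
    {H : SimpleGraph (Fin N)} (hH : H ∈ regularGraphs N d) :
    switch q H ∈ regularGraphs N d := by
  have key : ∀ q : Fin N × Fin N × Fin N × Fin N, altWeight (adj H) (flip q) = 1 →
      switch q H ∈ regularGraphs N d := by
    intro q h x
    have h1 := (isRegularAdj_iff H).2 hH
    have h2 : ∑ y, adj (switch q H) x y = d := by
      rw [adj_switch h]
      simp [Finset.sum_add_distrib, h1.row_sum, signedCycle_row_sum]
    classical
    rw [adj_row_sum] at h2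
    exact_mod_cast h2
  by_cases h : altWeight (adj H) (flip q) = 1
  · exact key q h
  by_cases h' : altWeight (adj H) q = 1
  · have := key (flip q) h'
    rwa [switch_flip] at this
  · have : switch q H = H := if_neg (by tauto)
    rwa [this]

/-! ### Samples with a spare weight, and the moves that preserve their law. -/

/-- The `d`-regular graphs on `Fin N`. -/
abbrev RegGraph (N d : ℕ) : Type := {H : SimpleGraph (Fin N) // H ∈ regularGraphs N d}

/-- A regular graph together with weights on all pairs of vertices and one spare weight. -/
abbrev Sample (N d : ℕ) : Type := RegGraph N d × (Option (Sym2 (Fin N)) → ℝ)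

/-- The law of a uniform regular graph and independent weights. -/
noncomputable def sampleLaw (N d : ℕ) (ν : Measure ℝ) : Measure (Sample N d) :=
  (uniformOn (Set.univ : Set (RegGraph N d))).prod (Measure.pi fun _ => ν)

/-- The adjacency matrix of the graph of a sample. -/
noncomputable abbrev Sample.adj {N d : ℕ} (s : Sample N d) : Matrix (Fin N) (Fin N) ℝ :=
  RegWigner.adj s.1.1

/-- The weight of a pair of vertices. -/
abbrev Sample.wt {N d : ℕ} (s : Sample N d) (e : Sym2 (Fin N)) : ℝ := s.2 (some e)

/-- The spare weight. -/
abbrev Sample.spare {N d : ℕ} (s : Sample N d) : ℝ := s.2 none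

/-- Switch the graph of a sample and keep the weights. -/
noncomputable def Sample.switch {N d : ℕ} (q : Fin N × Fin N × Fin N × Fin N) (s : Sample N d) :
    Sample N d :=
  (⟨RegWigner.switch q s.1.1, switch_mem_regularGraphs q s.1.2⟩, s.2)

/-- Exchange the weight of `e` with the spare weight. -/
def Sample.resample {N d : ℕ} (e : Sym2 (Fin N)) (s : Sample N d) : Sample N d :=
  (s.1, fun o => s.2 (Equiv.swap none (some e) o))

section

variable {N d : ℕ}

theorem Sample.isRegularAdj (s : Sample N d) : IsRegularAdj s.adj d :=
  (isRegularAdj_iff s.1.1).2 s.1.2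

@[simp] theorem Sample.resample_wt_self (s : Sample N d) (e : Sym2 (Fin N)) :
    (s.resample e).wt e = s.spare := by
  simp [Sample.resample, Sample.wt, Sample.spare]

@[simp] theorem Sample.resample_spare (s : Sample N d) (e : Sym2 (Fin N)) :
    (s.resample e).spare = s.wt e := by
  simp [Sample.resample, Sample.wt, Sample.spare]

theorem Sample.resample_wt_of_ne (s : Sample N d) {e f : Sym2 (Fin N)} (h : f ≠ e) :
    (s.resample e).wt f = s.wt f := by
  simp only [Sample.resample, Sample.wt]
  rw [Equiv.swap_apply_of_ne_of_ne (by simp) (by simpa using h)]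

variable {ν : Measure ℝ} [IsProbabilityMeasure ν] [Nonempty (RegGraph N d)]

instance : IsProbabilityMeasure (uniformOn (Set.univ : Set (RegGraph N d))) :=
  isProbabilityMeasure_uniformOn Set.finite_univ Set.univ_nonempty

instance : IsProbabilityMeasure (sampleLaw N d ν) := by
  unfold sampleLaw; infer_instance

omit [Nonempty (RegGraph N d)] in
-- An involution of a finite set preserves its uniform law, and the weights are left alone.
theorem measurePreserving_switch (q : Fin N × Fin N × Fin N × Fin N) :
    MeasurePreserving (Sample.switch (d := d) q) (sampleLaw N d ν) (sampleLaw N d ν) := by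
  let T : RegGraph N d → RegGraph N d :=
    fun H => ⟨RegWigner.switch q H.1, switch_mem_regularGraphs q H.2⟩
  have hT : Function.Involutive T := fun H => Subtype.ext (switch_switch q H.1)
  have h1 : MeasurePreserving T (uniformOn Set.univ) (uniformOn Set.univ) := by
    refine ⟨measurable_of_countable _, ?_⟩
    refine Measure.ext_of_singleton fun H => ?_
    rw [Measure.map_apply (measurable_of_countable _) (measurableSet_singleton _)]
    have : T ⁻¹' {H} = {T H} := by
      ext K
      simp only [Set.mem_preimage, Set.mem_singleton_iff]
      exact ⟨fun h => by rw [← h, hT K], fun h => by rw [h, hT H]⟩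
    rw [this, uniformOn, cond_apply MeasurableSet.univ, cond_apply MeasurableSet.univ,
      Set.univ_inter, Set.univ_inter, Measure.count_singleton, Measure.count_singleton]
  exact h1.prod (MeasurePreserving.id _)

omit [Nonempty (RegGraph N d)] in
-- Two coordinates of an i.i.d. family are transposed.
theorem measurePreserving_resample (e : Sym2 (Fin N)) :
    MeasurePreserving (Sample.resample (d := d) e) (sampleLaw N d ν) (sampleLaw N d ν) := by
  have h : MeasurePreserving (fun (w : Option (Sym2 (Fin N)) → ℝ) o => w (Equiv.swap none (some e) o))
      (Measure.pi fun _ => ν) (Measure.pi fun _ => ν) := by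
    convert measurePreserving_arrowCongr' (fun _ : Option (Sym2 (Fin N)) => ν) (fun _ => ν)
      (Equiv.swap none (some e)) (MeasurableEquiv.refl ℝ)
      (fun _ => MeasurePreserving.id _) using 1
    funext w o
    rfl
  exact (MeasurePreserving.id (uniformOn (Set.univ : Set (RegGraph N d)))).prod h

theorem measurePreserving_weight (o : Option (Sym2 (Fin N))) :
    MeasurePreserving (fun s : Sample N d => s.2 o) (sampleLaw N d ν) ν :=
  (measurePreserving_eval _ o).comp measurePreserving_snd

theorem tame_weight_comp {f : ℝ → ℝ} (hf : Tame f ν) (o : Option (Sym2 (Fin N))) :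
    Tame (fun s : Sample N d => f (s.2 o)) (sampleLaw N d ν) :=
  hf.comp (measurePreserving_weight o)

omit [Nonempty (RegGraph N d)] in
theorem tame_graph (g : RegGraph N d → ℝ) : Tame (fun s : Sample N d => g s.1) (sampleLaw N d ν) := by
  refine Tame.comp (μ := uniformOn Set.univ) (f := g) ⟨measurable_of_countable _, fun k => ?_⟩
    measurePreserving_fst
  exact Integrable.of_finite

omit [Nonempty (RegGraph N d)] in
theorem integral_graph_mul_weight (g : RegGraph N d → ℝ) {f : ℝ → ℝ} (hf : Measurable f)
    (o : Option (Sym2 (Fin N))) :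
    ∫ s : Sample N d, g s.1 * f (s.2 o) ∂sampleLaw N d ν =
      (∫ s : Sample N d, g s.1 ∂sampleLaw N d ν) * ∫ x, f x ∂ν := by
  have h1 : ∫ s : Sample N d, g s.1 ∂sampleLaw N d ν = ∫ H, g H ∂uniformOn Set.univ :=
    integral_comp_preserving (measurable_of_countable _) measurePreserving_fst
  have h2 : ∫ w, f (w o) ∂(Measure.pi fun _ : Option (Sym2 (Fin N)) => ν) = ∫ x, f x ∂ν :=
    integral_comp_preserving hf (measurePreserving_eval _ o)
  rw [h1, ← h2, sampleLaw]
  exact integral_prod_mul g (fun w : Option (Sym2 (Fin N)) → ℝ => f (w o))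

/-- Through `hF'` the function F does not see the spare weight, which is therefore independent of
it. -/
theorem integral_spare_mul {f : ℝ → ℝ} (hf : Tame f ν) {F : Sample N d → ℝ}
    (hF : Tame F (sampleLaw N d ν))
    (hF' : ∀ (s t : Sample N d), s.1 = t.1 → (∀ e, s.wt e = t.wt e) → F s = F t) :
    ∫ s : Sample N d, f s.spare * F s ∂sampleLaw N d ν =
      (∫ x, f x ∂ν) * ∫ s, F s ∂sampleLaw N d ν := by
  have hfT : Tame (fun s : Sample N d => f s.spare) (sampleLaw N d ν) := tame_weight_comp hf none
  rw [sampleLaw, integral_prod _ (hfT.mul hF).integrable, integral_prod _ hF.integrable,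
    ← integral_const_mul]
  refine integral_congr_ae (ae_of_all _ fun H => ?_)
  have hmp : MeasurePreserving (MeasurableEquiv.piOptionEquivProd fun _ => ℝ).symm
      ((Measure.pi fun _ : Sym2 (Fin N) => ν).prod ν)
      (Measure.pi fun _ : Option (Sym2 (Fin N)) => ν) :=
    ⟨(MeasurableEquiv.piOptionEquivProd _).symm.measurable,
      Measure.pi_map_piOptionEquivProd fun _ : Option (Sym2 (Fin N)) => ν⟩
  have hFm : Measurable fun w => F (H, w) := hF.1.comp measurable_prodMk_left
  have hfm : Measurable fun w : Option (Sym2 (Fin N)) → ℝ => f (w none) :=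
    hf.1.comp (measurable_pi_apply _)
  have hfF : Measurable fun w : Option (Sym2 (Fin N)) → ℝ => f (w none) * F (H, w) := hfm.mul hFm
  change ∫ w, f (w none) * F (H, w) ∂_ = _ * ∫ w, F (H, w) ∂_
  rw [← integral_comp_preserving hfF hmp, ← integral_comp_preserving hFm hmp]
  -- The spare coordinate does not matter for F; it is frozen at the arbitrary value 0 to display
  -- the integrand as a product.
  have e : ∀ p : (Sym2 (Fin N) → ℝ) × ℝ, F (H, (MeasurableEquiv.piOptionEquivProd fun _ => ℝ).symm p) =
      F (H, (MeasurableEquiv.piOptionEquivProd fun _ => ℝ).symm (p.1, 0)) :=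
    fun p => hF' _ _ rfl fun e => rfl
  have e2 : ∀ p : (Sym2 (Fin N) → ℝ) × ℝ,
      (MeasurableEquiv.piOptionEquivProd fun _ : Option (Sym2 (Fin N)) => ℝ).symm p none = p.2 :=
    fun p => rfl
  simp only [e2]
  rw [integral_congr_ae (ae_of_all _ fun p => by rw [e p, mul_comm]),
    integral_prod_mul (fun v => F (H, (MeasurableEquiv.piOptionEquivProd fun _ => ℝ).symm (v, 0))) f,
    integral_congr_ae (ae_of_all _ e)]
  have := integral_prod_mul (μ := Measure.pi fun _ : Sym2 (Fin N) => ν) (ν := ν)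
    (fun v => F (H, (MeasurableEquiv.piOptionEquivProd fun _ => ℝ).symm (v, 0))) (fun _ => (1:ℝ))
  simp only [mul_one, integral_const, probReal_univ, smul_eq_mul] at this
  rw [this, mul_comm]

end

/-! ### Perturbation of powers of a symmetric matrix at few positions. -/

section Perturbation

variable {V κ ι : Type*} [Fintype V] [DecidableEq V] [Fintype κ] [Fintype ι]

theorem mul_sum_single_mul_apply (A B : Matrix V V ℝ) (x y : ι → V) (c : ι → ℝ) (i j : V) :
    (A * (∑ t, Matrix.single (x t) (y t) (c t)) * B) i j =
      ∑ t, c t * (A i (x t) * B (y t) j) := by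
  rw [Matrix.mul_sum, Matrix.sum_mul, Matrix.sum_apply]
  refine Finset.sum_congr rfl fun t _ => ?_
  rw [Matrix.mul_apply]
  simp only [Matrix.mul_apply, Matrix.single_apply]
  simp [ite_and, Finset.sum_ite_eq]
  ring

theorem exists_pow_two_mul_eq {t : ℝ} (ht : 0 ≤ t) {n : ℕ} (hn : 1 ≤ n) :
    ∃ r : ℝ, 0 ≤ r ∧ r ^ (2 * n) = t := by
  refine ⟨t ^ ((1 : ℝ) / ((2 * n : ℕ) : ℝ)), Real.rpow_nonneg ht _, ?_⟩
  rw [one_div]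
  exact Real.rpow_inv_natCast_pow ht (by omega)

omit [Fintype κ] in
/-- If the diagonal entries of `M ^ (2 * K)` and `M' ^ (2 * K)` at the vertices concerned are at most
`r ^ (2 * K)`, then powers of `M` and `M'` differ little at these vertices. -/
theorem abs_pow_sub_pow_apply_le_of_diag_le {M M' : Matrix V V ℝ} (hM : M.IsSymm) (hM' : M'.IsSymm)
    {u : κ → V} {x y : ι → κ} {c : ι → ℝ}
    (hD : M' - M = ∑ t, Matrix.single (u (x t)) (u (y t)) (c t)) {C : ℝ} (hc : ∀ t, |c t| ≤ C)
    {r : ℝ} (hr : 0 < r) {m K : ℕ} (hm : m ≤ 2 * K + 1)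
    (hr1 : ∀ k, (M ^ (2 * K)) (u k) (u k) ≤ r ^ (2 * K))
    (hr2 : ∀ k, (M' ^ (2 * K)) (u k) (u k) ≤ r ^ (2 * K)) (i j : κ) :
    |(M' ^ m) (u i) (u j) - (M ^ m) (u i) (u j)| ≤
      m * (Fintype.card ι * (C * (4 * r ^ (m - 1)))) := by
  rw [← Matrix.sub_apply, pow_sub_pow_eq_sum, Matrix.sum_apply]
  refine (Finset.abs_sum_le_sum_abs _ _).trans ?_
  refine (Finset.sum_le_sum (g := fun _ => Fintype.card ι * (C * (4 * r ^ (m - 1))))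
    fun a ha => ?_).trans (by simp)
  rw [Finset.mem_range] at ha
  rw [hD, mul_sum_single_mul_apply]
  refine (Finset.abs_sum_le_sum_abs _ _).trans ?_
  refine (Finset.sum_le_sum (g := fun _ => C * (4 * r ^ (m - 1))) fun t _ => ?_).trans (by simp)
  rw [abs_mul, abs_mul]
  -- Both exponents a and m − 1 − a are at most 2K because m ≤ 2K + 1, so the outer factors multiply
  -- to at most 4r^{m−1}.
  have h1 := abs_pow_apply_le hM hr (a := a) (by omega) (hr1 i) (hr1 (x t))
  have h2 := abs_pow_apply_le hM' hr (a := m - 1 - a) (by omega) (hr2 (y t)) (hr2 j)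
  have h3 : r ^ (m - 1) = r ^ a * r ^ (m - 1 - a) := by
    rw [← pow_add]; congr 1; omega
  refine mul_le_mul (hc t) ?_ (by positivity) ((abs_nonneg _).trans (hc t))
  calc _ ≤ (2 * r ^ a) * (2 * r ^ (m - 1 - a)) :=
        mul_le_mul h1 h2 (abs_nonneg _) (by positivity)
    _ = _ := by rw [h3]; ring

/-- Define r by r^{2n} = ℓ^{2n} + (the diagonal entries at the vertices concerned). The natural
bound r^{2n−2} is at most r^{2n}/ℓ² because ℓ ≤ r, hence linear in these entries. The cutoff ℓ is
free; taken large enough, it makes the increment absorbable by the trace moment. -/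
theorem abs_pow_sub_pow_apply_le {M M' : Matrix V V ℝ} (hM : M.IsSymm) (hM' : M'.IsSymm)
    {u : κ → V} {x y : ι → κ} {c : ι → ℝ}
    (hD : M' - M = ∑ t, Matrix.single (u (x t)) (u (y t)) (c t)) {C : ℝ} (hc : ∀ t, |c t| ≤ C)
    {ℓ : ℝ} (hℓ : 0 < ℓ) {n : ℕ} (hn : 1 ≤ n) (hC : 0 ≤ C) (i j : κ) :
    |(M' ^ (2 * n - 1)) (u i) (u j) - (M ^ (2 * n - 1)) (u i) (u j)| ≤
      8 * n * Fintype.card ι * C / ℓ ^ 2 * (ℓ ^ (2 * n) +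
        ∑ k, ((M ^ (2 * n)) (u k) (u k) + (M' ^ (2 * n)) (u k) (u k))) := by
  have hnn : ∀ k, 0 ≤ (M ^ (2 * n)) (u k) (u k) + (M' ^ (2 * n)) (u k) (u k) := fun k =>
    add_nonneg (pow_two_mul_apply_nonneg hM n _) (pow_two_mul_apply_nonneg hM' n _)
  have hs : 0 ≤ ∑ k, ((M ^ (2 * n)) (u k) (u k) + (M' ^ (2 * n)) (u k) (u k)) :=
    Finset.sum_nonneg fun k _ => hnn k
  set t := ℓ ^ (2 * n) + ∑ k, ((M ^ (2 * n)) (u k) (u k) + (M' ^ (2 * n)) (u k) (u k)) with ht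
  have hℓn : 0 < ℓ ^ (2 * n) := by positivity
  obtain ⟨r, hr0, hr⟩ := exists_pow_two_mul_eq (t := t) (by positivity) hn
  have hle : ℓ ≤ r := by
    refine le_of_pow_le_pow_left₀ (n := 2 * n) (by omega) hr0 ?_
    rw [hr]; linarith
  have hk : ∀ k, (M ^ (2 * n)) (u k) (u k) + (M' ^ (2 * n)) (u k) (u k) ≤ r ^ (2 * n) := by
    intro k
    have : (M ^ (2 * n)) (u k) (u k) + (M' ^ (2 * n)) (u k) (u k) ≤
        ∑ k, ((M ^ (2 * n)) (u k) (u k) + (M' ^ (2 * n)) (u k) (u k)) :=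
      Finset.single_le_sum (f := fun k => (M ^ (2 * n)) (u k) (u k) +
        (M' ^ (2 * n)) (u k) (u k)) (fun k _ => hnn k) (Finset.mem_univ k)
    rw [hr]; linarith
  have h := abs_pow_sub_pow_apply_le_of_diag_le hM hM' hD hc (hℓ.trans_le hle) (m := 2 * n - 1)
    (K := n) (by omega)
    (fun k => by linarith [hk k, pow_two_mul_apply_nonneg hM' n (u k)])
    (fun k => by linarith [hk k, pow_two_mul_apply_nonneg hM n (u k)]) i j
  refine h.trans ?_
  have h1 : r ^ (2 * n - 1 - 1) ≤ t / ℓ ^ 2 := by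
    rw [le_div_iff₀ (by positivity), ← hr]
    calc r ^ (2 * n - 1 - 1) * ℓ ^ 2 ≤ r ^ (2 * n - 1 - 1) * r ^ 2 := by gcongr
      _ = r ^ (2 * n) := by rw [← pow_add]; congr 1; omega
  have h2 : ((2 * n - 1 : ℕ) : ℝ) ≤ 2 * n := by
    have : 2 * n - 1 ≤ 2 * n := by omega
    exact_mod_cast this
  calc ((2 * n - 1 : ℕ) : ℝ) * (Fintype.card ι * (C * (4 * r ^ (2 * n - 1 - 1))))
      ≤ (2 * n) * (Fintype.card ι * (C * (4 * (t / ℓ ^ 2)))) := by gcongr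
    _ = _ := by ring

/-- The same choice of r, with only one factor ℓ ≤ r given away because the exponent is 2n − 1. -/
theorem abs_pow_apply_le_add {M : Matrix V V ℝ} (hM : M.IsSymm) {ℓ : ℝ} (hℓ : 0 < ℓ) {n : ℕ}
    (hn : 1 ≤ n) (i j : V) :
    |(M ^ (2 * n - 1)) i j| ≤
      2 / ℓ * (ℓ ^ (2 * n) + (M ^ (2 * n)) i i + (M ^ (2 * n)) j j) := by
  have h1 := pow_two_mul_apply_nonneg hM n i
  have h2 := pow_two_mul_apply_nonneg hM n j
  have hℓn : 0 < ℓ ^ (2 * n) := by positivity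
  set t := ℓ ^ (2 * n) + (M ^ (2 * n)) i i + (M ^ (2 * n)) j j with ht
  obtain ⟨r, hr0, hr⟩ := exists_pow_two_mul_eq (t := t) (by positivity) hn
  have hle : ℓ ≤ r := by
    refine le_of_pow_le_pow_left₀ (n := 2 * n) (by omega) hr0 ?_
    rw [hr]; linarith
  have h := abs_pow_apply_le hM (hℓ.trans_le hle) (a := 2 * n - 1) (K := n) (by omega)
    (x := i) (y := j) (by rw [hr]; linarith) (by rw [hr]; linarith)
  refine h.trans ?_
  have h1 : r ^ (2 * n - 1) ≤ t / ℓ := by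
    rw [le_div_iff₀ hℓ, ← hr]
    calc r ^ (2 * n - 1) * ℓ ≤ r ^ (2 * n - 1) * r := by gcongr
      _ = r ^ (2 * n) := by rw [← pow_succ]; congr 1; omega
  calc _ ≤ 2 * (t / ℓ) := by gcongr
    _ = _ := by ring

end Perturbation

/-! ### Integration by parts for the graph and for the weights. -/

section SwitchIdentity

variable {N d : ℕ} {ν : Measure ℝ} [IsProbabilityMeasure ν] [Nonempty (RegGraph N d)]

/-- Reversal of quadruples as an equivalence. -/
def flipEquiv (N : ℕ) : (Fin N × Fin N × Fin N × Fin N) ≃ (Fin N × Fin N × Fin N × Fin N) :=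
  ⟨flip, flip, flip_flip, flip_flip⟩

/-- The corner of the reversed quadruple corresponding to a corner of the original one. -/
def flipCorner : Fin 4 → Fin 4 := ![0, 3, 2, 1]

theorem corner_flip (q : Fin N × Fin N × Fin N × Fin N) (a : Fin 4) :
    corner (flip q) (flipCorner a) = corner q a := by
  fin_cases a <;> rfl

theorem flipCorner_injective : Function.Injective flipCorner := by decide

/-- Change of variables by the switching, which carries the rate at `flip q` to the rate at `q`. -/
theorem integral_altWeight_switch (q : Fin N × Fin N × Fin N × Fin N) {F : Sample N d → ℝ}
    (hF : Tame F (sampleLaw N d ν)) :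
    ∫ s, altWeight s.adj (flip q) * F (s.switch q) ∂sampleLaw N d ν =
      ∫ s, altWeight s.adj q * F s ∂sampleLaw N d ν := by
  have hg : Tame (fun s : Sample N d => altWeight s.adj q) (sampleLaw N d ν) :=
    tame_graph fun H => altWeight (adj H.1) q
  rw [← integral_comp_preserving (hg.mul hF).1 (measurePreserving_switch q)]
  refine integral_congr_ae (ae_of_all _ fun s => ?_)
  simp only [Sample.switch, Sample.adj]
  rw [altWeight_switch_eq]

theorem tame_altWeight (q : Fin N × Fin N × Fin N × Fin N) :
    Tame (fun s : Sample N d => altWeight s.adj q) (sampleLaw N d ν) :=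
  tame_graph fun H => altWeight (adj H.1) q

/-- Integration by parts for the graph. By detailed balance, the cycles in which ij is an edge are
the switched images of those in which it is not, so the difference of the counts turns into the
increment of F under the switchings that create ij. -/
theorem integral_sum_altCycle_sub_mul {F : Fin N → Fin N → Sample N d → ℝ}
    (hF : ∀ i j, Tame (F i j) (sampleLaw N d ν)) :
    ∫ s, ∑ i, ∑ j, (∑ k, ∑ l, (altCycle s.adj i j k l - altCycle s.adj i l k j)) * F i j s
        ∂sampleLaw N d ν =
      ∫ s, ∑ q, altWeight s.adj (flip q) * (F q.1 q.2.1 (s.switch q) - F q.1 q.2.1 s)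
        ∂sampleLaw N d ν := by
  have hA := fun q : Fin N × Fin N × Fin N × Fin N => tame_altWeight (d := d) (ν := ν) q
  have hA' := fun q : Fin N × Fin N × Fin N × Fin N =>
    (hF q.1 q.2.1).comp (measurePreserving_switch (d := d) (ν := ν) q)
  have e : ∀ s : Sample N d,
      ∑ i, ∑ j, (∑ k, ∑ l, (altCycle s.adj i j k l - altCycle s.adj i l k j)) * F i j s =
      ∑ q : Fin N × Fin N × Fin N × Fin N,
        (altWeight s.adj q - altWeight s.adj (flip q)) * F q.1 q.2.1 s := by
    intro s
    simp only [Fintype.sum_prod_type, altWeight, flip, Finset.sum_mul]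
  rw [integral_congr_ae (ae_of_all _ e), integral_finsetSum, integral_finsetSum]
  · refine Finset.sum_congr rfl fun q _ => ?_
    simp only [sub_mul, mul_sub]
    rw [integral_sub, integral_sub, integral_altWeight_switch q (hF _ _)]
    · exact ((hA (flip q)).mul (hA' q)).integrable
    · exact ((hA (flip q)).mul (hF _ _)).integrable
    · exact ((hA q).mul (hF _ _)).integrable
    · exact ((hA (flip q)).mul (hF _ _)).integrable
  · exact fun q _ => ((hA (flip q)).mul ((hA' q).sub (hF _ _))).integrable
  · exact fun q _ => (((hA q).sub (hA (flip q))).mul (hF _ _)).integrable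

/-- Integration by parts for a weight. Let T be the exchange of the weight with the spare one. Then
E[g w_e F∘T] equals E[g · spare · F], which factors as the mean times E[gF] by independence. -/
theorem integral_resample {F : Sample N d → ℝ} (e : Sym2 (Fin N))
    (hF : Tame F (sampleLaw N d ν))
    (hF' : ∀ (s t : Sample N d), s.1 = t.1 → (∀ e, s.wt e = t.wt e) → F s = F t)
    (g : RegGraph N d → ℝ) (hx : Tame (fun x : ℝ => x) ν) :
    ∫ s : Sample N d, g s.1 * (s.wt e - ∫ x, x ∂ν) * F s ∂sampleLaw N d ν =
      ∫ s : Sample N d, g s.1 * s.wt e * (F s - F (s.resample e)) ∂sampleLaw N d ν := by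
  have hg := tame_graph (ν := ν) g
  have hw : Tame (fun s : Sample N d => s.wt e) (sampleLaw N d ν) := tame_weight_comp hx (some e)
  have hz : Tame (fun s : Sample N d => s.spare) (sampleLaw N d ν) := tame_weight_comp hx none
  have hFT := hF.comp (measurePreserving_resample (d := d) (ν := ν) e)
  have h1 : ∫ s : Sample N d, s.spare * (g s.1 * F s) ∂sampleLaw N d ν =
      (∫ x, x ∂ν) * ∫ s : Sample N d, g s.1 * F s ∂sampleLaw N d ν :=
    integral_spare_mul hx (hg.mul hF) fun s t h h' => by rw [h, hF' s t h h']
  have h2 : ∫ s : Sample N d, s.spare * (g s.1 * F s) ∂sampleLaw N d ν =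
      ∫ s : Sample N d, g s.1 * s.wt e * F (s.resample e) ∂sampleLaw N d ν := by
    rw [← integral_comp_preserving (hz.mul (hg.mul hF)).1 (measurePreserving_resample e)]
    refine integral_congr_ae (ae_of_all _ fun s => ?_)
    simp only [Sample.resample_spare]
    rw [show (s.resample e).1 = s.1 from rfl]; ring
  have e1 : ∀ s : Sample N d, g s.1 * (s.wt e - ∫ x, x ∂ν) * F s =
      g s.1 * s.wt e * F s - (∫ x, x ∂ν) * (g s.1 * F s) := fun s => by ring
  simp only [e1]
  simp only [mul_sub]
  rw [integral_sub ((hg.mul hw).mul hF).integrable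
    ((hg.mul hF).integrable.const_mul _), integral_const_mul, ← h1, h2,
    integral_sub ((hg.mul hw).mul hF).integrable ((hg.mul hw).mul hFT).integrable]

end SwitchIdentity

/-! ### Trace moments of the centered adjacency matrix. -/

section CenteredTrace

variable {N d : ℕ} {ν : Measure ℝ} [IsProbabilityMeasure ν] [Nonempty (RegGraph N d)]

theorem tame_centered (i j : Fin N) :
    Tame (fun s : Sample N d => centered d s.adj i j) (sampleLaw N d ν) :=
  tame_graph fun H => centered d (adj H.1) i j

omit [Nonempty (RegGraph N d)] in
theorem centered_switch {q : Fin N × Fin N × Fin N × Fin N} {s : Sample N d}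
    (h : altWeight s.adj (flip q) = 1) :
    centered d (s.switch q).adj = centered d s.adj + signedCycle q := by
  rw [centered, centered, Sample.adj, Sample.switch, adj_switch h]; abel

/-- The position of the first endpoint of the `t`-th term of `signedCycle`. -/
def sideFst (t : Fin 4 × Bool) : Fin 4 := if t.2 then t.1 else t.1 + 1

/-- The position of the second endpoint of the `t`-th term of `signedCycle`. -/
def sideSnd (t : Fin 4 × Bool) : Fin 4 := if t.2 then t.1 + 1 else t.1

theorem signedCycle_eq_sum (q : Fin N × Fin N × Fin N × Fin N) :
    signedCycle q = ∑ t : Fin 4 × Bool,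
      Matrix.single (corner q (sideFst t)) (corner q (sideSnd t)) ((-1 : ℝ) ^ (t.1 : ℕ)) := by
  rw [signedCycle, Fintype.sum_prod_type]
  refine Finset.sum_congr rfl fun a _ => ?_
  rw [Fintype.sum_bool]
  simp [sideFst, sideSnd, smul_add]

/-- Sum of a nonnegative function of the sample at the corners of a quadruple, weighted by the
switching rates, before the switching. -/
theorem integral_sum_altWeight_vertex_le {f : Fin N → Sample N d → ℝ}
    (hf : ∀ x, Tame (f x) (sampleLaw N d ν)) (hf0 : ∀ x s, 0 ≤ f x s) (a : Fin 4) :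
    ∫ s, ∑ q, altWeight s.adj (flip q) * f (corner q a) s ∂sampleLaw N d ν ≤
      4 * (N * rowVar N d ^ 2) * ∫ s, ∑ x, f x s ∂sampleLaw N d ν := by
  have hA := fun q : Fin N × Fin N × Fin N × Fin N => tame_altWeight (d := d) (ν := ν) q
  rw [← integral_const_mul]
  refine integral_mono (Tame.sum _ fun q => (hA _).mul (hf _)).integrable
    ((Tame.sum _ fun x => hf x).integrable.const_mul _) fun s => ?_
  refine le_trans (le_of_eq ?_) (s.isRegularAdj.sum_altWeight_vertex_le (f := fun x => f x s)
    (fun x => hf0 x s) (flipCorner a))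
  rw [← (flipEquiv N).sum_comp]
  refine Finset.sum_congr rfl fun q _ => ?_
  change altWeight s.adj (flip (flip q)) * f (corner (flip q) a) s = _
  rw [flip_flip, ← corner_flip (flip q) a, flip_flip]

theorem integral_sum_altWeight_vertex_switch_le {f : Fin N → Sample N d → ℝ}
    (hf : ∀ x, Tame (f x) (sampleLaw N d ν)) (hf0 : ∀ x s, 0 ≤ f x s) (a : Fin 4) :
    ∫ s, ∑ q, altWeight s.adj (flip q) * f (corner q a) (s.switch q) ∂sampleLaw N d ν ≤
      4 * (N * rowVar N d ^ 2) * ∫ s, ∑ x, f x s ∂sampleLaw N d ν := by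
  have hA := fun q : Fin N × Fin N × Fin N × Fin N => tame_altWeight (d := d) (ν := ν) q
  have hfT := fun (q : Fin N × Fin N × Fin N × Fin N) x =>
    (hf x).comp (measurePreserving_switch (d := d) (ν := ν) q)
  rw [integral_finsetSum _ fun q _ => ((hA _).mul (hfT q _)).integrable,
    Finset.sum_congr rfl fun q _ => integral_altWeight_switch q (hf (corner q a)),
    ← integral_finsetSum _ fun q _ => ((hA _).mul (hf _)).integrable, ← integral_const_mul]
  refine integral_mono (Tame.sum _ fun q => (hA _).mul (hf _)).integrable
    ((Tame.sum _ fun x => hf x).integrable.const_mul _) fun s => ?_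
  exact s.isRegularAdj.sum_altWeight_vertex_le (fun x => hf0 x s) a

theorem integral_sum_altWeight_pair_le {f : Fin N → Fin N → Sample N d → ℝ}
    (hf : ∀ x y, Tame (f x y) (sampleLaw N d ν)) (hf0 : ∀ x y s, 0 ≤ f x y s) {a b : Fin 4}
    (hab : a ≠ b) :
    ∫ s, ∑ q, altWeight s.adj (flip q) * f (corner q a) (corner q b) s ∂sampleLaw N d ν ≤
      2 * (N * rowVar N d) * ∫ s, ∑ x, ∑ y, f x y s ∂sampleLaw N d ν := by
  have hA := fun q : Fin N × Fin N × Fin N × Fin N => tame_altWeight (d := d) (ν := ν) q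
  rw [← integral_const_mul]
  refine integral_mono (Tame.sum _ fun q => (hA _).mul (hf _ _)).integrable
    ((Tame.sum _ fun x => Tame.sum _ fun y => hf x y).integrable.const_mul _) fun s => ?_
  refine le_trans (le_of_eq ?_) (s.isRegularAdj.sum_altWeight_pair_le (f := fun x y => f x y s)
    (fun x y => hf0 x y s) (flipCorner_injective.ne hab))
  rw [← (flipEquiv N).sum_comp]
  refine Finset.sum_congr rfl fun q _ => ?_
  change altWeight s.adj (flip (flip q)) * f (corner (flip q) a) (corner (flip q) b) s = _
  rw [flip_flip, ← corner_flip (flip q) a, ← corner_flip (flip q) b, flip_flip]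

theorem integral_sum_altWeight_pair_switch_le {f : Fin N → Fin N → Sample N d → ℝ}
    (hf : ∀ x y, Tame (f x y) (sampleLaw N d ν)) (hf0 : ∀ x y s, 0 ≤ f x y s) {a b : Fin 4}
    (hab : a ≠ b) :
    ∫ s, ∑ q, altWeight s.adj (flip q) * f (corner q a) (corner q b) (s.switch q)
        ∂sampleLaw N d ν ≤
      2 * (N * rowVar N d) * ∫ s, ∑ x, ∑ y, f x y s ∂sampleLaw N d ν := by
  have hA := fun q : Fin N × Fin N × Fin N × Fin N => tame_altWeight (d := d) (ν := ν) q
  have hfT := fun (q : Fin N × Fin N × Fin N × Fin N) x y =>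
    (hf x y).comp (measurePreserving_switch (d := d) (ν := ν) q)
  rw [integral_finsetSum _ fun q _ => ((hA _).mul (hfT q _ _)).integrable,
    Finset.sum_congr rfl fun q _ => integral_altWeight_switch q (hf (corner q a) (corner q b)),
    ← integral_finsetSum _ fun q _ => ((hA _).mul (hf _ _)).integrable, ← integral_const_mul]
  refine integral_mono (Tame.sum _ fun q => (hA _).mul (hf _ _)).integrable
    ((Tame.sum _ fun x => Tame.sum _ fun y => hf x y).integrable.const_mul _) fun s => ?_
  exact s.isRegularAdj.sum_altWeight_pair_le (fun x y => hf0 x y s) hab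

theorem sum_sum_pow_mul_pow {V : Type*} [Fintype V] [DecidableEq V] {M : Matrix V V ℝ}
    (hM : M.IsSymm) (a b : ℕ) :
    ∑ i, ∑ j, (M ^ a) i j * (M ^ b) i j = (M ^ (a + b)).trace := by
  rw [pow_add, Matrix.trace]
  refine Finset.sum_congr rfl fun i _ => ?_
  rw [Matrix.diag, Matrix.mul_apply]
  exact Finset.sum_congr rfl fun j _ => by rw [(isSymm_pow hM b).apply i j]

theorem sum_sum_one_add_ite_mul {N : ℕ} (L : ℝ) (f : Fin N → ℝ) :
    ∑ i, ∑ j, (1 + if i = j then (N : ℝ) else 0) * (L + f i + f j) =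
      2 * N ^ 2 * L + 4 * N * ∑ i, f i := by
  simp only [add_mul, mul_add, one_mul, ite_mul, zero_mul, Finset.sum_add_distrib,
    Finset.sum_ite_eq, Finset.mem_univ, if_true, Finset.sum_const, Finset.card_univ,
    Fintype.card_fin, nsmul_eq_mul, ← Finset.mul_sum]
  ring

/-- The defect in the switching identity, tested against an odd power. -/
theorem sum_altCycle_mul_centered_pow_ge {X : Matrix (Fin N) (Fin N) ℝ} {d : ℝ}
    (h : IsRegularAdj X d) (hσ : 1 ≤ rowVar N d) {n : ℕ} (hn : 1 ≤ n) {ℓ : ℝ} (hℓ : 0 < ℓ) :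
    (N * rowVar N d + 1 - d - rowVar N d) * (centered d X ^ (2 * n)).trace -
      12 * rowVar N d / ℓ * (2 * N ^ 2 * ℓ ^ (2 * n) +
        4 * N * (centered d X ^ (2 * n)).trace) ≤
      ∑ i, ∑ j, (∑ k, ∑ l, (altCycle X i j k l - altCycle X i l k j)) *
        (centered d X ^ (2 * n - 1)) i j := by
  set Y := centered d X with hY
  set κ := N * rowVar N d + 1 - d - rowVar N d
  have hs : Y.IsSymm := h.centered_isSymm
  have e1 : ∑ i, ∑ j, (Y ^ 1) i j * (Y ^ (2 * n - 1)) i j = (Y ^ (2 * n)).trace := by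
    rw [sum_sum_pow_mul_pow hs]; congr 2; omega
  have e2 : ∑ i, ∑ j, (Y ^ 3) i j * (Y ^ (2 * n - 1)) i j = (Y ^ (2 * (n + 1))).trace := by
    rw [sum_sum_pow_mul_pow hs]; congr 2; omega
  -- The cubic part of the kernel contributes tr Y^{2n+2} ≥ 0, which a lower bound may drop.
  have e3 := trace_pow_two_mul_nonneg hs (n + 1)
  rw [← e2] at e3
  have e4 := sum_sum_one_add_ite_mul (N := N) (ℓ ^ (2 * n)) fun i => (Y ^ (2 * n)) i i
  have e5 : ∑ i, (Y ^ (2 * n)) i i = (Y ^ (2 * n)).trace := rfl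
  rw [e5] at e4
  have hσ0 : 0 ≤ rowVar N d := by linarith
  calc _ ≤ κ * (∑ i, ∑ j, (Y ^ 1) i j * (Y ^ (2 * n - 1)) i j) +
        (∑ i, ∑ j, (Y ^ 3) i j * (Y ^ (2 * n - 1)) i j) -
        12 * rowVar N d / ℓ * ∑ i, ∑ j, (1 + if i = j then (N : ℝ) else 0) *
          (ℓ ^ (2 * n) + (Y ^ (2 * n)) i i + (Y ^ (2 * n)) j j) := by
        rw [e4, e1]; linarith
    _ = ∑ i, ∑ j, ((κ * Y i j + (Y ^ 3) i j) * (Y ^ (2 * n - 1)) i j -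
          12 * rowVar N d / ℓ * ((1 + if i = j then (N : ℝ) else 0) *
          (ℓ ^ (2 * n) + (Y ^ (2 * n)) i i + (Y ^ (2 * n)) j j))) := by
        rw [Finset.mul_sum, Finset.mul_sum, ← Finset.sum_add_distrib, ← Finset.sum_sub_distrib]
        refine Finset.sum_congr rfl fun i _ => ?_
        rw [Finset.mul_sum, Finset.mul_sum, ← Finset.sum_add_distrib, ← Finset.sum_sub_distrib]
        refine Finset.sum_congr rfl fun j _ => ?_
        rw [pow_one]; ring
    _ ≤ _ := by
        refine Finset.sum_le_sum fun i _ => Finset.sum_le_sum fun j _ => ?_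
        have h1 := h.abs_sum_altCycle_sub_le hσ i j
        have h2 := abs_pow_apply_le_add hs hℓ hn i j
        set D := ∑ k, ∑ l, (altCycle X i j k l - altCycle X i l k j)
        have hite : 0 ≤ if i = j then (N : ℝ) else 0 := by positivity
        have h3 : |(D - (κ * Y i j + (Y ^ 3) i j)) * (Y ^ (2 * n - 1)) i j| ≤
            (6 * rowVar N d * (1 + if i = j then (N : ℝ) else 0)) *
            (2 / ℓ * (ℓ ^ (2 * n) + (Y ^ (2 * n)) i i + (Y ^ (2 * n)) j j)) := by
          rw [abs_mul]
          exact mul_le_mul h1 h2 (abs_nonneg _) (by positivity)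
        have h4 := (abs_le.1 h3).1
        have h5 : (6 * rowVar N d * (1 + if i = j then (N : ℝ) else 0)) *
            (2 / ℓ * (ℓ ^ (2 * n) + (Y ^ (2 * n)) i i + (Y ^ (2 * n)) j j)) =
            12 * rowVar N d / ℓ * ((1 + if i = j then (N : ℝ) else 0) *
            (ℓ ^ (2 * n) + (Y ^ (2 * n)) i i + (Y ^ (2 * n)) j j)) := by ring
        rw [h5] at h4
        linarith

/-- Four corners, each before and after the switching, give eight terms, and each of them has vertex
rate at most 4Nσ². -/
theorem integral_sum_switch_energy_le {L : ℝ} (hL : 0 ≤ L) {g : Fin N → Sample N d → ℝ}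
    (hg : ∀ x, Tame (g x) (sampleLaw N d ν)) (hg0 : ∀ x s, 0 ≤ g x s) :
    ∫ s, ∑ q, altWeight s.adj (flip q) *
        (L + ∑ a, (g (corner q a) s + g (corner q a) (s.switch q))) ∂sampleLaw N d ν ≤
      4 * (N * rowVar N d ^ 2) * (N * L + 8 * ∫ s, ∑ x, g x s ∂sampleLaw N d ν) := by
  have hA := fun q : Fin N × Fin N × Fin N × Fin N => tame_altWeight (d := d) (ν := ν) q
  have hgT := fun (q : Fin N × Fin N × Fin N × Fin N) x =>
    (hg x).comp (measurePreserving_switch (d := d) (ν := ν) q)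
  have v0 := integral_sum_altWeight_vertex_le (N := N) (d := d) (ν := ν) (f := fun _ _ => L)
    (fun _ => Tame.const _) (fun _ _ => hL) 0
  have v1 := integral_sum_altWeight_vertex_le hg hg0
  have v2 := integral_sum_altWeight_vertex_switch_le hg hg0
  simp only [Finset.sum_const, Finset.card_univ, Fintype.card_fin, nsmul_eq_mul, integral_const,
    probReal_univ, one_smul] at v0
  have e : ∀ s : Sample N d, ∑ q, altWeight s.adj (flip q) *
        (L + ∑ a, (g (corner q a) s + g (corner q a) (s.switch q))) =
      ∑ q, altWeight s.adj (flip q) * L +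
          ∑ a, (∑ q, altWeight s.adj (flip q) * g (corner q a) s +
            ∑ q, altWeight s.adj (flip q) * g (corner q a) (s.switch q)) := by
    intro s
    simp only [← Finset.sum_add_distrib]
    rw [Finset.sum_comm, ← Finset.sum_add_distrib]
    refine Finset.sum_congr rfl fun q _ => ?_
    rw [mul_add, Finset.mul_sum]
    simp only [mul_add]
  have t1 := fun a : Fin 4 => Tame.sum (μ := sampleLaw N d ν) Finset.univ
    fun q => (hA (flip q)).mul (hg (corner q a))
  have t2 := fun a : Fin 4 => Tame.sum (μ := sampleLaw N d ν) Finset.univ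
    fun q => (hA (flip q)).mul (hgT q (corner q a))
  have t0 := Tame.sum (μ := sampleLaw N d ν) Finset.univ
    fun q => (hA (flip q)).mul (Tame.const L)
  rw [integral_congr_ae (ae_of_all _ e), integral_add t0.integrable
    (Tame.sum _ fun a => (t1 a).add (t2 a)).integrable,
    integral_finsetSum _ fun a _ => ((t1 a).add (t2 a)).integrable]
  have h2 : ∀ a : Fin 4, ∫ s, (∑ q, altWeight s.adj (flip q) * g (corner q a) s +
      ∑ q, altWeight s.adj (flip q) * g (corner q a) (s.switch q)) ∂sampleLaw N d ν ≤
      2 * (4 * (N * rowVar N d ^ 2) * ∫ s, ∑ x, g x s ∂sampleLaw N d ν) := by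
    intro a
    rw [integral_add (t1 a).integrable (t2 a).integrable]
    linarith [v1 a, v2 a]
  have h3 := Finset.sum_le_sum fun a (_ : a ∈ (Finset.univ : Finset (Fin 4))) => h2 a
  simp only [Finset.sum_const, Finset.card_univ, Fintype.card_fin, nsmul_eq_mul] at h3
  push_cast at h3
  linarith

/-- The pointwise perturbation bound with unit coefficients, averaged over switchings; 64 is 8 times
the number of signed entries of a four-cycle. -/
theorem integral_centered_pow_switch_le {n : ℕ} (hn : 1 ≤ n) {ℓ : ℝ} (hℓ : 0 < ℓ) :
    ∫ s, ∑ q, altWeight s.adj (flip q) *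
        ((centered d (s.switch q).adj ^ (2 * n - 1)) q.1 q.2.1 -
          (centered d s.adj ^ (2 * n - 1)) q.1 q.2.1) ∂sampleLaw N d ν ≤
      64 * n / ℓ ^ 2 * (4 * (N * rowVar N d ^ 2) * (N * ℓ ^ (2 * n) +
        8 * ∫ s : Sample N d, (centered d s.adj ^ (2 * n)).trace ∂sampleLaw N d ν)) := by
  have hY := tame_centered (N := N) (d := d) (ν := ν)
  have hF := Tame.matrix_pow hY (2 * n - 1)
  have hG := Tame.matrix_pow hY (2 * n)
  have hA := fun q : Fin N × Fin N × Fin N × Fin N => tame_altWeight (d := d) (ν := ν) q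
  have hFT := fun (q : Fin N × Fin N × Fin N × Fin N) i j =>
    (hF i j).comp (measurePreserving_switch (d := d) (ν := ν) q)
  have hGT := fun (q : Fin N × Fin N × Fin N × Fin N) i j =>
    (hG i j).comp (measurePreserving_switch (d := d) (ν := ν) q)
  have h := integral_sum_switch_energy_le (ν := ν) (L := ℓ ^ (2 * n)) (by positivity)
    (g := fun x s => (centered d s.adj ^ (2 * n)) x x) (fun x => hG x x)
      (fun x s => pow_two_mul_apply_nonneg s.isRegularAdj.centered_isSymm n x)
  refine le_trans ?_ (mul_le_mul_of_nonneg_left h (by positivity))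
  rw [← integral_const_mul]
  refine integral_mono
    (Tame.sum _ fun q => (hA _).mul ((hFT q _ _).sub (hF _ _))).integrable
    (((Tame.sum _ fun q => (hA _).mul ((Tame.const _).add (Tame.sum _ fun a =>
      (hG (corner q a) (corner q a)).add (hGT q _ _)))).integrable).const_mul _) fun s => ?_
  simp only
  rw [Finset.mul_sum]
  refine Finset.sum_le_sum fun q _ => ?_
  rcases altWeight_zero_or_one s.1.1 (flip q) with h0 | h1
  · rw [h0]; simp
  · rw [h1]
    have hD : centered d (s.switch q).adj - centered d s.adj = _ :=
      (sub_eq_of_eq_add' (centered_switch h1)).trans (signedCycle_eq_sum q)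
    have := abs_pow_sub_pow_apply_le s.isRegularAdj.centered_isSymm
      (s.switch q).isRegularAdj.centered_isSymm hD (C := 1) (fun t => by simp) hℓ hn zero_le_one
      0 1
    refine (le_trans (le_of_eq (one_mul _)) (le_abs_self _)).trans (this.trans (le_of_eq ?_))
    simp only [Fintype.card_prod, Fintype.card_fin, Fintype.card_bool, one_mul]
    push_cast
    ring

theorem integral_sum_altCycle_mul_centered_pow_ge {n : ℕ} (hn : 1 ≤ n) (hσ : 1 ≤ rowVar N d)
    {ℓ : ℝ} (hℓ : 0 < ℓ) {T : ℝ}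
    (hT : T = ∫ s : Sample N d, (centered d s.adj ^ (2 * n)).trace ∂sampleLaw N d ν) :
    (N * rowVar N d + 1 - d - rowVar N d) * T -
        12 * rowVar N d / ℓ * (2 * N ^ 2 * ℓ ^ (2 * n) + 4 * N * T) ≤
      ∫ s : Sample N d, ∑ i, ∑ j, (∑ k, ∑ l, (altCycle s.adj i j k l - altCycle s.adj i l k j)) *
        (centered d s.adj ^ (2 * n - 1)) i j ∂sampleLaw N d ν := by
  have hY := tame_centered (N := N) (d := d) (ν := ν)
  have htr := Tame.trace_matrix_pow hY (2 * n)
  have hF := Tame.matrix_pow hY (2 * n - 1)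
  have hc : ∀ i j k l, Tame (fun s : Sample N d => altCycle s.adj i j k l) (sampleLaw N d ν) :=
    fun i j k l => tame_altWeight (i, j, k, l)
  have e : (N * rowVar N d + 1 - d - rowVar N d) * T -
        12 * rowVar N d / ℓ * (2 * N ^ 2 * ℓ ^ (2 * n) + 4 * N * T) =
      ∫ s : Sample N d, ((N * rowVar N d + 1 - d - rowVar N d) *
          (centered d s.adj ^ (2 * n)).trace -
        12 * rowVar N d / ℓ * (2 * N ^ 2 * ℓ ^ (2 * n) +
          4 * N * (centered d s.adj ^ (2 * n)).trace)) ∂sampleLaw N d ν := by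
    rw [integral_sub (Tame.integrable (by fun_prop)) (Tame.integrable (by fun_prop)),
      integral_const_mul, integral_const_mul, integral_add (Tame.integrable (by fun_prop))
        (Tame.integrable (by fun_prop)), integral_const]
    simp [hT, integral_const_mul]
  rw [e]
  refine integral_mono (Tame.integrable (by fun_prop)) (Tame.integrable ?_) fun s =>
    sum_altCycle_mul_centered_pow_ge s.isRegularAdj hσ hn hℓ
  fun_prop

/-- From σ ≤ N − d one gets Nσ = d(N − d) ≥ 16d, and N ≥ 2σ gives the other bound. The coefficient
Nσ + 1 − d − σ is then at least 7Nσ/8. -/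
theorem mem_bounds_of_rowVar (h : 16 ≤ rowVar N d) :
    0 < N ∧ 16 * (d : ℝ) ≤ N * rowVar N d ∧ 16 * rowVar N d ≤ N * rowVar N d := by
  have hN : 0 < N := by
    rcases Nat.eq_zero_or_pos N with h0 | h0
    · subst h0; simp [rowVar] at h; norm_num at h
    · exact h0
  have hN' : (0 : ℝ) < N := by exact_mod_cast hN
  have hreg : IsRegularAdj (adj (Classical.arbitrary (RegGraph N d)).1) d :=
    (isRegularAdj_iff _).2 (Classical.arbitrary (RegGraph N d)).2
  refine ⟨hN, ?_, ?_⟩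
  · have h1 : N * rowVar N d = d * (N - d) := by rw [rowVar]; field_simp
    have h2 : rowVar N d ≤ N - d := by
      rw [rowVar, div_le_iff₀ hN']
      nlinarith [hreg.d_le hN]
    rw [h1]
    nlinarith [hreg.d_nonneg hN]
  · have := IsRegularAdj.two_mul_rowVar_le (d := d) hN
    exact mul_le_mul_of_nonneg_right (by linarith) (by linarith)

/-- The switching identity is tested with F = Y^{2n−1}. The kernel yields about NσT, where T is the
trace moment, while the increments cost of order (n/ℓ²)Nσ²(Nℓ^{2n} + T). When ℓ² is a large multiple
of nσ, all terms in T on the right are absorbed and T ≤ Nℓ^{2n} remains. -/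
theorem integral_trace_centered_pow_le {n : ℕ} (hn : 1 ≤ n) (hσ : 16 ≤ rowVar N d) :
    ∫ s : Sample N d, (centered d s.adj ^ (2 * n)).trace ∂sampleLaw N d ν ≤
      (2 ^ 14 * n) ^ n * (N * rowVar N d ^ n) := by
  obtain ⟨hN, hdN, hσN⟩ := mem_bounds_of_rowVar (d := d) hσ
  set σ := rowVar N d with hσdef
  have hN' : (0 : ℝ) < N := by exact_mod_cast hN
  have hn' : (1 : ℝ) ≤ n := by exact_mod_cast hn
  have hΛσ : 0 < 2 ^ 14 * n * σ := by positivity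
  -- The factor 2^14 makes the switching cost equal to Nσ(Nℓ^{2n}/64 + T/8), and with σ ≥ 16 it
  -- ensures ℓ ≥ 512, which tames the defect of the kernel.
  obtain ⟨ℓ, hℓ, hℓ2⟩ : ∃ ℓ : ℝ, 0 < ℓ ∧ ℓ ^ 2 = 2 ^ 14 * n * σ :=
    ⟨√(2 ^ 14 * n * σ), Real.sqrt_pos.2 hΛσ, Real.sq_sqrt hΛσ.le⟩
  have hℓ512 : 512 ≤ ℓ := by
    refine le_of_pow_le_pow_left₀ (n := 2) (by norm_num) hℓ.le ?_
    rw [hℓ2]; nlinarith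
  have key := integral_sum_altCycle_sub_mul (ν := ν)
    (Tame.matrix_pow (tame_centered (N := N) (d := d) (ν := ν)) (2 * n - 1))
  have upper := integral_centered_pow_switch_le (N := N) (d := d) (ν := ν) hn hℓ
  rw [← key] at upper
  set T := ∫ s : Sample N d, (centered d s.adj ^ (2 * n)).trace ∂sampleLaw N d ν with hT
  have hT0 : 0 ≤ T := integral_nonneg fun s =>
    trace_pow_two_mul_nonneg s.isRegularAdj.centered_isSymm n
  have hfin := (integral_sum_altCycle_mul_centered_pow_ge hn (by linarith) hℓ hT).trans upper
  rw [← hσdef] at hfin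
  have hu : 0 < N * σ := by positivity
  have hL : 0 < ℓ ^ (2 * n) := by positivity
  have c1 : 64 * n / ℓ ^ 2 * (4 * (N * σ ^ 2) * (N * ℓ ^ (2 * n) + 8 * T)) =
      N * σ * (N * ℓ ^ (2 * n) / 64 + T / 8) := by
    rw [hℓ2]; field_simp; ring
  have c2 : 12 * σ / ℓ * (2 * N ^ 2 * ℓ ^ (2 * n) + 4 * N * T) ≤
      N * σ * (N * ℓ ^ (2 * n) / 16 + T / 8) := by
    rw [div_mul_eq_mul_div, div_le_iff₀ hℓ]
    have : 12 * σ * (2 * N ^ 2 * ℓ ^ (2 * n) + 4 * N * T) =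
      N * σ * (24 * (N * ℓ ^ (2 * n)) + 48 * T) := by ring
    rw [this, mul_assoc (N * σ)]
    refine mul_le_mul_of_nonneg_left ?_ hu.le
    have : 0 ≤ N * ℓ ^ (2 * n) / 16 + T / 8 := by positivity
    nlinarith [mul_le_mul_of_nonneg_left hℓ512 this, mul_pos hN' hL]
  have c3 : N * σ * (7 / 8) * T ≤ (N * σ + 1 - d - σ) * T := by
    refine mul_le_mul_of_nonneg_right ?_ hT0
    nlinarith
  have c4 : N * σ * T ≤ N * σ * (N * ℓ ^ (2 * n)) := by
    have : 0 < N * σ * (N * ℓ ^ (2 * n)) := by positivity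
    rw [c1] at hfin
    nlinarith
  have c5 := le_of_mul_le_mul_left c4 hu
  refine c5.trans (le_of_eq ?_)
  rw [pow_mul, hℓ2, mul_pow]; ring

end CenteredTrace

/-! ### Trace moments of the matrix of centered weights. -/

theorem AdmissibleWeightLaw.tame {ν : Measure ℝ} [IsProbabilityMeasure ν]
    (hν : AdmissibleWeightLaw ν) : Tame (fun x : ℝ => x) ν := by
  refine ⟨measurable_id, fun k => ?_⟩
  rcases Nat.eq_zero_or_pos k with hk | hk
  · subst hk; simp
  refine ((integrable_const (1 : ℝ)).add (hν k hk).1).mono'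
    (by fun_prop) (ae_of_all _ fun x => ?_)
  simp only [Pi.add_apply, norm_pow, norm_abs_eq_norm, Real.norm_eq_abs]
  rw [two_mul, pow_add]
  nlinarith [sq_nonneg (|x| ^ k - 1)]

theorem weightedAdj_apply {N : ℕ} (H : SimpleGraph (Fin N)) (w : Sym2 (Fin N) → ℝ) (i j : Fin N) :
    weightedAdj H w i j = adj H i j * w s(i, j) := by
  simp [weightedAdj, adj]

/-- The weighted adjacency matrix with centered weights. -/
noncomputable def noise {N d : ℕ} (m : ℝ) (s : Sample N d) : Matrix (Fin N) (Fin N) ℝ :=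
  weightedAdj s.1.1 s.wt - m • s.adj

section Resample

variable {N d : ℕ}

theorem noise_apply (m : ℝ) (s : Sample N d) (i j : Fin N) :
    noise m s i j = s.adj i j * (s.wt s(i, j) - m) := by
  simp [noise, weightedAdj_apply]; ring

theorem adj_symm (H : SimpleGraph (Fin N)) (i j : Fin N) : adj H i j = adj H j i := by
  by_cases h : H.Adj i j
  · simp [adj, h, h.symm]
  · have h' : ¬ H.Adj j i := fun h' => h h'.symm
    simp [adj, h, h']

theorem weightedAdj_isSymm (H : SimpleGraph (Fin N)) (w : Sym2 (Fin N) → ℝ) :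
    (weightedAdj H w).IsSymm := by
  ext i j
  rw [Matrix.transpose_apply, weightedAdj_apply, weightedAdj_apply, adj_symm, Sym2.eq_swap]

theorem noise_isSymm (m : ℝ) (s : Sample N d) : (noise m s).IsSymm :=
  (weightedAdj_isSymm _ _).sub (s.isRegularAdj.isSymm.smul m)

/-- The two-term formula covers i = j as well: the adjacency matrix vanishes on the diagonal, so
both terms are zero. -/
theorem weightedAdj_resample_sub (s : Sample N d) (i j : Fin N) :
    weightedAdj s.1.1 (s.resample s(i, j)).wt - weightedAdj s.1.1 s.wt =
      ∑ t : Fin 2, Matrix.single (![i, j] t) (![i, j] (1 - t))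
        (s.adj i j * (s.spare - s.wt s(i, j))) := by
  ext a b
  rw [Fin.sum_univ_two]
  simp only [Matrix.sub_apply, weightedAdj_apply, Matrix.add_apply, Matrix.single_apply]
  have hsymm : s.adj j i = s.adj i j := s.isRegularAdj.symm j i
  by_cases hab : s(a, b) = s(i, j)
  · rw [hab, Sample.resample_wt_self]
    rw [Sym2.eq_iff] at hab
    rcases hab with ⟨rfl, rfl⟩ | ⟨rfl, rfl⟩
    · by_cases h : a = b
      · subst h; simp [s.isRegularAdj.diag]
      · simp [h, Ne.symm h]; ring
    · by_cases h : a = b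
      · subst h; simp [s.isRegularAdj.diag]
      · simp [h, Ne.symm h, hsymm]; ring
  · rw [Sample.resample_wt_of_ne _ hab]
    rw [Sym2.eq_iff] at hab
    push Not at hab
    have h1 : ¬ (i = a ∧ j = b) := fun h => hab.1 h.1.symm h.2.symm
    have h2 : ¬ (j = a ∧ i = b) := fun h => hab.2 h.1.symm h.2.symm
    simp [h1, h2]

theorem noise_resample_sub (m : ℝ) (s : Sample N d) (i j : Fin N) :
    noise m (s.resample s(i, j)) - noise m s =
      ∑ t : Fin 2, Matrix.single (![i, j] t) (![i, j] (1 - t))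
        (s.adj i j * (s.spare - s.wt s(i, j))) := by
  rw [← weightedAdj_resample_sub, noise, noise,
    show (s.resample s(i, j)).adj = s.adj from rfl, show (s.resample s(i, j)).1 = s.1 from rfl]
  abel

theorem one_add_add_pow_le {a b : ℝ} (ha : 0 ≤ a) (hb : 0 ≤ b) (k : ℕ) :
    (1 + a + b) ^ k ≤ 3 ^ k * (1 + a ^ k + b ^ k) := by
  set M := max 1 (max a b) with hM
  have h1 : 1 ≤ M := le_max_left _ _
  have h2 : a ≤ M := (le_max_left _ _).trans (le_max_right _ _)
  have h3 : b ≤ M := (le_max_right _ _).trans (le_max_right _ _)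
  have h4 : M ^ k ≤ 1 + a ^ k + b ^ k := by
    have := pow_nonneg ha k
    have := pow_nonneg hb k
    rcases max_choice 1 (max a b) with h | h
    · rw [hM, h, one_pow]; linarith
    · rcases max_choice a b with h' | h' <;> rw [hM, h, h'] <;> linarith
  calc (1 + a + b) ^ k ≤ (3 * M) ^ k := pow_le_pow_left₀ (by positivity) (by linarith) k
    _ = 3 ^ k * M ^ k := mul_pow _ _ _
    _ ≤ _ := by gcongr

/-- The perturbation bound is used with the random cutoff ℓω, where ω = 1 + |w| + |spare| dominates
the increment. The factors ω cancel against (ℓω)², so no unbounded weight multiplies the diagonal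
entries; weights survive only as ω^{2n}, which has finite mean. The choice ℓ² = 128nd gives the
prefactor 1/(8d). -/
theorem adj_mul_weight_mul_noise_sub_le (hd : 0 < d) {n : ℕ} (hn : 1 ≤ n) {ℓ : ℝ} (hℓ : 0 < ℓ)
    (hℓ2 : ℓ ^ 2 = 128 * n * d) (m : ℝ) (s : Sample N d) (i j : Fin N) :
    s.adj i j * s.wt s(i, j) * ((noise m s ^ (2 * n - 1)) i j -
        (noise m (s.resample s(i, j)) ^ (2 * n - 1)) i j) ≤
      1 / (8 * d) * (ℓ ^ (2 * n) * 3 ^ (2 * n) *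
        (s.adj i j * 1 + s.adj i j * |s.2 (some s(i, j))| ^ (2 * n) +
          s.adj i j * |s.2 none| ^ (2 * n)) +
        s.adj i j * ((noise m s ^ (2 * n)) i i + (noise m s ^ (2 * n)) j j +
          ((noise m (s.resample s(i, j)) ^ (2 * n)) i i +
          (noise m (s.resample s(i, j)) ^ (2 * n)) j j))) := by
  have hd' : (0 : ℝ) < d := by exact_mod_cast hd
  have hn' : (1 : ℝ) ≤ n := by exact_mod_cast hn
  have hω := one_add_add_pow_le (abs_nonneg (s.wt s(i, j))) (abs_nonneg s.spare) (2 * n)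
  rcases s.isRegularAdj.zero_or_one i j with h0 | h1
  · rw [h0]; simp
  · rw [h1, one_mul]
    set ω := 1 + |s.wt s(i, j)| + |s.spare| with hωdef
    have hω1 : 1 ≤ ω := by have := abs_nonneg (s.wt s(i, j)); have := abs_nonneg s.spare; linarith
    have hD := noise_resample_sub m s i j
    have hc : ∀ t : Fin 2, |s.adj i j * (s.spare - s.wt s(i, j))| ≤ ω := by
      intro _
      rw [h1, one_mul]
      refine (abs_sub _ _).trans ?_
      linarith
    have h2 := abs_pow_sub_pow_apply_le (noise_isSymm m s) (noise_isSymm m (s.resample s(i, j)))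
      hD hc (ℓ := ℓ * ω) (by positivity) hn (by linarith) 0 1
    simp only [Fin.sum_univ_two, Matrix.cons_val_zero, Matrix.cons_val_one, Fintype.card_fin]
      at h2
    rw [abs_sub_comm] at h2
    have h3 : |s.wt s(i, j)| ≤ ω := by have := abs_nonneg s.spare; linarith
    refine (le_abs_self _).trans ?_
    rw [abs_mul]
    refine (mul_le_mul h3 h2 (abs_nonneg _) (by linarith)).trans ?_
    have h4 := pow_two_mul_apply_nonneg (noise_isSymm m s) n
    have h5 := pow_two_mul_apply_nonneg (noise_isSymm m (s.resample s(i, j))) n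
    set q := (noise m s ^ (2 * n)) i i + (noise m (s.resample s(i, j)) ^ (2 * n)) i i +
      ((noise m s ^ (2 * n)) j j + (noise m (s.resample s(i, j)) ^ (2 * n)) j j) with hq
    calc ω * (8 * n * (2 : ℕ) * ω / (ℓ * ω) ^ 2 * ((ℓ * ω) ^ (2 * n) + q))
        = 1 / (8 * d) * (ℓ ^ (2 * n) * ω ^ (2 * n) + q) := by
          rw [mul_pow ℓ ω (2 * n), mul_pow ℓ ω 2, hℓ2]
          have : ω ≠ 0 := by positivity
          push_cast
          field_simp
          ring
      _ ≤ 1 / (8 * d) * (ℓ ^ (2 * n) * (3 ^ (2 * n) * (1 + |s.wt s(i, j)| ^ (2 * n) +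
            |s.spare| ^ (2 * n))) + q) := by
          gcongr
      _ = _ := by rw [hq]; ring

variable {ν : Measure ℝ} [IsProbabilityMeasure ν] [Nonempty (RegGraph N d)]

theorem tame_adj (i j : Fin N) : Tame (fun s : Sample N d => s.adj i j) (sampleLaw N d ν) :=
  tame_graph fun H => adj H.1 i j

theorem tame_noise (hx : Tame (fun x : ℝ => x) ν) (m : ℝ) (i j : Fin N) :
    Tame (fun s : Sample N d => noise m s i j) (sampleLaw N d ν) := by
  simp only [noise_apply]
  exact (tame_adj i j).mul ((tame_weight_comp hx _).sub (Tame.const _))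

theorem integral_sum_adj_mul_weight {f : ℝ → ℝ} (hf : Tame f ν)
    (o : Fin N → Fin N → Option (Sym2 (Fin N))) :
    ∫ s : Sample N d, ∑ i, ∑ j, s.adj i j * f (s.2 (o i j)) ∂sampleLaw N d ν =
      N * d * ∫ x, f x ∂ν := by
  have ht := fun i j => (tame_adj (d := d) (ν := ν) i j).mul (tame_weight_comp hf (o i j))
  rw [integral_finsetSum _ fun i _ => (Tame.sum _ fun j => ht i j).integrable,
    Finset.sum_congr rfl fun i _ => integral_finsetSum _ fun j _ => (ht i j).integrable]
  have e : ∀ i j, ∫ s : Sample N d, s.adj i j * f (s.2 (o i j)) ∂sampleLaw N d ν =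
      (∫ s : Sample N d, s.adj i j ∂sampleLaw N d ν) * ∫ x, f x ∂ν := fun i j =>
    integral_graph_mul_weight (fun H => adj H.1 i j) hf.1 (o i j)
  simp only [e, ← Finset.sum_mul]
  congr 1
  have e2 : ∀ i, ∑ j, ∫ s : Sample N d, s.adj i j ∂sampleLaw N d ν = d := by
    intro i
    rw [← integral_finsetSum _ fun j _ => (tame_adj i j).integrable,
      integral_congr_ae (ae_of_all _ fun s => s.isRegularAdj.row_sum i)]
    simp
  rw [Finset.sum_congr rfl fun i _ => e2 i]
  simp

/-- Summing over neighbors produces the factor d. The resampled terms have the same integrals as the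
original ones, since the exchange preserves the law and the graph. -/
theorem integral_sum_adj_mul_vertex {g : Fin N → Sample N d → ℝ}
    (hg : ∀ x, Tame (g x) (sampleLaw N d ν)) :
    ∫ s : Sample N d, ∑ i, ∑ j, s.adj i j * (g i s + g j s + (g i (s.resample s(i, j)) +
        g j (s.resample s(i, j)))) ∂sampleLaw N d ν =
      4 * (d * ∫ s, ∑ x, g x s ∂sampleLaw N d ν) := by
  have hX := tame_adj (N := N) (d := d) (ν := ν)
  have hT := fun e x => (hg x).comp (measurePreserving_resample (d := d) (ν := ν) e)
  have e1 : ∀ s : Sample N d, ∑ i, ∑ j, s.adj i j * (g i s + g j s) = 2 * (d * ∑ x, g x s) := by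
    intro s
    simp only [mul_add, Finset.sum_add_distrib]
    rw [Finset.sum_comm (f := fun i j => s.adj i j * g j s)]
    simp only [← Finset.sum_mul, s.isRegularAdj.row_sum]
    have : ∀ j, ∑ i, s.adj i j = d := fun j => by
      rw [← s.isRegularAdj.row_sum j]
      exact Finset.sum_congr rfl fun i _ => s.isRegularAdj.symm i j
    simp only [this, ← Finset.mul_sum]
    ring
  have i1 : ∀ i j, Tame (fun s : Sample N d => s.adj i j * (g i s + g j s)) (sampleLaw N d ν) :=
    fun i j => (hX i j).mul ((hg i).add (hg j))
  have i2 : ∀ i j, Tame (fun s : Sample N d => s.adj i j * (g i (s.resample s(i, j)) +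
      g j (s.resample s(i, j)))) (sampleLaw N d ν) :=
    fun i j => (hX i j).mul ((hT _ i).add (hT _ j))
  have e2 : ∫ s : Sample N d, ∑ i, ∑ j, s.adj i j * (g i (s.resample s(i, j)) +
      g j (s.resample s(i, j))) ∂sampleLaw N d ν =
      ∫ s : Sample N d, ∑ i, ∑ j, s.adj i j * (g i s + g j s) ∂sampleLaw N d ν := by
    rw [integral_finsetSum _ fun i _ => (Tame.sum _ fun j => i2 i j).integrable,
      integral_finsetSum _ fun i _ => (Tame.sum _ fun j => i1 i j).integrable]
    refine Finset.sum_congr rfl fun i _ => ?_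
    rw [integral_finsetSum _ fun j _ => (i2 i j).integrable,
      integral_finsetSum _ fun j _ => (i1 i j).integrable]
    refine Finset.sum_congr rfl fun j _ => ?_
    rw [← integral_comp_preserving (i1 i j).1 (measurePreserving_resample s(i, j))]
    rfl
  simp only [mul_add (Sample.adj _ _ _) (g _ _ + g _ _) (g _ _ + g _ _), Finset.sum_add_distrib]
  rw [integral_add (Tame.sum _ fun i => Tame.sum _ fun j => i1 i j).integrable
    (Tame.sum _ fun i => Tame.sum _ fun j => i2 i j).integrable, e2]
  simp only [e1, integral_const_mul]
  ring

/-- The counterpart of `integral_trace_centered_pow_le` for the weights: the vertex terms add up to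
4dT, which the prefactor 1/(8d) turns into T/2, and this is absorbed on the left. -/
theorem integral_trace_noise_pow_le_of_pos (hx : Tame (fun x : ℝ => x) ν) (hd : 0 < d) {n : ℕ}
    (hn : 1 ≤ n) :
    ∫ s : Sample N d, (noise (∫ x, x ∂ν) s ^ (2 * n)).trace ∂sampleLaw N d ν ≤
      (128 * n) ^ n * (3 ^ (2 * n) * (1 + 2 * ∫ x, |x| ^ (2 * n) ∂ν)) * (N * d ^ n) := by
  set m := ∫ x, x ∂ν
  have hd' : (0 : ℝ) < d := by exact_mod_cast hd
  have hn' : (1 : ℝ) ≤ n := by exact_mod_cast hn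
  have hZ := tame_noise (N := N) (d := d) hx m
  have hF := Tame.matrix_pow hZ (2 * n - 1)
  have hG := Tame.matrix_pow hZ (2 * n)
  have hX := tame_adj (N := N) (d := d) (ν := ν)
  have hw := fun o => tame_weight_comp (N := N) (d := d) hx o
  have hFT := fun e i j => (hF i j).comp (measurePreserving_resample (d := d) (ν := ν) e)
  have hGT := fun e i j => (hG i j).comp (measurePreserving_resample (d := d) (ν := ν) e)
  set T := ∫ s : Sample N d, (noise m s ^ (2 * n)).trace ∂sampleLaw N d ν with hT
  set K := ∫ x, |x| ^ (2 * n) ∂ν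
  have hΛ : (0 : ℝ) < 128 * n * d := by positivity
  obtain ⟨ℓ, hℓ, hℓ2⟩ : ∃ ℓ : ℝ, 0 < ℓ ∧ ℓ ^ 2 = 128 * n * d :=
    ⟨√(128 * n * d), Real.sqrt_pos.2 hΛ, Real.sq_sqrt hΛ.le⟩
  have e1 : T = ∑ i, ∑ j, ∫ s : Sample N d,
      s.adj i j * s.wt s(i, j) * ((noise m s ^ (2 * n - 1)) i j -
        (noise m (s.resample s(i, j)) ^ (2 * n - 1)) i j) ∂sampleLaw N d ν := by
    have : ∀ s : Sample N d, (noise m s ^ (2 * n)).trace =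
        ∑ i, ∑ j, s.adj i j * (s.wt s(i, j) - m) * (noise m s ^ (2 * n - 1)) i j := by
      intro s
      rw [show 2 * n = 1 + (2 * n - 1) by omega, ← sum_sum_pow_mul_pow (noise_isSymm m s)]
      simp only [pow_one, noise_apply, Nat.add_sub_cancel_left]
    have ht : ∀ i j, Tame (fun s : Sample N d => s.adj i j * (s.wt s(i, j) - m) *
        (noise m s ^ (2 * n - 1)) i j) (sampleLaw N d ν) := fun i j =>
      ((hX i j).mul ((hw _).sub (Tame.const _))).mul (hF i j)
    rw [hT, integral_congr_ae (ae_of_all _ this),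
      integral_finsetSum _ fun i _ => (Tame.sum _ fun j => ht i j).integrable]
    refine Finset.sum_congr rfl fun i _ => ?_
    rw [integral_finsetSum _ fun j _ => (ht i j).integrable]
    refine Finset.sum_congr rfl fun j _ => ?_
    exact integral_resample s(i, j) (hF i j) (fun s t h h' => by
      simp only [noise, h, Sample.adj, funext h']) (fun H => adj H.1 i j) hx
  have t0 := fun i j => (hX i j).mul (Tame.const 1)
  have t1 := fun i j => (hX i j).mul ((hw (some s(i, j))).abs.pow (2 * n))
  have t2 := fun i j => (hX i j).mul ((hw none).abs.pow (2 * n))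
  have t3 := fun i j => (hX i j).mul (((hG i i).add (hG j j)).add
    ((hGT s(i, j) i i).add (hGT s(i, j) j j)))
  have t4 := fun i j => (Tame.const (μ := sampleLaw N d ν) (1 / (8 * (d : ℝ)))).mul
    (((Tame.const (ℓ ^ (2 * n) * 3 ^ (2 * n))).mul (((t0 i j).add (t1 i j)).add (t2 i j))).add
      (t3 i j))
  have step : ∀ i j, ∫ s : Sample N d,
      s.adj i j * s.wt s(i, j) * ((noise m s ^ (2 * n - 1)) i j -
        (noise m (s.resample s(i, j)) ^ (2 * n - 1)) i j) ∂sampleLaw N d ν ≤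
      ∫ s : Sample N d, 1 / (8 * d) * (ℓ ^ (2 * n) * 3 ^ (2 * n) *
        (s.adj i j * 1 + s.adj i j * |s.2 (some s(i, j))| ^ (2 * n) +
          s.adj i j * |s.2 none| ^ (2 * n)) +
        s.adj i j * ((noise m s ^ (2 * n)) i i + (noise m s ^ (2 * n)) j j +
          ((noise m (s.resample s(i, j)) ^ (2 * n)) i i +
          (noise m (s.resample s(i, j)) ^ (2 * n)) j j))) ∂sampleLaw N d ν := by
    intro i j
    refine integral_mono (((hX i j).mul (hw _)).mul ((hF i j).sub (hFT s(i, j) i j))).integrable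
      (t4 i j).integrable fun s => ?_
    exact adj_mul_weight_mul_noise_sub_le hd hn hℓ hℓ2 m s i j
  have hsum : T ≤ 1 / (8 * d) * (ℓ ^ (2 * n) * 3 ^ (2 * n) * (N * d * 1 + N * d * K + N * d * K) +
      4 * (d * T)) := by
    refine (le_of_eq e1).trans
      ((Finset.sum_le_sum fun i _ => Finset.sum_le_sum fun j _ => step i j).trans (le_of_eq ?_))
    have a0 := integral_sum_adj_mul_weight (N := N) (d := d) (ν := ν) (f := fun _ => 1)
      (Tame.const _) (fun i j => none)
    have a1 := integral_sum_adj_mul_weight (N := N) (d := d) (ν := ν) (f := fun x => |x| ^ (2 * n))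
      (hx.abs.pow _) (fun i j => some s(i, j))
    have a2 := integral_sum_adj_mul_weight (N := N) (d := d) (ν := ν) (f := fun x => |x| ^ (2 * n))
      (hx.abs.pow _) (fun i j => none)
    have a3 := integral_sum_adj_mul_vertex (N := N) (d := d) (ν := ν)
      (g := fun x s => (noise m s ^ (2 * n)) x x) (fun x => hG x x)
    have e : ∀ s : Sample N d, ∑ x, (noise m s ^ (2 * n)) x x = (noise m s ^ (2 * n)).trace :=
      fun _ => rfl
    simp only [e, ← hT] at a3
    have a0' : ∫ x : ℝ, (1:ℝ) ∂ν = 1 := by simp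
    rw [a0'] at a0
    have e4 : ∀ s : Sample N d, ∑ i, ∑ j, (1 / (8 * (d : ℝ)) * (ℓ ^ (2 * n) * 3 ^ (2 * n) *
        (s.adj i j * 1 + s.adj i j * |s.2 (some s(i, j))| ^ (2 * n) +
          s.adj i j * |s.2 none| ^ (2 * n)) +
        s.adj i j * ((noise m s ^ (2 * n)) i i + (noise m s ^ (2 * n)) j j +
          ((noise m (s.resample s(i, j)) ^ (2 * n)) i i +
          (noise m (s.resample s(i, j)) ^ (2 * n)) j j)))) =
        1 / (8 * (d : ℝ)) * (ℓ ^ (2 * n) * 3 ^ (2 * n) *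
        (∑ i, ∑ j, s.adj i j * 1 + ∑ i, ∑ j, s.adj i j * |s.2 (some s(i, j))| ^ (2 * n) +
          ∑ i, ∑ j, s.adj i j * |s.2 none| ^ (2 * n)) +
        ∑ i, ∑ j, s.adj i j * ((noise m s ^ (2 * n)) i i + (noise m s ^ (2 * n)) j j +
          ((noise m (s.resample s(i, j)) ^ (2 * n)) i i +
          (noise m (s.resample s(i, j)) ^ (2 * n)) j j))) := fun s => by
      simp only [← Finset.mul_sum, Finset.sum_add_distrib]
    have u0 := Tame.sum (μ := sampleLaw N d ν) Finset.univ fun i => Tame.sum Finset.univ (t0 i)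
    have u1 := Tame.sum (μ := sampleLaw N d ν) Finset.univ fun i => Tame.sum Finset.univ (t1 i)
    have u2 := Tame.sum (μ := sampleLaw N d ν) Finset.univ fun i => Tame.sum Finset.univ (t2 i)
    have u3 := Tame.sum (μ := sampleLaw N d ν) Finset.univ fun i => Tame.sum Finset.univ (t3 i)
    rw [Finset.sum_congr rfl fun i _ => (integral_finsetSum _ fun j _ => (t4 i j).integrable).symm,
      ← integral_finsetSum _ fun i _ => (Tame.sum _ fun j => t4 i j).integrable,
      integral_congr_ae (ae_of_all _ fun s => e4 s), integral_const_mul,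
      integral_add ((Tame.const _).mul ((u0.add u1).add u2)).integrable u3.integrable,
      integral_const_mul, integral_add (u0.add u1).integrable u2.integrable,
      integral_add u0.integrable u1.integrable, a0, a1, a2, a3]
  have hc : 1 / (8 * d) * (ℓ ^ (2 * n) * 3 ^ (2 * n) * (N * d * 1 + N * d * K + N * d * K) +
      4 * (d * T)) = ℓ ^ (2 * n) * 3 ^ (2 * n) * (N * (1 + 2 * K)) / 8 + T / 2 := by
    field_simp; ring
  rw [hc] at hsum
  have hK : 0 ≤ K := integral_nonneg fun x => by positivity
  have hpos : 0 ≤ ℓ ^ (2 * n) * 3 ^ (2 * n) * (N * (1 + 2 * K)) := by positivity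
  have : T ≤ ℓ ^ (2 * n) * 3 ^ (2 * n) * (N * (1 + 2 * K)) := by linarith
  refine this.trans (le_of_eq ?_)
  rw [pow_mul ℓ, hℓ2, mul_pow]; ring

theorem ae_eq_mean_of_variance_eq_zero (hx : Tame (fun x : ℝ => x) ν)
    (h : ∫ x, x ^ 2 ∂ν - (∫ x, x ∂ν) ^ 2 = 0) : ∀ᵐ x ∂ν, x = ∫ x, x ∂ν := by
  have h1 : ∫ x, (x - ∫ x, x ∂ν) ^ 2 ∂ν = 0 := by
    have e : ∀ x : ℝ, (x - ∫ x, x ∂ν) ^ 2 = x ^ 2 - 2 * (∫ x, x ∂ν) * x + (∫ x, x ∂ν) ^ 2 :=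
      fun x => by ring
    simp only [e]
    rw [integral_add ((hx.pow 2).sub ((Tame.const _).mul hx)).integrable (integrable_const _),
      integral_sub (hx.pow 2).integrable (hx.integrable.const_mul _), integral_const_mul]
    simp only [integral_const, probReal_univ, one_smul]
    linarith
  rw [integral_eq_zero_iff_of_nonneg (fun x => sq_nonneg _)
    ((hx.sub (Tame.const _)).pow 2).integrable] at h1
  filter_upwards [h1] with x hx
  simpa [sub_eq_zero] using hx

theorem variance_nonneg (hx : Tame (fun x : ℝ => x) ν) :
    0 ≤ ∫ x, x ^ 2 ∂ν - (∫ x, x ∂ν) ^ 2 := by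
  have h1 : 0 ≤ ∫ x, (x - ∫ x, x ∂ν) ^ 2 ∂ν := integral_nonneg fun x => sq_nonneg _
  have e : ∀ x : ℝ, (x - ∫ x, x ∂ν) ^ 2 = x ^ 2 - 2 * (∫ x, x ∂ν) * x + (∫ x, x ∂ν) ^ 2 :=
    fun x => by ring
  simp only [e] at h1
  rw [integral_add ((hx.pow 2).sub ((Tame.const _).mul hx)).integrable (integrable_const _),
    integral_sub (hx.pow 2).integrable (hx.integrable.const_mul _), integral_const_mul] at h1
  simp only [integral_const, probReal_univ, one_smul] at h1
  linarith

theorem ae_noise_eq_zero (hx : Tame (fun x : ℝ => x) ν)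
    (h : ∫ x, x ^ 2 ∂ν - (∫ x, x ∂ν) ^ 2 = 0) :
    ∀ᵐ s ∂sampleLaw N d ν, ∀ e, s.wt e = ∫ x, x ∂ν := by
  rw [ae_all_iff]
  intro e
  exact (measurePreserving_weight (some e)).quasiMeasurePreserving.ae
    (ae_eq_mean_of_variance_eq_zero hx h)

end Resample

/-- The scale has to be vd and not d, because the squared normalization dominates vd but can be far
below d when v = 0. In that case the noise vanishes almost surely; otherwise v^n goes into the
constant. -/
theorem exists_integral_trace_noise_pow_le {ν : Measure ℝ} [IsProbabilityMeasure ν]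
    (hx : Tame (fun x : ℝ => x) ν) {n : ℕ} (hn : 1 ≤ n) :
    ∃ C : ℝ, 0 ≤ C ∧ ∀ (N d : ℕ) [Nonempty (RegGraph N d)], 0 < d →
      ∫ s : Sample N d, (noise (∫ x, x ∂ν) s ^ (2 * n)).trace ∂sampleLaw N d ν ≤
        C * (N * ((∫ x, x ^ 2 ∂ν - (∫ x, x ∂ν) ^ 2) * d) ^ n) := by
  set v := ∫ x, x ^ 2 ∂ν - (∫ x, x ∂ν) ^ 2 with hv
  rcases (variance_nonneg hx).eq_or_lt with h0 | h0
  · refine ⟨0, le_rfl, fun N d _ hd => ?_⟩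
    rw [zero_mul]
    refine le_of_eq (integral_eq_zero_of_ae ?_)
    filter_upwards [ae_noise_eq_zero (N := N) (d := d) hx h0.symm] with s hs
    have : noise (∫ x, x ∂ν) s = 0 := by
      ext i j; simp [noise_apply, hs]
    rw [this, zero_pow (by omega)]; simp
  · have hK : 0 ≤ ∫ x, |x| ^ (2 * n) ∂ν := integral_nonneg fun x => by positivity
    refine ⟨(128 * n) ^ n * (3 ^ (2 * n) * (1 + 2 * ∫ x, |x| ^ (2 * n) ∂ν)) / v ^ n,
      by positivity, fun N d _ hd => ?_⟩
    refine (integral_trace_noise_pow_le_of_pos hx hd hn).trans (le_of_eq ?_)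
    rw [← hv] at h0
    rw [mul_pow v]; field_simp

/-! ### Decomposition and a priori trace moments of the standardized matrix. -/

/-- The deterministic difference between the two ways of centering an adjacency matrix. -/
noncomputable def centeringError (N d : ℕ) (m : ℝ) : Matrix (Fin N) (Fin N) ℝ :=
  m • (((d : ℝ) / N) • onesMat N - ((d : ℝ) / (N - 1)) • offDiagOnes N)

/-- The square of the normalization in `standardized`. -/
noncomputable def scaleSq (N d : ℕ) (ν : Measure ℝ) : ℝ :=
  (d : ℝ) * ((∫ x, x ^ 2 ∂ν) - (∫ x, x ∂ν) ^ 2 * ((d : ℝ) / ((N : ℝ) - 1)))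

theorem standardized_eq {N d : ℕ} (ν : Measure ℝ) (s : Sample N d) :
    standardized d ν s.1.1 s.wt = (√(scaleSq N d ν))⁻¹ • (noise (∫ x, x ∂ν) s +
      (∫ x, x ∂ν) • centered d s.adj + centeringError N d (∫ x, x ∂ν)) := by
  rw [standardized, scaleSq, noise, centered, centeringError]
  congr 1
  rw [smul_sub, smul_sub, smul_smul, smul_smul]
  abel

theorem standardized_isSymm {N d : ℕ} (ν : Measure ℝ) (s : Sample N d) :
    (standardized d ν s.1.1 s.wt).IsSymm := by
  have := standardized_isHermitian d ν s.1.1 s.wt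
  rwa [Matrix.IsHermitian, Matrix.conjTranspose_eq_transpose_of_trivial] at this

theorem standardized_resample_sub {N d : ℕ} (ν : Measure ℝ) (s : Sample N d) (i j : Fin N) :
    standardized d ν (s.resample s(i, j)).1.1 (s.resample s(i, j)).wt -
        standardized d ν s.1.1 s.wt =
      ∑ t : Fin 2, Matrix.single (![i, j] t) (![i, j] (1 - t))
        ((√(scaleSq N d ν))⁻¹ * (s.adj i j * (s.spare - s.wt s(i, j)))) := by
  rw [standardized_eq, standardized_eq, ← smul_sub,
    show (s.resample s(i, j)).adj = s.adj from rfl, add_sub_add_right_eq_sub,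
    add_sub_add_right_eq_sub, noise_resample_sub, Finset.smul_sum]
  simp [Matrix.smul_single]

section Scale

variable {N d : ℕ} {ν : Measure ℝ} [IsProbabilityMeasure ν] [Nonempty (RegGraph N d)]

omit [IsProbabilityMeasure ν] [Nonempty (RegGraph N d)] in
theorem scaleSq_eq (hN : 2 ≤ N) : scaleSq N d ν =
    d * (∫ x, x ^ 2 ∂ν - (∫ x, x ∂ν) ^ 2) + (∫ x, x ∂ν) ^ 2 * rowVar N d -
      (∫ x, x ∂ν) ^ 2 * (d ^ 2 / (N * (N - 1))) := by
  have hN' : (2 : ℝ) ≤ N := by exact_mod_cast hN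
  have h1 : (N : ℝ) - 1 ≠ 0 := by linarith
  have h2 : (N : ℝ) ≠ 0 := by linarith
  rw [scaleSq, rowVar]; field_simp; ring

omit [IsProbabilityMeasure ν] in
theorem degree_le (hN : 0 < N) : (d : ℝ) ≤ N - 1 := by
  have hreg : IsRegularAdj (adj (Classical.arbitrary (RegGraph N d)).1) d :=
    (isRegularAdj_iff _).2 (Classical.arbitrary (RegGraph N d)).2
  have := hreg.row_sum_coAdj ⟨0, hN⟩
  have h2 : 0 ≤ ∑ j, coAdj (adj (Classical.arbitrary (RegGraph N d)).1) ⟨0, hN⟩ j :=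
    Finset.sum_nonneg fun j _ => hreg.coAdj_nonneg _ _
  linarith

/-- The defect dv + m²σ − `scaleSq` equals m²d²/(N(N − 1)), which lies between 0 and m². Since σ ≤
d, this also gives `scaleSq` ≥ σm₂ − m² ≥ σm₂/2, with m₂ the second moment. -/
theorem scaleSq_bounds (hx : Tame (fun x : ℝ => x) ν) (hσ : 16 ≤ rowVar N d) :
    d * (∫ x, x ^ 2 ∂ν - (∫ x, x ∂ν) ^ 2) ≤ scaleSq N d ν ∧
    (∫ x, x ^ 2 ∂ν) * rowVar N d ≤ 2 * scaleSq N d ν ∧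
    |d * (∫ x, x ^ 2 ∂ν - (∫ x, x ∂ν) ^ 2) + (∫ x, x ∂ν) ^ 2 * rowVar N d - scaleSq N d ν| ≤
      (∫ x, x ∂ν) ^ 2 := by
  obtain ⟨hN, h16, h17⟩ := mem_bounds_of_rowVar (d := d) hσ
  have hN' : (0 : ℝ) < N := by exact_mod_cast hN
  have hN16 : (16 : ℝ) ≤ N := by
    by_contra h
    push Not at h
    nlinarith
  have hN2 : 2 ≤ N := by
    have : (2 : ℝ) ≤ N := by linarith
    exact_mod_cast this
  have hd1 := degree_le (d := d) hN
  have hv := variance_nonneg hx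
  set m := ∫ x, x ∂ν
  set m2 := ∫ x, x ^ 2 ∂ν
  have hreg : IsRegularAdj (adj (Classical.arbitrary (RegGraph N d)).1) d :=
    (isRegularAdj_iff _).2 (Classical.arbitrary (RegGraph N d)).2
  have hσd := hreg.rowVar_le hN
  have hd0 := hreg.d_nonneg hN
  have hm : m ^ 2 * rowVar N d ≥ 0 := by positivity
  have hq0 : 0 ≤ (d : ℝ) ^ 2 / (N * (N - 1)) :=
    div_nonneg (sq_nonneg _) (mul_nonneg hN'.le (by linarith))
  have hq1 : (d : ℝ) ^ 2 / (N * (N - 1)) ≤ 1 := by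
    rw [div_le_one (mul_pos hN' (by linarith))]
    nlinarith
  have hmq0 : 0 ≤ m ^ 2 * ((d : ℝ) ^ 2 / (N * (N - 1))) := by positivity
  have hmq : m ^ 2 * ((d : ℝ) ^ 2 / (N * (N - 1))) ≤ m ^ 2 :=
    mul_le_of_le_one_right (sq_nonneg _) hq1
  have hdv : rowVar N d * (m2 - m ^ 2) ≤ d * (m2 - m ^ 2) := mul_le_mul_of_nonneg_right hσd hv
  refine ⟨?_, ?_, ?_⟩
  · rw [scaleSq]
    refine mul_le_mul_of_nonneg_left (sub_le_sub_left ?_ _) hd0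
    exact mul_le_of_le_one_right (sq_nonneg _) ((div_le_one (by linarith)).2 hd1)
  · rw [scaleSq_eq hN2]
    nlinarith [sq_nonneg m]
  · rw [scaleSq_eq hN2, abs_le]
    constructor <;> nlinarith [sq_nonneg m]

omit [IsProbabilityMeasure ν] in
theorem abs_centeringError_le (hN : 2 ≤ N) (m : ℝ) (i j : Fin N) :
    |centeringError N d m i j| ≤ |m| * (1 / N + if i = j then 1 else 0) := by
  have hN' : (2 : ℝ) ≤ N := by exact_mod_cast hN
  have hd1 := degree_le (d := d) (N := N) (by omega)
  have hd0 : (0 : ℝ) ≤ d := Nat.cast_nonneg _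
  rw [centeringError, Matrix.smul_apply, smul_eq_mul, abs_mul]
  refine mul_le_mul_of_nonneg_left ?_ (abs_nonneg _)
  simp only [Matrix.sub_apply, Matrix.smul_apply, onesMat_apply, smul_eq_mul, offDiagOnes,
    Matrix.of_apply]
  by_cases h : i = j
  · rw [if_pos h, if_pos h, mul_zero, sub_zero, mul_one, abs_of_nonneg (by positivity)]
    have : (d : ℝ) / N ≤ 1 := (div_le_one (by linarith)).2 (by linarith)
    have : (0 : ℝ) ≤ 1 / N := by positivity
    linarith
  · rw [if_neg h, if_neg h, mul_one, mul_one, add_zero, abs_sub_comm]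
    have h1 : (0 : ℝ) < N - 1 := by linarith
    have : (d : ℝ) / (N - 1) - d / N = (d / (N - 1)) * (1 / N) := by
      field_simp; ring
    rw [this, abs_of_nonneg (by positivity)]
    exact mul_le_of_le_one_left (by positivity) ((div_le_one h1).2 hd1)

/-- Submultiplicativity of the norm given by the largest absolute row sum. -/
theorem abs_pow_apply_le_of_row_sum {V : Type*} [Fintype V] [DecidableEq V] {A : Matrix V V ℝ}
    {q : ℝ} (hA : ∀ i, ∑ j, |A i j| ≤ q) (n : ℕ) (i : V) :
    ∑ j, |(A ^ n) i j| ≤ q ^ n := by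
  have hq : 0 ≤ q := (Finset.sum_nonneg fun j _ => abs_nonneg (A i j)).trans (hA i)
  induction n generalizing i with
  | zero => simp [Matrix.one_apply, apply_ite]
  | succ n ih =>
    simp only [pow_succ', Matrix.mul_apply]
    calc ∑ j, |∑ k, A i k * (A ^ n) k j| ≤ ∑ j, ∑ k, |A i k| * |(A ^ n) k j| := by
          refine Finset.sum_le_sum fun j _ => (Finset.abs_sum_le_sum_abs _ _).trans (le_of_eq ?_)
          exact Finset.sum_congr rfl fun k _ => abs_mul _ _
      _ = ∑ k, |A i k| * ∑ j, |(A ^ n) k j| := by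
          rw [Finset.sum_comm]
          exact Finset.sum_congr rfl fun k _ => (Finset.mul_sum _ _ _).symm
      _ ≤ ∑ k, |A i k| * q ^ n :=
          Finset.sum_le_sum fun k _ => mul_le_mul_of_nonneg_left (ih k) (abs_nonneg _)
      _ ≤ q * q ^ n := by
          rw [← Finset.sum_mul]
          exact mul_le_mul_of_nonneg_right (hA i) (by positivity)

omit [IsProbabilityMeasure ν] in
theorem trace_centeringError_pow_le (hN : 2 ≤ N) (m : ℝ) (n : ℕ) :
    (centeringError N d m ^ n).trace ≤ N * (2 * |m|) ^ n := by
  have hN' : (N : ℝ) ≠ 0 := by positivity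
  have h1 : ∀ i, ∑ j, |centeringError N d m i j| ≤ 2 * |m| := by
    intro i
    refine (Finset.sum_le_sum fun j _ => abs_centeringError_le hN m i j).trans (le_of_eq ?_)
    rw [← Finset.mul_sum, Finset.sum_add_distrib]
    simp [hN']; ring
  rw [Matrix.trace]
  refine (Finset.sum_le_sum (g := fun _ => (2 * |m|) ^ n) fun i _ => ?_).trans (by simp)
  refine (le_abs_self _).trans (le_trans ?_ (abs_pow_apply_le_of_row_sum h1 n i))
  exact Finset.single_le_sum (f := fun j => |(centeringError N d m ^ n) i j|)
    (fun j _ => abs_nonneg _) (Finset.mem_univ i)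

theorem tame_standardized (hx : Tame (fun x : ℝ => x) ν) (i j : Fin N) :
    Tame (fun s : Sample N d => standardized d ν s.1.1 s.wt i j) (sampleLaw N d ν) := by
  simp only [standardized_eq, Matrix.smul_apply, Matrix.add_apply, smul_eq_mul]
  exact (Tame.const _).mul (((tame_noise hx _ i j).add ((Tame.const _).mul
    (tame_centered i j))).add (Tame.const _))

end Scale

theorem centeringError_isSymm (N d : ℕ) (m : ℝ) : (centeringError N d m).IsSymm := by
  ext i j
  simp [centeringError, offDiagOnes, eq_comm]

/-- The convexity inequality for traces separates the three parts of M. With τ = `scaleSq`, each has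
trace moment O(Nτ^n): the noise since vd ≤ τ, the graph since m²σ ≤ 2τ, and the deterministic part
by its row sums. -/
theorem exists_integral_trace_standardized_pow_le {ν : Measure ℝ} [IsProbabilityMeasure ν]
    (hν : AdmissibleWeightLaw ν) (n : ℕ) :
    ∃ C : ℝ, 0 ≤ C ∧ ∀ (N d : ℕ) [Nonempty (RegGraph N d)], 16 ≤ rowVar N d →
      ∫ s : Sample N d, (standardized d ν s.1.1 s.wt ^ (2 * n)).trace ∂sampleLaw N d ν ≤
        C * N := by
  have hx := hν.tame
  rcases Nat.eq_zero_or_pos n with h0 | hn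
  · subst h0
    exact ⟨1, zero_le_one, fun N d _ _ => by simp⟩
  obtain ⟨C₁, hC₁, hZ⟩ := exists_integral_trace_noise_pow_le hx hn
  set m := ∫ x, x ∂ν with hm
  set v := ∫ x, x ^ 2 ∂ν - m ^ 2 with hv
  refine ⟨2 ^ (2 * n - 1) * (2 ^ (2 * n - 1) * (C₁ + 2 ^ n * (2 ^ 14 * n) ^ n) + 1),
    by positivity, fun N d _ hσ => ?_⟩
  obtain ⟨hN, h16, h17⟩ := mem_bounds_of_rowVar (d := d) hσ
  obtain ⟨b1, b2, -⟩ := scaleSq_bounds hx hσ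
  have hN' : (0 : ℝ) < N := by exact_mod_cast hN
  have hN2 : 2 ≤ N := by
    have : (16 : ℝ) ≤ N := by
      by_contra h
      push Not at h
      nlinarith
    have : (2 : ℝ) ≤ N := by linarith
    exact_mod_cast this
  have hv0 : 0 ≤ v := variance_nonneg hx
  have hm2 : 0 < ∫ x, x ^ 2 ∂ν := by
    have := (hν 1 le_rfl).2
    simpa using this
  set τ := scaleSq N d ν with hτdef
  have hτ : 0 < τ := by nlinarith
  have hd : 0 < d := by
    rcases Nat.eq_zero_or_pos d with h | h
    · subst h; simp [rowVar] at hσ; norm_num at hσ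
    · exact h
  have hmle : m ^ 2 ≤ ∫ x, x ^ 2 ∂ν := by linarith
  have key : ∀ s : Sample N d, (standardized d ν s.1.1 s.wt ^ (2 * n)).trace ≤
      (τ ^ n)⁻¹ * (2 ^ (2 * n - 1) * (2 ^ (2 * n - 1) * ((noise m s ^ (2 * n)).trace +
        (m ^ 2) ^ n * (centered d s.adj ^ (2 * n)).trace) + N * τ ^ n)) := by
    intro s
    rw [standardized_eq, _root_.smul_pow, Matrix.trace_smul, smul_eq_mul, pow_mul (_⁻¹), inv_pow,
      Real.sq_sqrt hτ.le, inv_pow]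
    refine mul_le_mul_of_nonneg_left ?_ (by positivity)
    have hs1 := noise_isSymm m s
    have hs2 : (m • centered d s.adj).IsSymm := s.isRegularAdj.centered_isSymm.smul m
    refine (trace_add_pow_two_mul_le (hs1.add hs2) (centeringError_isSymm N d m) n).trans ?_
    refine mul_le_mul_of_nonneg_left (add_le_add ?_ ?_) (by positivity)
    · refine (trace_add_pow_two_mul_le hs1 hs2 n).trans (le_of_eq ?_)
      rw [_root_.smul_pow, Matrix.trace_smul, smul_eq_mul, pow_mul m]
    · refine (trace_centeringError_pow_le hN2 m (2 * n)).trans ?_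
      rw [pow_mul (2 * |m|), mul_pow, sq_abs]
      -- From m₂σ ≤ 2τ and σ ≥ 16 follows 8m₂ ≤ τ, and m² ≤ m₂.
      have : 2 ^ 2 * m ^ 2 ≤ τ := by nlinarith
      gcongr
  have tZ := Tame.trace_matrix_pow (tame_noise (N := N) (d := d) hx m) (2 * n)
  have tY := Tame.trace_matrix_pow (tame_centered (N := N) (d := d) (ν := ν)) (2 * n)
  refine (integral_mono (Tame.trace_matrix_pow (tame_standardized hx) (2 * n)).integrable
    (((Tame.const _).mul ((Tame.const _).mul (((Tame.const _).mul (tZ.add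
      ((Tame.const _).mul tY))).add (Tame.const _))))).integrable key).trans ?_
  rw [integral_const_mul, integral_const_mul, integral_add
    ((Tame.const _).mul (tZ.add ((Tame.const _).mul tY))).integrable (integrable_const _),
    integral_const_mul, integral_add tZ.integrable ((Tame.const _).mul tY).integrable,
    integral_const_mul, integral_const, probReal_univ, one_smul]
  have hZ' := hZ N d hd
  have hY' := integral_trace_centered_pow_le (N := N) (d := d) (ν := ν) hn hσ
  have z1 : ∫ s : Sample N d, (noise m s ^ (2 * n)).trace ∂sampleLaw N d ν ≤
      C₁ * (N * τ ^ n) := by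
    refine hZ'.trans ?_
    have : v * d ≤ τ := by linarith
    gcongr
  have y1 : (m ^ 2) ^ n * ∫ s : Sample N d, (centered d s.adj ^ (2 * n)).trace ∂sampleLaw N d ν ≤
      2 ^ n * (2 ^ 14 * n) ^ n * (N * τ ^ n) := by
    calc _ ≤ (m ^ 2) ^ n * ((2 ^ 14 * n) ^ n * (N * rowVar N d ^ n)) := by gcongr
      _ = (2 ^ 14 * n) ^ n * N * (m ^ 2 * rowVar N d) ^ n := by rw [mul_pow (m ^ 2)]; ring
      _ ≤ (2 ^ 14 * n) ^ n * N * (2 * τ) ^ n := by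
          have : m ^ 2 * rowVar N d ≤ 2 * τ := by nlinarith
          have h0 : 0 ≤ m ^ 2 * rowVar N d := by positivity
          gcongr
      _ = _ := by rw [mul_pow 2 τ]; ring
  have hτn : 0 < τ ^ n := by positivity
  calc _ ≤ (τ ^ n)⁻¹ * (2 ^ (2 * n - 1) * (2 ^ (2 * n - 1) * (C₁ * (N * τ ^ n) +
        2 ^ n * (2 ^ 14 * n) ^ n * (N * τ ^ n)) + N * τ ^ n)) := by gcongr
    _ = _ := by field_simp

/-! ### First-order expansion of entries of powers. -/

section Expansion

variable {V κ ι : Type*} [Fintype V] [DecidableEq V] [Fintype κ] [DecidableEq κ] [Fintype ι]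

/-- The total size of the entries of the powers of two matrices at pairs of distinct positions. -/
def offDiagSize (m : ℕ) (M M' : Matrix V V ℝ) (u : κ → V) : ℝ :=
  ∑ a ∈ Finset.range (m + 1), ∑ k, ∑ l,
    if k = l then 0 else |(M ^ a) (u k) (u l)| + |(M' ^ a) (u k) (u l)|

theorem abs_add_abs_le_offDiagSize {m : ℕ} {M M' : Matrix V V ℝ} {u : κ → V} {a : ℕ} (ha : a ≤ m)
    {k l : κ} (hkl : k ≠ l) :
    |(M ^ a) (u k) (u l)| + |(M' ^ a) (u k) (u l)| ≤ offDiagSize m M M' u := by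
  have h0 : ∀ a k l, 0 ≤ if k = l then 0 else |(M ^ a) (u k) (u l)| + |(M' ^ a) (u k) (u l)| :=
    fun a k l => by split_ifs <;> positivity
  calc _ = if k = l then 0 else |(M ^ a) (u k) (u l)| + |(M' ^ a) (u k) (u l)| := by
        rw [if_neg hkl]
    _ ≤ ∑ l, if k = l then 0 else |(M ^ a) (u k) (u l)| + |(M' ^ a) (u k) (u l)| :=
        Finset.single_le_sum (f := fun l => if k = l then 0 else
          |(M ^ a) (u k) (u l)| + |(M' ^ a) (u k) (u l)|) (fun l _ => h0 a k l) (Finset.mem_univ l)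
    _ ≤ ∑ k, ∑ l, if k = l then 0 else |(M ^ a) (u k) (u l)| + |(M' ^ a) (u k) (u l)| :=
        Finset.single_le_sum (f := fun k => ∑ l, if k = l then 0 else
          |(M ^ a) (u k) (u l)| + |(M' ^ a) (u k) (u l)|)
          (fun k _ => Finset.sum_nonneg fun l _ => h0 a k l) (Finset.mem_univ k)
    _ ≤ _ :=
        Finset.single_le_sum (f := fun a => ∑ k, ∑ l, if k = l then 0 else
          |(M ^ a) (u k) (u l)| + |(M' ^ a) (u k) (u l)|)
          (fun a _ => Finset.sum_nonneg fun k _ => Finset.sum_nonneg fun l _ => h0 a k l)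
          (Finset.mem_range.2 (Nat.lt_succ_of_le ha))

theorem offDiagSize_nonneg (m : ℕ) (M M' : Matrix V V ℝ) (u : κ → V) :
    0 ≤ offDiagSize m M M' u :=
  Finset.sum_nonneg fun a _ => Finset.sum_nonneg fun k _ => Finset.sum_nonneg fun l _ => by
    split_ifs <;> positivity

variable {M M' : Matrix V V ℝ} {u : κ → V} {x y : ι → κ} {c : ι → ℝ}

omit [Fintype κ] [DecidableEq κ] in
-- Telescoping with a uniform bound L on the entries. This zeroth-order estimate is meant for
-- remainders, where one extra factor ε suffices.
theorem abs_pow_sub_pow_apply_le_of_entries_le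
    (hD : M' - M = ∑ t, Matrix.single (u (x t)) (u (y t)) (c t)) {ε : ℝ} (hc : ∀ t, |c t| ≤ ε)
    {m n : ℕ} (hn : n ≤ m) {L : ℝ} (hL1 : ∀ a ≤ m, ∀ k l, |(M ^ a) (u k) (u l)| ≤ L)
    (hL2 : ∀ a ≤ m, ∀ k l, |(M' ^ a) (u k) (u l)| ≤ L) (i j : κ) :
    |(M' ^ n) (u i) (u j) - (M ^ n) (u i) (u j)| ≤ m * Fintype.card ι * (ε * L ^ 2) := by
  have hL : 0 ≤ L := (abs_nonneg _).trans (hL1 0 (by omega) i i)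
  have h0 : ∀ a, a < n → |(M ^ a * (M' - M) * M' ^ (n - 1 - a)) (u i) (u j)| ≤
      Fintype.card ι * (ε * L ^ 2) := by
    intro a ha
    rw [hD, mul_sum_single_mul_apply]
    refine (Finset.abs_sum_le_sum_abs _ _).trans ?_
    refine (Finset.sum_le_sum (g := fun _ => ε * L ^ 2) fun t _ => ?_).trans (by simp)
    rw [abs_mul, abs_mul, sq]
    exact mul_le_mul (hc t) (mul_le_mul (hL1 a (by omega) _ _) (hL2 _ (by omega) _ _)
      (abs_nonneg _) hL) (by positivity) ((abs_nonneg _).trans (hc t))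
  rw [← Matrix.sub_apply, pow_sub_pow_eq_sum, Matrix.sum_apply]
  refine (Finset.abs_sum_le_sum_abs _ _).trans ?_
  refine (Finset.sum_le_sum (g := fun _ => Fintype.card ι * (ε * L ^ 2))
    fun a ha => h0 a (Finset.mem_range.1 ha)).trans ?_
  rw [Finset.sum_const, Finset.card_range, nsmul_eq_mul, mul_assoc]
  rcases Nat.eq_zero_or_pos n with rfl | hn0
  · rcases isEmpty_or_nonempty ι with hι | ⟨⟨t⟩⟩
    · simp
    · have : 0 ≤ ε := (abs_nonneg _).trans (hc t)
      rw [Nat.cast_zero, zero_mul]; positivity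
  · have := (abs_nonneg _).trans (h0 0 hn0)
    gcongr

/-- First order expansion of an off-diagonal entry of a power of a matrix. -/
theorem abs_pow_sub_pow_sub_main_le [DecidableEq ι]
    (hD : M' - M = ∑ t, Matrix.single (u (x t)) (u (y t)) (c t)) {ε : ℝ} (hc : ∀ t, |c t| ≤ ε)
    {m n : ℕ} (hn : n + 1 ≤ m) {L : ℝ} (hL1 : ∀ a ≤ m, ∀ k l, |(M ^ a) (u k) (u l)| ≤ L)
    (hL2 : ∀ a ≤ m, ∀ k l, |(M' ^ a) (u k) (u l)| ≤ L) {t₀ : ι}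
    (ht : ∀ t, t ≠ t₀ → x t ≠ x t₀ ∨ y t ≠ y t₀) :
    |(M' ^ (n + 1)) (u (x t₀)) (u (y t₀)) - (M ^ (n + 1)) (u (x t₀)) (u (y t₀)) -
        c t₀ * ∑ a ∈ Finset.range (n + 1), (M ^ a) (u (x t₀)) (u (x t₀)) *
          (M ^ (n - a)) (u (y t₀)) (u (y t₀))| ≤
      m * Fintype.card ι * (ε * L * offDiagSize m M M' u + m * Fintype.card ι * (ε ^ 2 * L ^ 3)) := by
  set i := u (x t₀)
  set j := u (y t₀)
  set O := offDiagSize m M M' u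
  have hL : 0 ≤ L := (abs_nonneg _).trans (hL1 0 (by omega) (x t₀) (x t₀))
  have hε : 0 ≤ ε := (abs_nonneg _).trans (hc t₀)
  have hO : 0 ≤ O := offDiagSize_nonneg _ _ _ _
  have hι : (1 : ℝ) ≤ Fintype.card ι := by
    exact_mod_cast Fintype.card_pos_iff.2 ⟨t₀⟩
  have h0 : ∀ a, a < n + 1 → |(M ^ a * (M' - M) * M' ^ (n + 1 - 1 - a)) i j -
      c t₀ * ((M ^ a) i i * (M ^ (n - a)) j j)| ≤
      Fintype.card ι * (ε * L * O + m * Fintype.card ι * (ε ^ 2 * L ^ 3)) := by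
    intro a ha
    have e : n + 1 - 1 - a = n - a := by omega
    rw [e, hD, mul_sum_single_mul_apply, ← Finset.add_sum_erase _ _ (Finset.mem_univ t₀)]
    -- The distinguished increment: replacing M' by M in the last factor costs a second factor ε.
    have h1 : |c t₀ * ((M ^ a) i i * ((M' ^ (n - a)) j j - (M ^ (n - a)) j j))| ≤
        ε * L * (m * Fintype.card ι * (ε * L ^ 2)) := by
      rw [abs_mul, abs_mul, mul_assoc]
      refine mul_le_mul (hc t₀) (mul_le_mul (hL1 a (by omega) _ _) ?_ (abs_nonneg _) hL)
        (by positivity) hε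
      exact abs_pow_sub_pow_apply_le_of_entries_le hD hc (by omega) hL1 hL2 (y t₀) (y t₀)
    -- Every other increment differs from the distinguished one in its row or its column position,
    -- so one of its two outer factors is at a pair of distinct positions.
    have h2 : |∑ t ∈ Finset.univ.erase t₀, c t * ((M ^ a) i (u (x t)) *
        (M' ^ (n - a)) (u (y t)) j)| ≤ Fintype.card ι * (ε * L * O) := by
      refine (Finset.abs_sum_le_sum_abs _ _).trans ?_
      refine (Finset.sum_le_sum (g := fun _ => ε * L * O) fun t htm => ?_).trans ?_
      · rw [abs_mul, abs_mul, mul_assoc]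
        refine mul_le_mul (hc t) ?_ (by positivity) hε
        rcases ht t (Finset.ne_of_mem_erase htm) with h | h
        · rw [mul_comm L]
          refine mul_le_mul ?_ (hL2 _ (by omega) _ _) (abs_nonneg _) hO
          exact (le_add_of_nonneg_right (abs_nonneg _)).trans
            (abs_add_abs_le_offDiagSize (by omega) h.symm)
        · refine mul_le_mul (hL1 a (by omega) _ _) ?_ (abs_nonneg _) hL
          exact (le_add_of_nonneg_left (abs_nonneg _)).trans
            (abs_add_abs_le_offDiagSize (by omega) h)
      · rw [Finset.sum_const, nsmul_eq_mul]
        have : (Finset.univ.erase t₀).card ≤ Fintype.card ι := Finset.card_le_univ _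
        gcongr
    rw [show c t₀ * ((M ^ a) i (u (x t₀)) * (M' ^ (n - a)) (u (y t₀)) j) +
        ∑ t ∈ Finset.univ.erase t₀, c t * ((M ^ a) i (u (x t)) * (M' ^ (n - a)) (u (y t)) j) -
        c t₀ * ((M ^ a) i i * (M ^ (n - a)) j j) =
        c t₀ * ((M ^ a) i i * ((M' ^ (n - a)) j j - (M ^ (n - a)) j j)) +
        ∑ t ∈ Finset.univ.erase t₀, c t * ((M ^ a) i (u (x t)) * (M' ^ (n - a)) (u (y t)) j) by ring]
    refine (abs_add_le _ _).trans ((add_le_add h1 h2).trans ?_)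
    have : ε * L * (m * Fintype.card ι * (ε * L ^ 2)) ≤
        Fintype.card ι * (m * Fintype.card ι * (ε ^ 2 * L ^ 3)) := by
      calc _ = 1 * (m * Fintype.card ι * (ε ^ 2 * L ^ 3)) := by ring
        _ ≤ _ := by gcongr
    linarith
  rw [← Matrix.sub_apply, pow_sub_pow_eq_sum, Matrix.sum_apply, Finset.mul_sum,
    ← Finset.sum_sub_distrib]
  refine (Finset.abs_sum_le_sum_abs _ _).trans ?_
  refine (Finset.sum_le_sum (g := fun _ => Fintype.card ι * (ε * L * O +
    m * Fintype.card ι * (ε ^ 2 * L ^ 3))) fun a ha => h0 a (Finset.mem_range.1 ha)).trans ?_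
  rw [Finset.sum_const, Finset.card_range, nsmul_eq_mul, mul_assoc (m : ℝ) _ (ε * L * O + _)]
  have : ((n + 1 : ℕ) : ℝ) ≤ m := by exact_mod_cast hn
  gcongr

/-- First order expansion of the product of an off-diagonal entry of a power of a matrix and a
diagonal entry of the next power. -/
theorem abs_mul_sub_mul_sub_main_le [DecidableEq ι]
    (hD : M' - M = ∑ t, Matrix.single (u (x t)) (u (y t)) (c t)) {ε : ℝ} (hc : ∀ t, |c t| ≤ ε)
    {n : ℕ} {L : ℝ} (hL1 : ∀ a ≤ n + 2, ∀ k l, |(M ^ a) (u k) (u l)| ≤ L)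
    (hL2 : ∀ a ≤ n + 2, ∀ k l, |(M' ^ a) (u k) (u l)| ≤ L) {t₀ : ι}
    (ht : ∀ t, t ≠ t₀ → x t ≠ x t₀ ∨ y t ≠ y t₀) (ht₀ : x t₀ ≠ y t₀) {z : ℝ} (hz : |z| ≤ L) :
    |(M' ^ (n + 1)) (u (x t₀)) (u (y t₀)) * ((M' ^ (n + 2)) (u (x t₀)) (u (x t₀)) - z) -
      (M ^ (n + 1)) (u (x t₀)) (u (y t₀)) * ((M ^ (n + 2)) (u (x t₀)) (u (x t₀)) - z) -
        c t₀ * (∑ a ∈ Finset.range (n + 1), (M ^ a) (u (x t₀)) (u (x t₀)) *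
          (M ^ (n - a)) (u (y t₀)) (u (y t₀))) * ((M ^ (n + 2)) (u (x t₀)) (u (x t₀)) - z)| ≤
      3 * ((n + 2) * Fintype.card ι) * (ε * L ^ 2 * offDiagSize (n + 2) M M' u) +
        3 * ((n + 2) * Fintype.card ι) ^ 2 * (ε ^ 2 * L ^ 4) := by
  have hL : 0 ≤ L := (abs_nonneg _).trans hz
  have hε : 0 ≤ ε := (abs_nonneg _).trans (hc t₀)
  have h1 := abs_pow_sub_pow_sub_main_le hD hc (m := n + 2) (n := n) (by omega) hL1 hL2 ht
  have h2 := abs_pow_sub_pow_apply_le_of_entries_le hD hc (le_refl (n + 2)) hL1 hL2 (x t₀) (x t₀)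
  have h3 := abs_pow_sub_pow_apply_le_of_entries_le hD hc (n := n + 1) (m := n + 2) (by omega)
    hL1 hL2 (x t₀) (y t₀)
  have h4 : |(M ^ (n + 1)) (u (x t₀)) (u (y t₀))| ≤ offDiagSize (n + 2) M M' u :=
    (le_add_of_nonneg_right (abs_nonneg _)).trans (abs_add_abs_le_offDiagSize (by omega) ht₀)
  have h5 : |(M ^ (n + 2)) (u (x t₀)) (u (x t₀)) - z| ≤ 2 * L := by
    refine (abs_sub _ _).trans ?_
    linarith [hL1 (n + 2) le_rfl (x t₀) (x t₀)]
  push_cast at h1 h2 h3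
  set O := offDiagSize (n + 2) M M' u
  have hO : 0 ≤ O := offDiagSize_nonneg _ _ _ _
  set P := (M ^ (n + 1)) (u (x t₀)) (u (y t₀))
  set P' := (M' ^ (n + 1)) (u (x t₀)) (u (y t₀))
  set g := (M ^ (n + 2)) (u (x t₀)) (u (x t₀))
  set g' := (M' ^ (n + 2)) (u (x t₀)) (u (x t₀))
  set S := ∑ a ∈ Finset.range (n + 1), (M ^ a) (u (x t₀)) (u (x t₀)) *
          (M ^ (n - a)) (u (y t₀)) (u (y t₀))
  set p : ℝ := (n + 2) * Fintype.card ι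
  have hp : 0 ≤ p := by positivity
  -- Product rule. The increment of the diagonal factor is multiplied either by P, which is itself
  -- off-diagonal, or by P' − P, which makes it second order.
  rw [show P' * (g' - z) - P * (g - z) - c t₀ * S * (g - z) =
    (P' - P - c t₀ * S) * (g - z) + P * (g' - g) + (P' - P) * (g' - g) by ring]
  refine (abs_add_three _ _ _).trans ?_
  rw [abs_mul, abs_mul, abs_mul]
  have b1 := mul_le_mul h1 h5 (abs_nonneg _) ((abs_nonneg _).trans h1)
  have b2 := mul_le_mul h4 h2 (abs_nonneg _) hO
  have b3 := mul_le_mul h3 h2 (abs_nonneg _) ((abs_nonneg _).trans h3)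
  refine (add_le_add (add_le_add b1 b2) b3).trans (le_of_eq ?_)
  ring

end Expansion

/-! ### Pointwise control of the increments in terms of averageable quantities. -/

section Pointwise

variable {V κ ι : Type*} [Fintype V] [DecidableEq V] [Fintype κ] [DecidableEq κ] [Fintype ι]

/-- The total squared size of the entries of the powers of two matrices at pairs of distinct
positions. -/
def offDiagEnergy (m : ℕ) (M M' : Matrix V V ℝ) (u : κ → V) : ℝ :=
  ∑ a ∈ Finset.range (m + 1), ∑ k, ∑ l,
    if k = l then 0 else (M ^ a) (u k) (u l) ^ 2 + (M' ^ a) (u k) (u l) ^ 2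

theorem offDiagSize_sq_le (m : ℕ) (M M' : Matrix V V ℝ) (u : κ → V) :
    offDiagSize m M M' u ^ 2 ≤
      2 * ((m + 1) * Fintype.card κ ^ 2) * offDiagEnergy m M M' u := by
  have h1 : offDiagSize m M M' u = ∑ p ∈ Finset.range (m + 1) ×ˢ (Finset.univ : Finset (κ × κ)),
      if p.2.1 = p.2.2 then 0 else |(M ^ p.1) (u p.2.1) (u p.2.2)| +
        |(M' ^ p.1) (u p.2.1) (u p.2.2)| := by
    rw [Finset.sum_product, offDiagSize]
    exact Finset.sum_congr rfl fun a _ => by rw [Fintype.sum_prod_type]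
  have h2 : offDiagEnergy m M M' u = ∑ p ∈ Finset.range (m + 1) ×ˢ (Finset.univ : Finset (κ × κ)),
      if p.2.1 = p.2.2 then 0 else (M ^ p.1) (u p.2.1) (u p.2.2) ^ 2 +
        (M' ^ p.1) (u p.2.1) (u p.2.2) ^ 2 := by
    rw [Finset.sum_product, offDiagEnergy]
    exact Finset.sum_congr rfl fun a _ => by rw [Fintype.sum_prod_type]
  rw [h1, h2]
  refine (sq_sum_le_card_mul_sum_sq).trans ?_
  rw [Finset.card_product, Finset.card_range, Finset.card_univ, Fintype.card_prod, mul_comm 2,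
    mul_assoc _ (2 : ℝ), Finset.mul_sum _ _ (2 : ℝ)]
  push_cast
  rw [← sq]
  refine mul_le_mul_of_nonneg_left (Finset.sum_le_sum fun p _ => ?_) (by positivity)
  split_ifs
  · simp
  · have a1 := sq_abs ((M ^ p.1) (u p.2.1) (u p.2.2))
    have a2 := sq_abs ((M' ^ p.1) (u p.2.1) (u p.2.2))
    nlinarith [sq_nonneg (|(M ^ p.1) (u p.2.1) (u p.2.2)| - |(M' ^ p.1) (u p.2.1) (u p.2.2)|)]

/-- Young's inequality with a free parameter, by which each error is shared between a quantity known
to be bounded and one known to be small. -/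
theorem mul_le_mul_sq_add_inv_mul_sq {a b δ : ℝ} (hδ : 0 < δ) : a * b ≤ δ * a ^ 2 + δ⁻¹ * b ^ 2 := by
  have h : 0 ≤ δ * (a - δ⁻¹ * b) ^ 2 + δ * a ^ 2 + δ⁻¹ * b ^ 2 := by positivity
  have e : δ * (a - δ⁻¹ * b) ^ 2 = δ * a ^ 2 - 2 * (a * b) + δ⁻¹ * b ^ 2 := by
    field_simp; ring
  nlinarith

theorem pow_four_mul_pow_four_le (a b : ℝ) : a ^ 4 * b ^ 4 ≤ a ^ 8 + b ^ 8 := by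
  nlinarith [sq_nonneg (a ^ 4 - b ^ 4), sq_nonneg (a ^ 4), sq_nonneg (b ^ 4)]

omit [DecidableEq κ] in
-- With r^{8m} = 1 + (the diagonal entries of the 8m-th powers), L = 2zr^m bounds all the entries
-- and L^8 is linear in those diagonal entries, hence averages to a trace moment. The eighth power
-- fits ω⁴L⁴ ≤ ω⁸ + L⁸.
theorem exists_entries_bound {M M' : Matrix V V ℝ} (hM : M.IsSymm) (hM' : M'.IsSymm) (u : κ → V)
    {m : ℕ} (hm : 1 ≤ m) {z : ℝ} (hz : 1 ≤ z) :
    ∃ L : ℝ, z ≤ L ∧ (∀ a ≤ m, ∀ k l, |(M ^ a) (u k) (u l)| ≤ L) ∧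
      (∀ a ≤ m, ∀ k l, |(M' ^ a) (u k) (u l)| ≤ L) ∧ L ^ 8 = (2 * z) ^ 8 *
        (1 + ∑ k, ((M ^ (8 * m)) (u k) (u k) + (M' ^ (8 * m)) (u k) (u k))) := by
  have e8 : 8 * m = 2 * (4 * m) := by ring
  rw [e8]
  have hnn : ∀ k, 0 ≤ (M ^ (2 * (4 * m))) (u k) (u k) + (M' ^ (2 * (4 * m))) (u k) (u k) := fun k =>
    add_nonneg (pow_two_mul_apply_nonneg hM _ _) (pow_two_mul_apply_nonneg hM' _ _)
  have hs := Finset.sum_nonneg (s := Finset.univ) fun k _ => hnn k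
  obtain ⟨r, hr0, hr⟩ := exists_pow_two_mul_eq (t := 1 + ∑ k, ((M ^ (2 * (4 * m))) (u k) (u k) +
    (M' ^ (2 * (4 * m))) (u k) (u k))) (by linarith) (n := 4 * m) (by omega)
  have hr1 : 1 ≤ r := by
    refine le_of_pow_le_pow_left₀ (n := 2 * (4 * m)) (by omega) hr0 ?_
    rw [hr, one_pow]; linarith
  have hk : ∀ k, (M ^ (2 * (4 * m))) (u k) (u k) + (M' ^ (2 * (4 * m))) (u k) (u k) ≤
      r ^ (2 * (4 * m)) := fun k => by
    have := Finset.single_le_sum (f := fun k => (M ^ (2 * (4 * m))) (u k) (u k) +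
        (M' ^ (2 * (4 * m))) (u k) (u k)) (fun k _ => hnn k) (Finset.mem_univ k)
    rw [hr]; linarith
  have hrm : (1 : ℝ) ≤ r ^ m := one_le_pow₀ hr1
  have key : ∀ a ≤ m, 2 * r ^ a ≤ 2 * z * r ^ m := fun a ha => by
    have : r ^ a ≤ r ^ m := pow_le_pow_right₀ hr1 ha
    nlinarith
  refine ⟨2 * z * r ^ m, by nlinarith, fun a ha k l => ?_, fun a ha k l => ?_, ?_⟩
  · refine (abs_pow_apply_le hM (by linarith) (K := 4 * m) (by omega) ?_ ?_).trans (key a ha)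
    · linarith [hk k, pow_two_mul_apply_nonneg hM' (4 * m) (u k)]
    · linarith [hk l, pow_two_mul_apply_nonneg hM' (4 * m) (u l)]
  · refine (abs_pow_apply_le hM' (by linarith) (K := 4 * m) (by omega) ?_ ?_).trans (key a ha)
    · linarith [hk k, pow_two_mul_apply_nonneg hM (4 * m) (u k)]
    · linarith [hk l, pow_two_mul_apply_nonneg hM (4 * m) (u l)]
  · rw [mul_pow, ← pow_mul, ← hr]; congr 2; ring

set_option maxHeartbeats 1000000 in
/-- The first order expansion with the diagonal entries replaced by constants. -/
theorem exists_abs_increment_sub_le (κ ι : Type*) [Fintype κ] [DecidableEq κ] [Fintype ι]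
    [DecidableEq ι] (n : ℕ) (cs : ℕ → ℝ) :
    ∃ C : ℝ, 0 ≤ C ∧ ∀ (V : Type) [Fintype V] [DecidableEq V] (M M' : Matrix V V ℝ), M.IsSymm →
      M'.IsSymm → ∀ (u : κ → V) (x y : ι → κ) (c : ι → ℝ),
      M' - M = ∑ t, Matrix.single (u (x t)) (u (y t)) (c t) → ∀ θ ω : ℝ, 0 ≤ θ → 1 ≤ ω →
      (∀ t, |c t| ≤ θ * ω) → ∀ t₀, (∀ t, t ≠ t₀ → x t ≠ x t₀ ∨ y t ≠ y t₀) → x t₀ ≠ y t₀ →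
      ∀ φ δ ρ : ℝ, |φ| ≤ ω → 0 < δ → 0 < ρ →
      |φ * ((M' ^ (n + 1)) (u (x t₀)) (u (y t₀)) *
            ((M' ^ (n + 2)) (u (x t₀)) (u (x t₀)) - cs (n + 2)) -
          (M ^ (n + 1)) (u (x t₀)) (u (y t₀)) *
            ((M ^ (n + 2)) (u (x t₀)) (u (x t₀)) - cs (n + 2))) -
        (∑ a ∈ Finset.range (n + 1), cs a * cs (n - a)) *
          (φ * c t₀ * ((M ^ (n + 2)) (u (x t₀)) (u (x t₀)) - cs (n + 2)))| ≤
      C * θ * ((ρ⁻¹ + θ + δ) * (ω ^ 8 + (1 + ∑ k, ((M ^ (8 * (n + 2))) (u k) (u k) +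
          (M' ^ (8 * (n + 2))) (u k) (u k)))) +
        ρ * offDiagEnergy (n + 2) M M' u +
        δ⁻¹ * ∑ a ∈ Finset.range (n + 1), (((M ^ a) (u (x t₀)) (u (x t₀)) - cs a) ^ 2 +
          ((M ^ a) (u (y t₀)) (u (y t₀)) - cs a) ^ 2)) := by
  set z : ℝ := 1 + ∑ a ∈ Finset.range (n + 3), |cs a| with hz
  have hz1 : 1 ≤ z := by
    have : 0 ≤ ∑ a ∈ Finset.range (n + 3), |cs a| := Finset.sum_nonneg fun _ _ => abs_nonneg _
    linarith
  have hcz : ∀ a ≤ n + 2, |cs a| ≤ z := fun a ha => by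
    have := Finset.single_le_sum (f := fun a => |cs a|) (fun a _ => abs_nonneg (cs a))
      (Finset.mem_range.2 (Nat.lt_succ_of_le ha))
    linarith
  set p : ℝ := (n + 2) * Fintype.card ι with hp
  set h : ℝ := 2 * (((n + 2 : ℕ) + 1) * Fintype.card κ ^ 2) with hh
  have hp0 : 0 ≤ p := by positivity
  have hh0 : 0 ≤ h := by positivity
  -- The first product accounts for the off-diagonal terms and the second-order remainder, the rest
  -- for replacing diagonal entries by constants; p bounds the number of telescoping terms times the
  -- number of increments.
  refine ⟨(3 * p + 3 * p ^ 2) * ((2 * z) ^ 8 + h) + 4 * (n + 1) * (2 * z) ^ 8 + 2, by positivity, ?_⟩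
  intro V _ _ M M' hM hM' u x y c hD θ ω hθ hω hc t₀ ht ht₀ φ δ ρ hφ hδ hρ
  obtain ⟨L, hzL, hL1, hL2, hL8⟩ := exists_entries_bound hM hM' u (m := n + 2) (by omega) hz1
  have hL0 : 0 ≤ L := by linarith
  have e1 := abs_mul_sub_mul_sub_main_le hD hc hL1 hL2 ht ht₀ ((hcz _ le_rfl).trans hzL)
  have e2 := offDiagSize_sq_le (n + 2) M M' u
  have hO : 0 ≤ offDiagSize (n + 2) M M' u := offDiagSize_nonneg _ _ _ _
  rw [← hh] at e2
  rw [← hp] at e1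
  set O := offDiagSize (n + 2) M M' u
  set En := offDiagEnergy (n + 2) M M' u with hEn
  have hEn0 : 0 ≤ En := Finset.sum_nonneg fun a _ => Finset.sum_nonneg fun k _ =>
    Finset.sum_nonneg fun l _ => by split_ifs <;> positivity
  set R := 1 + ∑ k, ((M ^ (8 * (n + 2))) (u k) (u k) + (M' ^ (8 * (n + 2))) (u k) (u k)) with hR
  have hR0 : 0 ≤ R := by
    have : 0 ≤ (2 * z) ^ 8 * R := by rw [← hL8]; positivity
    exact nonneg_of_mul_nonneg_right this (by positivity)
  set i := u (x t₀)
  set j := u (y t₀)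
  set P := (M ^ (n + 1)) i j
  set P' := (M' ^ (n + 1)) i j
  set G := (M ^ (n + 2)) i i - cs (n + 2)
  set G' := (M' ^ (n + 2)) i i - cs (n + 2)
  set S := ∑ a ∈ Finset.range (n + 1), (M ^ a) i i * (M ^ (n - a)) j j with hS
  set s := ∑ a ∈ Finset.range (n + 1), cs a * cs (n - a) with hs
  set D := ∑ a ∈ Finset.range (n + 1), (((M ^ a) i i - cs a) ^ 2 + ((M ^ a) j j - cs a) ^ 2) with hDd
  have hG : |G| ≤ 2 * L := by
    refine (abs_sub _ _).trans ?_
    linarith [hL1 (n + 2) le_rfl (x t₀) (x t₀), hcz (n + 2) le_rfl]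
  have hωL : ω ^ 4 * L ^ 4 ≤ (2 * z) ^ 8 * (ω ^ 8 + R) := by
    refine (pow_four_mul_pow_four_le ω L).trans ?_
    rw [hL8, mul_add]
    have : 1 ≤ (2 * z) ^ 8 := one_le_pow₀ (by linarith)
    have : ω ^ 8 ≤ (2 * z) ^ 8 * ω ^ 8 := le_mul_of_one_le_left (by positivity) this
    linarith
  have hSs : |S - s| ≤ L * ∑ a ∈ Finset.range (n + 1), (|(M ^ a) i i - cs a| +
      |(M ^ a) j j - cs a|) := by
    -- The exponent at j is n − a; reflecting the range brings the deviations at j to the same index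
    -- as those at i.
    rw [Finset.sum_add_distrib, ← Finset.sum_range_reflect (fun a => |(M ^ a) j j - cs a|),
      ← Finset.sum_add_distrib, hS, hs, ← Finset.sum_sub_distrib, Finset.mul_sum]
    refine (Finset.abs_sum_le_sum_abs _ _).trans (Finset.sum_le_sum fun a ha => ?_)
    have ha' := Finset.mem_range.1 ha
    rw [show n + 1 - 1 - a = n - a by omega,
      show (M ^ a) i i * (M ^ (n - a)) j j - cs a * cs (n - a) =
        ((M ^ a) i i - cs a) * (M ^ (n - a)) j j + cs a * ((M ^ (n - a)) j j - cs (n - a)) by ring]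
    refine (abs_add_le _ _).trans ?_
    rw [abs_mul, abs_mul]
    have b1 : |(M ^ (n - a)) j j| ≤ L := hL1 _ (by omega) (y t₀) (y t₀)
    have b2 : |cs a| ≤ L := (hcz a (by omega)).trans hzL
    have := mul_le_mul_of_nonneg_left b1 (abs_nonneg ((M ^ a) i i - cs a))
    have := mul_le_mul_of_nonneg_right b2 (abs_nonneg ((M ^ (n - a)) j j - cs (n - a)))
    linarith
  -- The squared deviations are small by the induction hypothesis and can afford δ⁻¹; the bounded
  -- factor receives the small δ.
  have t2 : ω ^ 2 * L ^ 2 * ∑ a ∈ Finset.range (n + 1), (|(M ^ a) i i - cs a| +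
      |(M ^ a) j j - cs a|) ≤ 2 * (n + 1) * (δ * (ω ^ 4 * L ^ 4)) + δ⁻¹ * D := by
    rw [Finset.mul_sum, hDd, Finset.mul_sum]
    have : 2 * (n + 1) * (δ * (ω ^ 4 * L ^ 4)) =
        ∑ a ∈ Finset.range (n + 1), 2 * (δ * (ω ^ 4 * L ^ 4)) := by simp; ring
    rw [this, ← Finset.sum_add_distrib]
    refine Finset.sum_le_sum fun a _ => ?_
    have q1 := mul_le_mul_sq_add_inv_mul_sq (a := ω ^ 2 * L ^ 2) (b := |(M ^ a) i i - cs a|) hδ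
    have q2 := mul_le_mul_sq_add_inv_mul_sq (a := ω ^ 2 * L ^ 2) (b := |(M ^ a) j j - cs a|) hδ
    rw [sq_abs] at q1 q2
    have e : (ω ^ 2 * L ^ 2) ^ 2 = ω ^ 4 * L ^ 4 := by ring
    rw [e] at q1 q2
    linarith
  -- The off-diagonal energy can afford the large factor ρ because rates at pairs are much lower
  -- than rates at vertices.
  have t1 : ω ^ 2 * L ^ 2 * O ≤ ρ⁻¹ * (ω ^ 4 * L ^ 4) + ρ * (h * En) := by
    have q := mul_le_mul_sq_add_inv_mul_sq (a := ω ^ 2 * L ^ 2) (b := O) (inv_pos.2 hρ)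
    rw [inv_inv, show (ω ^ 2 * L ^ 2) ^ 2 = ω ^ 4 * L ^ 4 by ring] at q
    have := mul_le_mul_of_nonneg_left e2 hρ.le
    linarith
  have t3 : ω ^ 3 * L ^ 4 ≤ ω ^ 4 * L ^ 4 :=
    mul_le_mul_of_nonneg_right (pow_le_pow_right₀ hω (by norm_num)) (by positivity)
  have hct := hc t₀
  have hφc : |φ * c t₀| ≤ θ * ω ^ 2 := by
    rw [abs_mul]
    calc |φ| * |c t₀| ≤ ω * (θ * ω) := mul_le_mul hφ hct (abs_nonneg _) (by linarith)
      _ = _ := by ring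
  have f1 : |φ * (P' * G' - P * G - c t₀ * S * G)| ≤
      3 * p * θ * (ω ^ 2 * L ^ 2 * O) + 3 * p ^ 2 * (θ * (θ * (ω ^ 3 * L ^ 4))) := by
    rw [abs_mul]
    refine (mul_le_mul hφ e1 (abs_nonneg _) (by linarith)).trans (le_of_eq ?_)
    ring
  have f2 : |φ * c t₀ * G * (S - s)| ≤ 2 * θ * (ω ^ 2 * L ^ 2 * ∑ a ∈ Finset.range (n + 1),
      (|(M ^ a) i i - cs a| + |(M ^ a) j j - cs a|)) := by
    rw [abs_mul, abs_mul]
    refine (mul_le_mul (mul_le_mul hφc hG (abs_nonneg _) (by positivity)) hSs (abs_nonneg _)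
      (by positivity)).trans (le_of_eq ?_)
    ring
  rw [show φ * (P' * G' - P * G) - s * (φ * c t₀ * G) =
    φ * (P' * G' - P * G - c t₀ * S * G) + φ * c t₀ * G * (S - s) by ring]
  refine (abs_add_le _ _).trans ((add_le_add f1 f2).trans ?_)
  set W := ω ^ 8 + R with hW
  have hW0 : 0 ≤ W := by positivity
  set k := (2 * z) ^ 8
  have hk0 : 0 ≤ k := by positivity
  have hρi : 0 ≤ ρ⁻¹ := by positivity
  have hδi : 0 ≤ δ⁻¹ := by positivity
  have hD0 : 0 ≤ D := Finset.sum_nonneg fun a _ => by positivity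
  have g1 : ω ^ 2 * L ^ 2 * O ≤ (k + h) * (ρ⁻¹ * W + ρ * En) := by
    have u1 : ρ⁻¹ * (ω ^ 4 * L ^ 4) ≤ ρ⁻¹ * (k * W) := mul_le_mul_of_nonneg_left hωL hρi
    have u2 : 0 ≤ h * (ρ⁻¹ * W) := by positivity
    have u3 : 0 ≤ k * (ρ * En) := by positivity
    linarith
  have g2 : θ * (ω ^ 3 * L ^ 4) ≤ (k + h) * (θ * W) := by
    have u1 : θ * (ω ^ 3 * L ^ 4) ≤ θ * (k * W) := mul_le_mul_of_nonneg_left (t3.trans hωL) hθ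
    have u2 : 0 ≤ h * (θ * W) := by positivity
    linarith
  have g3 := t2.trans (add_le_add_left (mul_le_mul_of_nonneg_left
    (mul_le_mul_of_nonneg_left hωL hδ.le) (by positivity : (0 : ℝ) ≤ 2 * (n + 1))) _)
  set X := (ρ⁻¹ + θ + δ) * W + ρ * En + δ⁻¹ * D with hX
  have x1 : ρ⁻¹ * W + ρ * En ≤ X := by
    have : 0 ≤ (θ + δ) * W + δ⁻¹ * D := by positivity
    rw [hX]; linarith
  have x2 : θ * W ≤ X := by
    have : 0 ≤ (ρ⁻¹ + δ) * W + ρ * En + δ⁻¹ * D := by positivity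
    rw [hX]; linarith
  have x3 : δ * W ≤ X := by
    have : 0 ≤ (ρ⁻¹ + θ) * W + ρ * En + δ⁻¹ * D := by positivity
    rw [hX]; linarith
  have x4 : δ⁻¹ * D ≤ X := by
    have : 0 ≤ (ρ⁻¹ + θ + δ) * W + ρ * En := by positivity
    rw [hX]; linarith
  have y1 : 3 * p * θ * (ω ^ 2 * L ^ 2 * O) ≤ 3 * p * θ * ((k + h) * X) :=
    mul_le_mul_of_nonneg_left (g1.trans (mul_le_mul_of_nonneg_left x1 (by positivity)))
      (by positivity)
  have y2 : 3 * p ^ 2 * (θ * (θ * (ω ^ 3 * L ^ 4))) ≤ 3 * p ^ 2 * (θ * ((k + h) * X)) :=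
    mul_le_mul_of_nonneg_left (mul_le_mul_of_nonneg_left
      (g2.trans (mul_le_mul_of_nonneg_left x2 (by positivity))) hθ) (by positivity)
  have y3 : 2 * θ * (ω ^ 2 * L ^ 2 * ∑ a ∈ Finset.range (n + 1),
      (|(M ^ a) i i - cs a| + |(M ^ a) j j - cs a|)) ≤ 2 * θ * (2 * (n + 1) * (k * X) + X) := by
    refine mul_le_mul_of_nonneg_left (g3.trans (add_le_add ?_ x4)) (by positivity)
    have := mul_le_mul_of_nonneg_left x3 (by positivity : (0 : ℝ) ≤ 2 * (n + 1) * k)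
    linarith
  calc _ ≤ 3 * p * θ * ((k + h) * X) + 3 * p ^ 2 * (θ * ((k + h) * X)) +
        2 * θ * (2 * (n + 1) * (k * X) + X) := add_le_add (add_le_add y1 y2) y3
    _ = _ := by ring

end Pointwise

/-! ### Exchanges: a common framework for resampling and switching. -/

/-- The standardized matrix of a sample. -/
noncomputable abbrev Sample.std {N d : ℕ} (ν : Measure ℝ) (s : Sample N d) :
    Matrix (Fin N) (Fin N) ℝ :=
  standardized d ν s.1.1 s.wt

/-- The deviation of a diagonal entry of a power of the standardized matrix. -/
noncomputable def deviation {N d : ℕ} (ν : Measure ℝ) (cs : ℕ → ℝ) (a : ℕ) (i : Fin N)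
    (s : Sample N d) : ℝ :=
  (s.std ν ^ a) i i - cs a

/-- The total squared deviation of the diagonal of a power of the standardized matrix. -/
noncomputable def fluctuation (N d : ℕ) (ν : Measure ℝ) (cs : ℕ → ℝ) (a : ℕ) : ℝ :=
  ∫ s : Sample N d, ∑ i, deviation ν cs a i s ^ 2 ∂sampleLaw N d ν

/-- The function tested against an entry of the standardized matrix. -/
noncomputable def testEntry {N d : ℕ} (ν : Measure ℝ) (cs : ℕ → ℝ) (n : ℕ) (i j : Fin N)
    (s : Sample N d) : ℝ :=
  (s.std ν ^ (n + 1)) i j * deviation ν cs (n + 2) i s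

/-- A family of measure-preserving moves of samples, which happen at given rates and change the
standardized matrix only at a few positions. -/
structure Exchange (N d : ℕ) (Q κ ι : Type) where
  /-- the move -/
  move : Q → Sample N d → Sample N d
  /-- the rate of a move -/
  rate : Q → Sample N d → ℝ
  /-- the vertices concerned -/
  corner : Q → κ → Fin N
  /-- the row of an increment -/
  fst : ι → κ
  /-- the column of an increment -/
  snd : ι → κ
  /-- the value of an increment -/
  coef : Q → ι → Sample N d → ℝ
  /-- a bound for the increments before standardization -/
  size : Q → Sample N d → ℝ
  /-- the distinguished increment -/
  main : ι

/-- The average of a function over all moves, weighted by the rates. -/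
noncomputable def Exchange.average {N d : ℕ} {Q κ ι : Type} [Fintype Q] (E : Exchange N d Q κ ι)
    (ν : Measure ℝ) (f : Q → Sample N d → ℝ) : ℝ :=
  ∫ s, ∑ q, E.rate q s * f q s ∂sampleLaw N d ν

/-- The properties of an exchange of total rates `A` at a vertex and `B` at a pair of vertices. -/
structure Exchange.IsAdmissible {N d : ℕ} {Q κ ι : Type} [Fintype Q] [Fintype ι]
    (E : Exchange N d Q κ ι) (ν : Measure ℝ) (A B D : ℝ) : Prop where
  nonneg_vertex : 0 ≤ A
  nonneg_pair : 0 ≤ B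
  preserving : ∀ q, MeasurePreserving (E.move q) (sampleLaw N d ν) (sampleLaw N d ν)
  tame_rate : ∀ q, Tame (E.rate q) (sampleLaw N d ν)
  tame_size : ∀ q, Tame (E.size q) (sampleLaw N d ν)
  tame_coef : ∀ q t, Tame (E.coef q t) (sampleLaw N d ν)
  rate_nonneg : ∀ q s, 0 ≤ E.rate q s
  one_le_size : ∀ q s, 1 ≤ E.size q s
  std_move_sub : ∀ q s, E.rate q s ≠ 0 → (E.move q s).std ν - s.std ν =
    ∑ t, Matrix.single (E.corner q (E.fst t)) (E.corner q (E.snd t)) (E.coef q t s)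
  abs_coef_le : ∀ q s, E.rate q s ≠ 0 → ∀ t, |E.coef q t s| ≤ (√(scaleSq N d ν))⁻¹ * E.size q s
  ne_main : ∀ t, t ≠ E.main → E.fst t ≠ E.fst E.main ∨ E.snd t ≠ E.snd E.main
  fst_main_ne : E.fst E.main ≠ E.snd E.main
  size_le : E.average ν (fun q s => E.size q s ^ 8) ≤ D * (A * N)
  vertex_le : ∀ f : Fin N → Sample N d → ℝ, (∀ x, Tame (f x) (sampleLaw N d ν)) →
    (∀ x s, 0 ≤ f x s) → ∀ k, E.average ν (fun q s => f (E.corner q k) s) ≤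
      A * ∫ s, ∑ x, f x s ∂sampleLaw N d ν
  vertex_move_le : ∀ f : Fin N → Sample N d → ℝ, (∀ x, Tame (f x) (sampleLaw N d ν)) →
    (∀ x s, 0 ≤ f x s) → ∀ k, E.average ν (fun q s => f (E.corner q k) (E.move q s)) ≤
      A * ∫ s, ∑ x, f x s ∂sampleLaw N d ν
  pair_le : ∀ f : Fin N → Fin N → Sample N d → ℝ, (∀ x y, Tame (f x y) (sampleLaw N d ν)) →
    (∀ x y s, 0 ≤ f x y s) → ∀ k l, k ≠ l →
      E.average ν (fun q s => f (E.corner q k) (E.corner q l) s) ≤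
      B * ∫ s, ∑ x, ∑ y, f x y s ∂sampleLaw N d ν
  pair_move_le : ∀ f : Fin N → Fin N → Sample N d → ℝ, (∀ x y, Tame (f x y) (sampleLaw N d ν)) →
    (∀ x y s, 0 ≤ f x y s) → ∀ k l, k ≠ l →
      E.average ν (fun q s => f (E.corner q k) (E.corner q l) (E.move q s)) ≤
      B * ∫ s, ∑ x, ∑ y, f x y s ∂sampleLaw N d ν

namespace Exchange

variable {N d : ℕ} {Q κ ι : Type} [Fintype Q] [Fintype ι] {E : Exchange N d Q κ ι}
  {ν : Measure ℝ} [IsProbabilityMeasure ν] [Nonempty (RegGraph N d)] {A B D : ℝ}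

theorem IsAdmissible.integrable_average (hE : E.IsAdmissible ν A B D) {f : Q → Sample N d → ℝ}
    (hf : ∀ q, Tame (f q) (sampleLaw N d ν)) :
    Integrable (fun s => ∑ q, E.rate q s * f q s) (sampleLaw N d ν) :=
  (Tame.sum _ fun q => (hE.tame_rate q).mul (hf q)).integrable

theorem IsAdmissible.average_add (hE : E.IsAdmissible ν A B D) {f g : Q → Sample N d → ℝ}
    (hf : ∀ q, Tame (f q) (sampleLaw N d ν)) (hg : ∀ q, Tame (g q) (sampleLaw N d ν)) :
    E.average ν (fun q s => f q s + g q s) = E.average ν f + E.average ν g := by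
  simp only [average, mul_add, Finset.sum_add_distrib]
  exact integral_add (hE.integrable_average hf) (hE.integrable_average hg)

omit [Fintype ι] [IsProbabilityMeasure ν] [Nonempty (RegGraph N d)] in
theorem average_const_mul (f : Q → Sample N d → ℝ) (c : ℝ) :
    E.average ν (fun q s => c * f q s) = c * E.average ν f := by
  simp only [average, ← integral_const_mul, Finset.mul_sum, mul_left_comm]

theorem IsAdmissible.average_sum (hE : E.IsAdmissible ν A B D) {β : Type*} (t : Finset β)
    {f : β → Q → Sample N d → ℝ} (hf : ∀ b q, Tame (f b q) (sampleLaw N d ν)) :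
    E.average ν (fun q s => ∑ b ∈ t, f b q s) = ∑ b ∈ t, E.average ν (f b) := by
  simp only [average, Finset.mul_sum]
  rw [← integral_finsetSum _ fun b _ => hE.integrable_average (hf b)]
  simp only [Finset.sum_comm (s := t)]

theorem IsAdmissible.average_mono (hE : E.IsAdmissible ν A B D) {f g : Q → Sample N d → ℝ}
    (hf : ∀ q, Tame (f q) (sampleLaw N d ν)) (hg : ∀ q, Tame (g q) (sampleLaw N d ν))
    (h : ∀ q s, E.rate q s ≠ 0 → f q s ≤ g q s) : E.average ν f ≤ E.average ν g := by
  refine integral_mono (hE.integrable_average hf) (hE.integrable_average hg) fun s =>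
    Finset.sum_le_sum fun q _ => ?_
  by_cases h0 : E.rate q s = 0
  · simp [h0]
  · exact mul_le_mul_of_nonneg_left (h q s h0) (hE.rate_nonneg q s)

/-- Moves of zero rate are exempt from the comparison, which matters because the increment formula
is only available where the rate does not vanish. -/
theorem IsAdmissible.abs_average_le (hE : E.IsAdmissible ν A B D) {f g : Q → Sample N d → ℝ}
    (hf : ∀ q, Tame (f q) (sampleLaw N d ν)) (hg : ∀ q, Tame (g q) (sampleLaw N d ν))
    (h : ∀ q s, E.rate q s ≠ 0 → |f q s| ≤ g q s) : |E.average ν f| ≤ E.average ν g := by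
  rw [abs_le]
  refine ⟨?_, hE.average_mono hf hg fun q s hq => (le_abs_self _).trans (h q s hq)⟩
  have := hE.average_mono (f := fun q s => -1 * f q s) (fun q => (Tame.const _).mul (hf q)) hg
    fun q s hq => by linarith [neg_abs_le (f q s), h q s hq]
  rw [average_const_mul] at this
  linarith

end Exchange

section

variable {N d : ℕ} {ν : Measure ℝ} [IsProbabilityMeasure ν] [Nonempty (RegGraph N d)]

theorem tame_std_pow (hx : Tame (fun x : ℝ => x) ν) (a : ℕ) (i j : Fin N) :
    Tame (fun s : Sample N d => (s.std ν ^ a) i j) (sampleLaw N d ν) :=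
  Tame.matrix_pow (tame_standardized hx) a i j

theorem tame_deviation (hx : Tame (fun x : ℝ => x) ν) (cs : ℕ → ℝ) (a : ℕ) (i : Fin N) :
    Tame (deviation (d := d) ν cs a i) (sampleLaw N d ν) :=
  (tame_std_pow hx a i i).sub (Tame.const _)

theorem tame_testEntry (hx : Tame (fun x : ℝ => x) ν) (cs : ℕ → ℝ) (n : ℕ) (i j : Fin N) :
    Tame (testEntry (d := d) ν cs n i j) (sampleLaw N d ν) :=
  (tame_std_pow hx _ i j).mul (tame_deviation hx cs _ i)

end

/-- A bound for the powers of the standardized matrix at the vertices concerned by a move. -/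
noncomputable def Exchange.energy {N d : ℕ} {Q κ ι : Type} [Fintype κ] (E : Exchange N d Q κ ι)
    (ν : Measure ℝ) (m : ℕ) (q : Q) (s : Sample N d) : ℝ :=
  E.size q s ^ 8 + (1 + ∑ k, ((s.std ν ^ (8 * m)) (E.corner q k) (E.corner q k) +
    ((E.move q s).std ν ^ (8 * m)) (E.corner q k) (E.corner q k)))

theorem Exchange.IsAdmissible.tame_energy {N d : ℕ} {Q κ ι : Type} [Fintype Q] [Fintype κ]
    [Fintype ι] {E : Exchange N d Q κ ι} {ν : Measure ℝ} [IsProbabilityMeasure ν]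
    [Nonempty (RegGraph N d)] {A B D : ℝ} (hE : E.IsAdmissible ν A B D)
    (hx : Tame (fun x : ℝ => x) ν) (m : ℕ) (q : Q) : Tame (E.energy ν m q) (sampleLaw N d ν) :=
  ((hE.tame_size q).pow 8).add ((Tame.const _).add (Tame.sum _ fun _ =>
    (tame_std_pow hx _ _ _).add ((tame_std_pow hx _ _ _).comp (hE.preserving q))))

/-- The vertex bound at each position, before and after the move, reduces the energy to a trace
moment of order N. -/
theorem Exchange.exists_average_energy_le {ν : Measure ℝ} [IsProbabilityMeasure ν]
    (hν : AdmissibleWeightLaw ν) (κ ι : Type) [Fintype κ] [Fintype ι] (m : ℕ) {D : ℝ}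
    (hD : 0 ≤ D) :
    ∃ C : ℝ, 0 ≤ C ∧ ∀ (N d : ℕ) [Nonempty (RegGraph N d)], 16 ≤ rowVar N d →
      ∀ (Q : Type) [Fintype Q] (E : Exchange N d Q κ ι) (A B : ℝ), E.IsAdmissible ν A B D →
      E.average ν (E.energy ν m) ≤ C * (A * N) := by
  have hx := hν.tame
  obtain ⟨C, hC0, hC⟩ := exists_integral_trace_standardized_pow_le hν (4 * m)
  refine ⟨D + 1 + 2 * Fintype.card κ * C, by positivity, ?_⟩
  intro N d _ hσ Q _ E A B hE
  have hA := hE.nonneg_vertex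
  have hM : ∀ s : Sample N d, (s.std ν).IsSymm := fun s => standardized_isSymm ν s
  have tP := fun a (i j : Fin N) => tame_std_pow (N := N) (d := d) hx a i j
  have tPm := fun q a (i j : Fin N) => (tP a i j).comp (hE.preserving q)
  have tR1 : ∀ q, Tame (fun s => E.size q s ^ 8) (sampleLaw N d ν) := fun q => (hE.tame_size q).pow 8
  have tR2 : ∀ k q, Tame (fun s : Sample N d =>
      (s.std ν ^ (8 * m)) (E.corner q k) (E.corner q k) +
      ((E.move q s).std ν ^ (8 * m)) (E.corner q k) (E.corner q k)) (sampleLaw N d ν) :=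
    fun k q => (tP _ _ _).add (tPm q _ _ _)
  have e : E.average ν (E.energy ν m) = E.average ν (fun q s => E.size q s ^ 8) +
      (E.average ν (fun _ _ => 1) + ∑ k, E.average ν (fun q s =>
        (s.std ν ^ (8 * m)) (E.corner q k) (E.corner q k) +
        ((E.move q s).std ν ^ (8 * m)) (E.corner q k) (E.corner q k))) := by
    rw [← hE.average_sum _ tR2, ← hE.average_add (fun q => Tame.const _)
      (fun q => Tame.sum _ fun k => tR2 k q), ← hE.average_add tR1
      (fun q => (Tame.const _).add (Tame.sum _ fun k => tR2 k q))]
    rfl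
  have e1 := hE.vertex_le (fun _ _ => 1) (fun _ => Tame.const _) (fun _ _ => zero_le_one)
    (E.fst E.main)
  simp only [Finset.sum_const, Finset.card_univ, Fintype.card_fin, nsmul_eq_mul, mul_one,
    integral_const, probReal_univ, one_smul] at e1
  have h8 : 8 * m = 2 * (4 * m) := by ring
  have hnn : ∀ x (s : Sample N d), 0 ≤ (s.std ν ^ (8 * m)) x x := fun x s => by
    rw [h8]; exact pow_two_mul_apply_nonneg (hM s) _ x
  have hct := hC N d hσ
  rw [← h8] at hct
  have e2 : ∀ k, E.average ν (fun q s =>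
        (s.std ν ^ (8 * m)) (E.corner q k) (E.corner q k) +
        ((E.move q s).std ν ^ (8 * m)) (E.corner q k) (E.corner q k)) ≤
      2 * C * (A * N) := by
    intro k
    rw [hE.average_add (fun q => tP _ _ _) (fun q => tPm q _ _ _)]
    have a1 := hE.vertex_le (fun x s => (s.std ν ^ (8 * m)) x x) (fun x => tP _ x x) hnn k
    have a2 := hE.vertex_move_le (fun x s => (s.std ν ^ (8 * m)) x x) (fun x => tP _ x x)
      hnn k
    have a3 : A * ∫ s : Sample N d, ∑ x, (s.std ν ^ (8 * m)) x x ∂sampleLaw N d ν ≤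
        A * (C * N) := mul_le_mul_of_nonneg_left hct hA
    linarith
  have e3 := Finset.sum_le_sum (s := Finset.univ) fun k _ => e2 k
  rw [Finset.sum_const, nsmul_eq_mul, Finset.card_univ] at e3
  rw [e]
  linarith [hE.size_le]

/-- The effect of an exchange on the test functions, to first order. -/
theorem Exchange.exists_abs_average_sub_le {ν : Measure ℝ} [IsProbabilityMeasure ν]
    (hν : AdmissibleWeightLaw ν) (κ ι : Type) [Fintype κ] [DecidableEq κ] [Fintype ι]
    [DecidableEq ι] (cs : ℕ → ℝ) (n : ℕ) {D : ℝ} (hD : 0 ≤ D) :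
    ∃ C : ℝ, 0 ≤ C ∧ ∀ (N d : ℕ) [Nonempty (RegGraph N d)], 16 ≤ rowVar N d →
      ∀ (Q : Type) [Fintype Q] (E : Exchange N d Q κ ι) (A B : ℝ), E.IsAdmissible ν A B D →
      ∀ φ : Q → Sample N d → ℝ, (∀ q, Tame (φ q) (sampleLaw N d ν)) →
      (∀ q s, |φ q s| ≤ E.size q s) → ∀ δ ρ : ℝ, 0 < δ → 0 < ρ →
      |E.average ν (fun q s => φ q s *
          (testEntry ν cs n (E.corner q (E.fst E.main)) (E.corner q (E.snd E.main)) (E.move q s) -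
          testEntry ν cs n (E.corner q (E.fst E.main)) (E.corner q (E.snd E.main)) s)) -
        (∑ a ∈ Finset.range (n + 1), cs a * cs (n - a)) *
          E.average ν (fun q s => φ q s * E.coef q E.main s *
            deviation ν cs (n + 2) (E.corner q (E.fst E.main)) s)| ≤
      C * (√(scaleSq N d ν))⁻¹ * (A * N * (ρ⁻¹ + (√(scaleSq N d ν))⁻¹ + δ) + ρ * (B * N) +
        δ⁻¹ * (A * ∑ a ∈ Finset.range (n + 1), fluctuation N d ν cs a)) := by
  have hx := hν.tame
  obtain ⟨C₀, hC₀, h₀⟩ := exists_abs_increment_sub_le κ ι n cs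
  obtain ⟨Ce, hCe0, hCe⟩ := exists_average_energy_le hν κ ι (n + 2) hD
  choose Ct hCt0 hCt using exists_integral_trace_standardized_pow_le hν
  set b := ∑ a ∈ Finset.range (n + 3), Ct a with hb
  have hb0 : 0 ≤ b := Finset.sum_nonneg fun a _ => hCt0 a
  refine ⟨C₀ * (Ce + 2 * Fintype.card κ ^ 2 * b + 2), by positivity, ?_⟩
  intro N d _ hσ Q _ E A B hE φ hφ hφs δ ρ hδ hρ
  have hA := hE.nonneg_vertex
  have hB := hE.nonneg_pair
  set θ := (√(scaleSq N d ν))⁻¹ with hθ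
  have hθ0 : 0 ≤ θ := by positivity
  have hM : ∀ s : Sample N d, (s.std ν).IsSymm := fun s => standardized_isSymm ν s
  have tP := fun a (i j : Fin N) => tame_std_pow (N := N) (d := d) hx a i j
  have tPm := fun q a (i j : Fin N) => (tP a i j).comp (hE.preserving q)
  have tT := fun (i j : Fin N) => tame_testEntry (N := N) (d := d) hx cs n i j
  have tTm := fun q (i j : Fin N) => (tT i j).comp (hE.preserving q)
  have tG := fun a (i : Fin N) => tame_deviation (N := N) (d := d) hx cs a i
  rw [← average_const_mul, show ∀ a b : ℝ, a - b = a + -1 * b from fun a b => by ring,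
    ← average_const_mul, ← hE.average_add
      (fun q => (hφ q).mul ((tTm q _ _).sub (tT _ _)))
      (fun q => (Tame.const _).mul ((Tame.const _).mul (((hφ q).mul (hE.tame_coef q _)).mul
        (tG _ _))))]
  let R : Q → Sample N d → ℝ := E.energy ν (n + 2)
  let O : Q → Sample N d → ℝ := fun q s =>
    offDiagEnergy (n + 2) (s.std ν) ((E.move q s).std ν) (E.corner q)
  let F : Q → Sample N d → ℝ := fun q s => ∑ a ∈ Finset.range (n + 1),
    (deviation ν cs a (E.corner q (E.fst E.main)) s ^ 2 +
      deviation ν cs a (E.corner q (E.snd E.main)) s ^ 2)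
  have tR : ∀ q, Tame (R q) (sampleLaw N d ν) := hE.tame_energy hx (n + 2)
  have tO1 : ∀ (a : ℕ) k l q, Tame (fun s : Sample N d => if k = l then (0 : ℝ) else
      (s.std ν ^ a) (E.corner q k) (E.corner q l) ^ 2 +
      ((E.move q s).std ν ^ a) (E.corner q k) (E.corner q l) ^ 2) (sampleLaw N d ν) := by
    intro a k l q
    split_ifs
    · exact Tame.const _
    · exact ((tP _ _ _).pow 2).add ((tPm q _ _ _).pow 2)
  have tO : ∀ q, Tame (O q) (sampleLaw N d ν) := fun q => Tame.sum _ fun a => Tame.sum _ fun k =>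
    Tame.sum _ fun l => tO1 a k l q
  have tF1 : ∀ (a : ℕ) q, Tame (fun s : Sample N d =>
      deviation ν cs a (E.corner q (E.fst E.main)) s ^ 2 +
      deviation ν cs a (E.corner q (E.snd E.main)) s ^ 2) (sampleLaw N d ν) :=
    fun a q => ((tG _ _).pow 2).add ((tG _ _).pow 2)
  have tF : ∀ q, Tame (F q) (sampleLaw N d ν) := fun q => Tame.sum _ fun a => tF1 a q
  refine (hE.abs_average_le (g := fun q s => C₀ * θ * ((ρ⁻¹ + θ + δ) * R q s + ρ * O q s +
      δ⁻¹ * F q s))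
    (fun q => ((hφ q).mul ((tTm q _ _).sub (tT _ _))).add
      ((Tame.const _).mul ((Tame.const _).mul (((hφ q).mul (hE.tame_coef q _)).mul (tG _ _)))))
    (fun q => (Tame.const _).mul ((((Tame.const _).mul (tR q)).add ((Tame.const _).mul (tO q))).add
      ((Tame.const _).mul (tF q)))) fun q s hq => ?_).trans ?_
  · have := h₀ (Fin N) (s.std ν) ((E.move q s).std ν) (hM _) (hM _) (E.corner q) E.fst E.snd
      (fun t => E.coef q t s) (hE.std_move_sub q s hq) θ (E.size q s) hθ0 (hE.one_le_size q s)
      (hE.abs_coef_le q s hq) E.main hE.ne_main hE.fst_main_ne (φ q s) δ ρ (hφs q s) hδ hρ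
    rw [neg_one_mul, ← sub_eq_add_neg]
    exact this
  have bR := hCe N d hσ Q E A B hE
  -- Over all pairs the squared entries of M^a sum to tr M^{2a}, so the pair rate B is multiplied by
  -- N only.
  have bO : E.average ν O ≤ 2 * Fintype.card κ ^ 2 * b * (B * N) := by
    have e : E.average ν O = ∑ a ∈ Finset.range (n + 2 + 1), ∑ k, ∑ l, E.average ν (fun q s =>
        if k = l then (0 : ℝ) else (s.std ν ^ a) (E.corner q k) (E.corner q l) ^ 2 +
        ((E.move q s).std ν ^ a) (E.corner q k) (E.corner q l) ^ 2) := by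
      simp only [← hE.average_sum _ fun l q => tO1 _ _ l q]
      simp only [← hE.average_sum _ fun k q => Tame.sum _ fun l => tO1 _ k l q]
      simp only [← hE.average_sum _ fun a q => Tame.sum _ fun k => Tame.sum _ fun l => tO1 a k l q]
      rfl
    have e2 : ∀ a k l, E.average ν (fun q s =>
        if k = l then (0 : ℝ) else (s.std ν ^ a) (E.corner q k) (E.corner q l) ^ 2 +
        ((E.move q s).std ν ^ a) (E.corner q k) (E.corner q l) ^ 2) ≤ 2 * Ct a * (B * N) := by
      intro a k l
      by_cases hkl : k = l
      · simp only [if_pos hkl]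
        have : E.average ν (fun _ _ => 0) = 0 := by simp [average]
        rw [this]
        have := hCt0 a
        positivity
      · simp only [if_neg hkl]
        rw [hE.average_add (fun q => (tP _ _ _).pow 2) (fun q => (tPm q _ _ _).pow 2)]
        have a1 := hE.pair_le (fun x y s => (s.std ν ^ a) x y ^ 2) (fun x y => (tP _ x y).pow 2)
          (fun _ _ _ => sq_nonneg _) k l hkl
        have a2 := hE.pair_move_le (fun x y s => (s.std ν ^ a) x y ^ 2)
          (fun x y => (tP _ x y).pow 2) (fun _ _ _ => sq_nonneg _) k l hkl
        have a4 : ∀ s : Sample N d, ∑ x, ∑ y, (s.std ν ^ a) x y ^ 2 = (s.std ν ^ (2 * a)).trace :=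
          fun s => sum_sum_sq_pow_apply (hM s) a
        simp only [a4] at a1 a2
        have a3 := mul_le_mul_of_nonneg_left (hCt a N d hσ) hB
        linarith
    rw [e]
    refine (Finset.sum_le_sum fun a _ => Finset.sum_le_sum fun k _ => Finset.sum_le_sum fun l _ =>
      e2 a k l).trans (le_of_eq ?_)
    simp only [Finset.sum_const, Finset.card_univ, nsmul_eq_mul]
    rw [hb, Finset.mul_sum, Finset.sum_mul]
    exact Finset.sum_congr rfl fun a _ => by ring
  have bF : E.average ν F ≤ 2 * (A * ∑ a ∈ Finset.range (n + 1), fluctuation N d ν cs a) := by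
    rw [show E.average ν F = ∑ a ∈ Finset.range (n + 1), E.average ν (fun q s =>
      deviation ν cs a (E.corner q (E.fst E.main)) s ^ 2 +
      deviation ν cs a (E.corner q (E.snd E.main)) s ^ 2) from hE.average_sum _ tF1,
      Finset.mul_sum, Finset.mul_sum]
    refine Finset.sum_le_sum fun a _ => ?_
    rw [hE.average_add (fun q => (tG _ _).pow 2) (fun q => (tG _ _).pow 2)]
    have a1 := fun k => hE.vertex_le (fun x s => deviation ν cs a x s ^ 2)
      (fun x => (tG _ x).pow 2) (fun _ _ => sq_nonneg _) k
    simp only [fluctuation]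
    linarith [a1 (E.fst E.main), a1 (E.snd E.main)]
  rw [average_const_mul, hE.average_add
    (fun q => ((Tame.const _).mul (tR q)).add ((Tame.const _).mul (tO q)))
    (fun q => (Tame.const _).mul (tF q)), hE.average_add
    (fun q => (Tame.const _).mul (tR q)) (fun q => (Tame.const _).mul (tO q)),
    average_const_mul, average_const_mul, average_const_mul]
  have hρi : 0 ≤ ρ⁻¹ := by positivity
  have hδi : 0 ≤ δ⁻¹ := by positivity
  have hf0 : 0 ≤ ∑ a ∈ Finset.range (n + 1), fluctuation N d ν cs a :=
    Finset.sum_nonneg fun a _ => integral_nonneg fun s => Finset.sum_nonneg fun i _ => sq_nonneg _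
  have k1 := mul_le_mul_of_nonneg_left bR (by positivity : 0 ≤ ρ⁻¹ + θ + δ)
  have k2 := mul_le_mul_of_nonneg_left bO hρ.le
  have k3 := mul_le_mul_of_nonneg_left bF hδi
  set k' := (2 : ℝ) * Fintype.card κ ^ 2 * b
  have hk'0 : 0 ≤ k' := by positivity
  set a1 := (ρ⁻¹ + θ + δ) * (A * N) with h1
  have ha1 : 0 ≤ a1 := by positivity
  set a2 := ρ * (B * N) with h2
  have ha2 : 0 ≤ a2 := by positivity
  set a3 := δ⁻¹ * (A * ∑ a ∈ Finset.range (n + 1), fluctuation N d ν cs a) with h3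
  have ha3 : 0 ≤ a3 := by positivity
  have q1 : Ce * a1 ≤ (Ce + k' + 2) * a1 :=
    mul_le_mul_of_nonneg_right (by linarith) ha1
  have q2 : k' * a2 ≤ (Ce + k' + 2) * a2 :=
    mul_le_mul_of_nonneg_right (by linarith) ha2
  have q3 : 2 * a3 ≤ (Ce + k' + 2) * a3 :=
    mul_le_mul_of_nonneg_right (by linarith) ha3
  calc _ ≤ C₀ * θ * (Ce * a1 + k' * a2 + 2 * a3) := by
        refine mul_le_mul_of_nonneg_left ((add_le_add (add_le_add k1 k2) k3).trans
          (le_of_eq ?_)) (by positivity)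
        rw [h1, h2, h3]; ring
    _ ≤ C₀ * θ * ((Ce + k' + 2) * a1 + (Ce + k' + 2) * a2 +
          (Ce + k' + 2) * a3) :=
        mul_le_mul_of_nonneg_left (add_le_add (add_le_add q1 q2) q3) (by positivity)
    _ = _ := by rw [h1]; ring

/-! ### Resampling a weight as an exchange. -/

section Resample

/-- The exchanges of the weight of an edge with the spare weight. -/
noncomputable def resampleExchange (N d : ℕ) (ν : Measure ℝ) :
    Exchange N d (Fin N × Fin N) (Fin 2) (Fin 2) where
  move q s := s.resample s(q.1, q.2)
  rate q s := s.adj q.1 q.2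
  corner q := ![q.1, q.2]
  fst t := t
  snd t := 1 - t
  coef q _ s := (√(scaleSq N d ν))⁻¹ * (s.adj q.1 q.2 * (s.spare - s.wt s(q.1, q.2)))
  size q s := 1 + |s.wt s(q.1, q.2)| + |s.spare|
  main := 0

variable {N d : ℕ} {ν : Measure ℝ} [IsProbabilityMeasure ν] [Nonempty (RegGraph N d)]

/-- The rate depends on the graph alone, which the move leaves unchanged; a change of variables
removes the move. -/
theorem resampleExchange_average_move {f : (Fin N × Fin N) → Sample N d → ℝ}
    (hf : ∀ q, Tame (f q) (sampleLaw N d ν)) :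
    (resampleExchange N d ν).average ν (fun q s => f q ((resampleExchange N d ν).move q s)) =
      (resampleExchange N d ν).average ν f := by
  have hX := fun q : Fin N × Fin N => tame_adj (N := N) (d := d) (ν := ν) q.1 q.2
  simp only [Exchange.average, resampleExchange]
  have hm := fun q : Fin N × Fin N => measurePreserving_resample (d := d) (ν := ν) s(q.1, q.2)
  rw [integral_finsetSum _ fun q _ => ((hX q).mul ((hf q).comp (hm q))).integrable,
    integral_finsetSum _ fun q _ => ((hX q).mul (hf q)).integrable]
  refine Finset.sum_congr rfl fun q _ => ?_
  rw [← integral_comp_preserving ((hX q).mul (hf q)).1 (hm q)]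
  rfl

omit [IsProbabilityMeasure ν] [Nonempty (RegGraph N d)] in
theorem resampleExchange_vertex_le (f : Fin N → Sample N d → ℝ) (k : Fin 2) :
    (resampleExchange N d ν).average ν (fun q s => f ((resampleExchange N d ν).corner q k) s) ≤
      d * ∫ s, ∑ x, f x s ∂sampleLaw N d ν := by
  refine le_of_eq ?_
  rw [← integral_const_mul]
  refine integral_congr_ae (ae_of_all _ fun s => ?_)
  simp only [resampleExchange, Fintype.sum_prod_type]
  have hr := s.isRegularAdj.row_sum
  have hs := s.isRegularAdj.symm
  fin_cases k
  · simp only [Fin.zero_eta, Matrix.cons_val_zero, ← Finset.sum_mul, hr, Finset.mul_sum]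
  · simp only [Fin.mk_one, Matrix.cons_val_one]
    rw [Finset.sum_comm, Finset.mul_sum]
    refine Finset.sum_congr rfl fun j _ => ?_
    rw [← Finset.sum_mul, ← hr j]
    simp only [Matrix.cons_val_fin_one]
    congr 1
    exact Finset.sum_congr rfl fun i _ => adj_symm _ _ _

theorem resampleExchange_pair_le {f : Fin N → Fin N → Sample N d → ℝ}
    (hf : ∀ x y, Tame (f x y) (sampleLaw N d ν)) (hf0 : ∀ x y s, 0 ≤ f x y s) {k l : Fin 2}
    (hkl : k ≠ l) :
    (resampleExchange N d ν).average ν (fun q s => f ((resampleExchange N d ν).corner q k)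
        ((resampleExchange N d ν).corner q l) s) ≤
      1 * ∫ s, ∑ x, ∑ y, f x y s ∂sampleLaw N d ν := by
  have hX := fun q : Fin N × Fin N => tame_adj (N := N) (d := d) (ν := ν) q.1 q.2
  rw [one_mul]
  refine integral_mono (Tame.sum _ fun q => (hX q).mul (hf _ _)).integrable
    (Tame.sum _ fun x => Tame.sum _ fun y => hf x y).integrable fun s => ?_
  have h1 : ∑ q, (resampleExchange N d ν).rate q s * f ((resampleExchange N d ν).corner q k)
        ((resampleExchange N d ν).corner q l) s ≤
      ∑ q, f ((resampleExchange N d ν).corner q k) ((resampleExchange N d ν).corner q l) s :=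
    Finset.sum_le_sum fun q _ => mul_le_of_le_one_left (hf0 _ _ _) (s.isRegularAdj.le_one _ _)
  refine h1.trans (le_of_eq ?_)
  rw [Fintype.sum_prod_type]
  fin_cases k <;> fin_cases l <;> simp [resampleExchange] at hkl ⊢
  exact Finset.sum_comm

/-- A vertex meets d edges, a pair at most one; the quotient 1/d of the two rates makes the
off-diagonal terms negligible. The constant comes from (1 + a + b)^8 ≤ 3^8(1 + a^8 + b^8). -/
theorem resampleExchange_isAdmissible (hx : Tame (fun x : ℝ => x) ν) :
    (resampleExchange N d ν).IsAdmissible ν d 1 (3 ^ 8 * (1 + 2 * ∫ x, |x| ^ 8 ∂ν)) where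
  nonneg_vertex := Nat.cast_nonneg _
  nonneg_pair := zero_le_one
  preserving q := measurePreserving_resample _
  tame_rate q := tame_adj _ _
  tame_size q := ((Tame.const _).add (tame_weight_comp hx (some _)).abs).add
    (tame_weight_comp hx none).abs
  tame_coef q _ := (Tame.const _).mul ((tame_adj _ _).mul ((tame_weight_comp hx none).sub
    (tame_weight_comp hx (some _))))
  rate_nonneg q s := s.isRegularAdj.nonneg _ _
  one_le_size q s := by
    simp only [resampleExchange]
    have := abs_nonneg (s.wt s(q.1, q.2))
    have := abs_nonneg s.spare
    linarith
  std_move_sub q s _ := standardized_resample_sub ν s q.1 q.2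
  abs_coef_le q s _ t := by
    simp only [resampleExchange]
    rw [abs_mul, abs_of_nonneg (by positivity : 0 ≤ (√(scaleSq N d ν))⁻¹)]
    refine mul_le_mul_of_nonneg_left ?_ (by positivity)
    rw [abs_mul, abs_of_nonneg (s.isRegularAdj.nonneg _ _)]
    refine (mul_le_of_le_one_left (abs_nonneg _) (s.isRegularAdj.le_one _ _)).trans ?_
    refine (abs_sub _ _).trans ?_
    linarith
  ne_main t ht := Or.inl ht
  fst_main_ne := by simp [resampleExchange]
  size_le := by
    have a0 := integral_sum_adj_mul_weight (N := N) (d := d) (ν := ν) (f := fun _ => 1)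
      (Tame.const _) (fun i j => none)
    have a1 := integral_sum_adj_mul_weight (N := N) (d := d) (ν := ν) (f := fun x => |x| ^ 8)
      (hx.abs.pow _) (fun i j => some s(i, j))
    have a2 := integral_sum_adj_mul_weight (N := N) (d := d) (ν := ν) (f := fun x => |x| ^ 8)
      (hx.abs.pow _) (fun i j => none)
    have t0 := fun i j => (tame_adj (N := N) (d := d) (ν := ν) i j).mul (Tame.const 1)
    have t1 := fun i j => (tame_adj (N := N) (d := d) (ν := ν) i j).mul
      ((tame_weight_comp hx (some s(i, j))).abs.pow 8)
    have t2 := fun i j => (tame_adj (N := N) (d := d) (ν := ν) i j).mul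
      ((tame_weight_comp hx none).abs.pow 8)
    have u0 := Tame.sum (μ := sampleLaw N d ν) Finset.univ fun i => Tame.sum Finset.univ (t0 i)
    have u1 := Tame.sum (μ := sampleLaw N d ν) Finset.univ fun i => Tame.sum Finset.univ (t1 i)
    have u2 := Tame.sum (μ := sampleLaw N d ν) Finset.univ fun i => Tame.sum Finset.univ (t2 i)
    have tS := fun q : Fin N × Fin N => (tame_adj (N := N) (d := d) (ν := ν) q.1 q.2).mul
      ((((Tame.const 1).add (tame_weight_comp hx (some s(q.1, q.2))).abs).add
        (tame_weight_comp hx none).abs).pow 8)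
    have e : (resampleExchange N d ν).average ν
        (fun q s => (resampleExchange N d ν).size q s ^ 8) ≤
        ∫ s : Sample N d, 3 ^ 8 * (∑ i, ∑ j, s.adj i j * 1 +
          ∑ i, ∑ j, s.adj i j * |s.2 (some s(i, j))| ^ 8 +
          ∑ i, ∑ j, s.adj i j * |s.2 none| ^ 8) ∂sampleLaw N d ν := by
      refine integral_mono (Tame.sum _ tS).integrable
        ((Tame.const _).mul ((u0.add u1).add u2)).integrable fun s => ?_
      simp only [resampleExchange, Fintype.sum_prod_type, ← Finset.sum_add_distrib, Finset.mul_sum]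
      refine Finset.sum_le_sum fun i _ => Finset.sum_le_sum fun j _ => ?_
      have := mul_le_mul_of_nonneg_left (one_add_add_pow_le (abs_nonneg (s.wt s(i, j)))
        (abs_nonneg s.spare) 8) (s.isRegularAdj.nonneg i j)
      linarith
    refine e.trans (le_of_eq ?_)
    rw [integral_const_mul, integral_add (u0.add u1).integrable u2.integrable,
      integral_add u0.integrable u1.integrable, a0, a1, a2]
    simp only [integral_const, probReal_univ, one_smul]
    ring
  vertex_le f _ _ k := resampleExchange_vertex_le f k
  vertex_move_le f hf _ k :=
    (resampleExchange_average_move fun q => hf _).trans_le (resampleExchange_vertex_le f k)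
  pair_le f hf hf0 _ _ hkl := resampleExchange_pair_le hf hf0 hkl
  pair_move_le f hf hf0 _ _ hkl :=
    (resampleExchange_average_move fun q => hf _ _).trans_le (resampleExchange_pair_le hf hf0 hkl)

end Resample

/-! ### Switching as an exchange. -/

section Switch

/-- The switchings which create an edge between the first two vertices of a quadruple. -/
noncomputable def switchExchange (N d : ℕ) (ν : Measure ℝ) :
    Exchange N d (Fin N × Fin N × Fin N × Fin N) (Fin 4) (Fin 4 × Bool) where
  move q s := s.switch q
  rate q s := altWeight s.adj (flip q)
  corner q := corner q
  fst := sideFst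
  snd := sideSnd
  coef q t s := (√(scaleSq N d ν))⁻¹ * ((-1) ^ (t.1 : ℕ) *
    s.wt s(corner q (sideFst t), corner q (sideSnd t)))
  size q s := 1 + ∑ a : Fin 4, |s.wt s(corner q a, corner q (a + 1))|
  -- The first side in its given orientation, which enters with sign +1: the edge being created.
  main := (0, true)

variable {N d : ℕ} {ν : Measure ℝ}

theorem weightedAdj_switch_sub {q : Fin N × Fin N × Fin N × Fin N} {s : Sample N d}
    (h : altWeight s.adj (flip q) = 1) :
    weightedAdj (s.switch q).1.1 (s.switch q).wt - weightedAdj s.1.1 s.wt =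
      ∑ t : Fin 4 × Bool, Matrix.single (corner q (sideFst t)) (corner q (sideSnd t))
        ((-1 : ℝ) ^ (t.1 : ℕ) * s.wt s(corner q (sideFst t), corner q (sideSnd t))) := by
  have e : adj (switch q s.1.1) = adj s.1.1 + signedCycle q := adj_switch h
  ext a b
  rw [Matrix.sub_apply, weightedAdj_apply, weightedAdj_apply]
  change adj (switch q s.1.1) a b * s.wt s(a, b) - adj s.1.1 a b * s.wt s(a, b) = _
  rw [e, Matrix.add_apply, ← sub_mul, add_sub_cancel_left, signedCycle_eq_sum, Matrix.sum_apply,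
    Matrix.sum_apply, Finset.sum_mul]
  refine Finset.sum_congr rfl fun t _ => ?_
  rw [Matrix.single_apply, Matrix.single_apply]
  split_ifs with hab
  · rw [hab.1, hab.2]
  · rw [zero_mul]

theorem std_switch_sub {q : Fin N × Fin N × Fin N × Fin N} {s : Sample N d}
    (h : altWeight s.adj (flip q) = 1) :
    (s.switch q).std ν - s.std ν =
      ∑ t : Fin 4 × Bool, Matrix.single (corner q (sideFst t)) (corner q (sideSnd t))
        ((√(scaleSq N d ν))⁻¹ * ((-1 : ℝ) ^ (t.1 : ℕ) *
          s.wt s(corner q (sideFst t), corner q (sideSnd t)))) := by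
  have h1 := weightedAdj_switch_sub h
  simp only [Sample.std, standardized]
  rw [← smul_sub, sub_sub_sub_cancel_right, h1, Finset.smul_sum]
  refine Finset.sum_congr rfl fun t _ => ?_
  rw [Matrix.smul_single, smul_eq_mul, scaleSq]

theorem abs_wt_side_le (q : Fin N × Fin N × Fin N × Fin N) (s : Sample N d) (t : Fin 4 × Bool) :
    |s.wt s(corner q (sideFst t), corner q (sideSnd t))| ≤
      1 + ∑ a : Fin 4, |s.wt s(corner q a, corner q (a + 1))| := by
  have h := Finset.single_le_sum (f := fun a : Fin 4 => |s.wt s(corner q a, corner q (a + 1))|)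
    (fun a _ => abs_nonneg _) (Finset.mem_univ t.1)
  obtain ⟨a, b⟩ := t
  cases b
  · simp only [sideFst, sideSnd]
    rw [Sym2.eq_swap]
    simp at h ⊢
    linarith
  · simp [sideFst, sideSnd] at h ⊢
    linarith

theorem one_add_sum_pow_le (f : Fin 4 → ℝ) (hf : ∀ a, 0 ≤ f a) :
    (1 + ∑ a, f a) ^ 8 ≤ 2 ^ 7 * (1 + 4 ^ 7 * ∑ a, f a ^ 8) := by
  have h1 := add_pow_le (zero_le_one (α := ℝ)) (Finset.sum_nonneg fun a (_ : a ∈ Finset.univ) => hf a) 8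
  have h2 := pow_sum_div_card_le_sum_pow (s := Finset.univ) (f := f) (fun a _ => hf a) 7
  rw [div_le_iff₀ (by simp), Finset.card_univ, Fintype.card_fin] at h2
  push_cast at h2
  norm_num at h1 h2 ⊢
  linarith

variable [IsProbabilityMeasure ν] [Nonempty (RegGraph N d)]

/-- The rates depend on the graph only and the weights are independent of it, so the eighth moment
of the size factors out; 4^8 is 4^7 from convexity times the four sides. -/
theorem switchExchange_isAdmissible (hx : Tame (fun x : ℝ => x) ν) :
    (switchExchange N d ν).IsAdmissible ν (4 * (N * rowVar N d ^ 2)) (2 * (N * rowVar N d))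
      (2 ^ 7 * (1 + 4 ^ 8 * ∫ x, |x| ^ 8 ∂ν)) where
  nonneg_vertex := by positivity
  nonneg_pair := by
    rcases Nat.eq_zero_or_pos N with h | h
    · simp [h]
    · have := (Sample.isRegularAdj ((Classical.arbitrary (RegGraph N d), fun _ => 0) :
        Sample N d)).rowVar_nonneg h
      positivity
  preserving q := measurePreserving_switch _
  tame_rate q := tame_altWeight _
  tame_size q := (Tame.const _).add (Tame.sum _ fun a => (tame_weight_comp hx (some _)).abs)
  tame_coef q _ := (Tame.const _).mul ((Tame.const _).mul (tame_weight_comp hx (some _)))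
  rate_nonneg q s := by
    change 0 ≤ altWeight s.adj (flip q)
    rcases altWeight_zero_or_one s.1.1 (flip q) with h | h <;> rw [h]
    exact zero_le_one
  one_le_size q s := le_add_of_nonneg_right (Finset.sum_nonneg fun _ _ => abs_nonneg _)
  std_move_sub q s h :=
    std_switch_sub ((altWeight_zero_or_one s.1.1 (flip q)).resolve_left h)
  abs_coef_le q s _ t := by
    simp only [switchExchange]
    rw [abs_mul, abs_of_nonneg (by positivity : 0 ≤ (√(scaleSq N d ν))⁻¹), abs_mul, abs_pow,
      abs_neg, abs_one, one_pow, one_mul]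
    exact mul_le_mul_of_nonneg_left (abs_wt_side_le q s t) (by positivity)
  ne_main t ht := by
    revert t
    simp only [switchExchange]
    decide
  fst_main_ne := by
    simp only [switchExchange]
    decide
  size_le := by
    have hA := fun q : Fin N × Fin N × Fin N × Fin N => tame_altWeight (d := d) (ν := ν) (flip q)
    have v := integral_sum_altWeight_vertex_le (N := N) (d := d) (ν := ν) (f := fun _ _ => 1)
      (fun _ => Tame.const _) (fun _ _ => zero_le_one) 0
    simp only [Finset.sum_const, Finset.card_univ, Fintype.card_fin, nsmul_eq_mul, integral_const,
      probReal_univ, one_smul, mul_one] at v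
    have tw := fun (q : Fin N × Fin N × Fin N × Fin N) (a : Fin 4) =>
      (tame_weight_comp (N := N) (d := d) hx (some s(corner q a, corner q (a + 1)))).abs
    have hsz := fun q => ((Tame.const 1).add (Tame.sum (μ := sampleLaw N d ν) Finset.univ (tw q))).pow 8
    have hE8 : 0 ≤ ∫ x, |x| ^ 8 ∂ν := integral_nonneg fun x => by positivity
    simp only [Exchange.average, switchExchange]
    rw [integral_finsetSum _ fun q _ => ((hA q).mul (hsz q)).integrable]
    rw [integral_finsetSum _ fun q _ => (hA q).integrable] at v
    have key : ∀ q : Fin N × Fin N × Fin N × Fin N, ∫ s : Sample N d, altWeight s.adj (flip q) *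
        (1 + ∑ a : Fin 4, |s.wt s(corner q a, corner q (a + 1))|) ^ 8 ∂sampleLaw N d ν ≤
        2 ^ 7 * (1 + 4 ^ 8 * ∫ x, |x| ^ 8 ∂ν) *
          ∫ s : Sample N d, altWeight s.adj (flip q) ∂sampleLaw N d ν := by
      intro q
      have tt := fun a => (hA q).mul ((tw q a).pow 8)
      have hle : ∫ s : Sample N d, altWeight s.adj (flip q) *
          (1 + ∑ a : Fin 4, |s.wt s(corner q a, corner q (a + 1))|) ^ 8 ∂sampleLaw N d ν ≤
          ∫ s : Sample N d, 2 ^ 7 * (altWeight s.adj (flip q) + 4 ^ 7 * ∑ a : Fin 4,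
            altWeight s.adj (flip q) * |s.wt s(corner q a, corner q (a + 1))| ^ 8)
            ∂sampleLaw N d ν := by
        refine integral_mono ((hA q).mul (hsz q)).integrable ((Tame.const _).mul ((hA q).add
          ((Tame.const _).mul (Tame.sum _ tt)))).integrable fun s => ?_
        have h0 : 0 ≤ altWeight s.adj (flip q) := by
          rcases altWeight_zero_or_one s.1.1 (flip q) with h | h <;> rw [h]
          exact zero_le_one
        have := mul_le_mul_of_nonneg_left (one_add_sum_pow_le
          (fun a : Fin 4 => |s.wt s(corner q a, corner q (a + 1))|) fun a => abs_nonneg _) h0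
        simp only [← Finset.mul_sum]
        linarith
      refine hle.trans (le_of_eq ?_)
      rw [integral_const_mul, integral_add (hA q).integrable
        ((Tame.const _).mul (Tame.sum _ tt)).integrable, integral_const_mul,
        integral_finsetSum _ fun a _ => (tt a).integrable]
      have e : ∀ a : Fin 4, ∫ s : Sample N d, altWeight s.adj (flip q) *
          |s.wt s(corner q a, corner q (a + 1))| ^ 8 ∂sampleLaw N d ν =
          (∫ s : Sample N d, altWeight s.adj (flip q) ∂sampleLaw N d ν) * ∫ x, |x| ^ 8 ∂ν :=
        fun a => integral_graph_mul_weight (fun H => altWeight (adj H.1) (flip q))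
          (f := fun x => |x| ^ 8) (hx.abs.pow 8).1 (some s(corner q a, corner q (a + 1)))
      simp only [e, Finset.sum_const, Finset.card_univ, Fintype.card_fin, nsmul_eq_mul]
      push_cast
      ring
    refine (Finset.sum_le_sum fun q _ => key q).trans ?_
    rw [← Finset.mul_sum]
    exact mul_le_mul_of_nonneg_left v (by positivity)
  vertex_le f hf hf0 k := integral_sum_altWeight_vertex_le hf hf0 k
  vertex_move_le f hf hf0 k := integral_sum_altWeight_vertex_switch_le hf hf0 k
  pair_le f hf hf0 _ _ hkl := integral_sum_altWeight_pair_le hf hf0 hkl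
  pair_move_le f hf hf0 _ _ hkl := integral_sum_altWeight_pair_switch_le hf hf0 hkl

end Switch

/-! ### Bounds for test functions, normalization and deviations. -/

section Bounds

theorem sq_pow_apply_le {V : Type*} [Fintype V] [DecidableEq V] {M : Matrix V V ℝ}
    (hM : M.IsSymm) (a : ℕ) (i : V) : (M ^ a) i i ^ 2 ≤ (M ^ (2 * a)) i i := by
  rw [← sum_sq_pow_apply hM]
  exact Finset.single_le_sum (f := fun y => (M ^ a) i y ^ 2) (fun y _ => sq_nonneg _)
    (Finset.mem_univ i)

variable {ν : Measure ℝ} [IsProbabilityMeasure ν]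

theorem exists_fluctuation_le (hν : AdmissibleWeightLaw ν) (cs : ℕ → ℝ) (a : ℕ) :
    ∃ C : ℝ, 0 ≤ C ∧ ∀ (N d : ℕ) [Nonempty (RegGraph N d)], 16 ≤ rowVar N d →
      fluctuation N d ν cs a ≤ C * N := by
  obtain ⟨C, hC0, hC⟩ := exists_integral_trace_standardized_pow_le hν a
  refine ⟨2 * (C + cs a ^ 2), by positivity, fun N d _ hσ => ?_⟩
  have tP := fun a (i j : Fin N) => tame_std_pow (N := N) (d := d) hν.tame a i j
  have h1 : fluctuation N d ν cs a ≤ ∫ s : Sample N d, 2 * ((s.std ν ^ (2 * a)).trace +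
      N * cs a ^ 2) ∂sampleLaw N d ν := by
    refine integral_mono (Tame.sum _ fun i => (tame_deviation hν.tame cs a i).pow 2).integrable
      ((Tame.const _).mul ((Tame.trace_matrix_pow (tame_standardized hν.tame) _).add
        (Tame.const _))).integrable fun s => ?_
    have : (N : ℝ) * cs a ^ 2 = ∑ _i : Fin N, cs a ^ 2 := by simp
    simp only
    rw [this, Matrix.trace, ← Finset.sum_add_distrib, Finset.mul_sum]
    refine Finset.sum_le_sum fun i _ => ?_
    have := sq_pow_apply_le (standardized_isSymm ν s) a i
    simp only [deviation, Matrix.diag]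
    nlinarith [sq_nonneg ((s.std ν ^ a) i i + cs a)]
  refine h1.trans ?_
  rw [integral_const_mul, integral_add
    (Tame.trace_matrix_pow (tame_standardized hν.tame) _).integrable (integrable_const _)]
  simp only [integral_const, probReal_univ, one_smul]
  linarith [hC N d hσ]

/-- The i-th row of M^{n+1} has squared length (M^{2n+2})_ii, so the sum over pairs is of order N
rather than N². -/
theorem exists_integral_sum_testEntry_sq_le (hν : AdmissibleWeightLaw ν) (cs : ℕ → ℝ) (n : ℕ) :
    ∃ C : ℝ, 0 ≤ C ∧ ∀ (N d : ℕ) [Nonempty (RegGraph N d)], 16 ≤ rowVar N d →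
      ∫ s : Sample N d, ∑ i, ∑ j, testEntry ν cs n i j s ^ 2 ∂sampleLaw N d ν ≤ C * N := by
  obtain ⟨C₁, hC₁0, hC₁⟩ := exists_integral_trace_standardized_pow_le hν (2 * (n + 1))
  obtain ⟨C₂, hC₂0, hC₂⟩ := exists_integral_trace_standardized_pow_le hν (2 * (n + 2))
  refine ⟨C₁ + 8 * (C₂ + cs (n + 2) ^ 4), by positivity, fun N d _ hσ => ?_⟩
  have t1 := Tame.trace_matrix_pow (tame_standardized (N := N) (d := d) hν.tame)
    (2 * (2 * (n + 1)))
  have t2 := Tame.trace_matrix_pow (tame_standardized (N := N) (d := d) hν.tame)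
    (2 * (2 * (n + 2)))
  refine (integral_mono (g := fun s : Sample N d => (s.std ν ^ (2 * (2 * (n + 1)))).trace +
      8 * ((s.std ν ^ (2 * (2 * (n + 2)))).trace + N * cs (n + 2) ^ 4))
    (Tame.sum _ fun i => Tame.sum _ fun j => (tame_testEntry hν.tame cs n i j).pow 2).integrable
    (t1.add ((Tame.const _).mul (t2.add (Tame.const _)))).integrable fun s => ?_).trans ?_
  · have hM := standardized_isSymm ν s
    have e : (N : ℝ) * cs (n + 2) ^ 4 = ∑ _i : Fin N, cs (n + 2) ^ 4 := by simp
    simp only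
    rw [e, Matrix.trace, Matrix.trace, ← Finset.sum_add_distrib, Finset.mul_sum,
      ← Finset.sum_add_distrib]
    refine Finset.sum_le_sum fun i _ => ?_
    simp only [testEntry, mul_pow, ← Finset.sum_mul, Matrix.diag]
    rw [sum_sq_pow_apply hM]
    have q1 := sq_pow_apply_le hM (2 * (n + 1)) i
    have q2 := sq_pow_apply_le hM (n + 2) i
    have q3 := sq_pow_apply_le hM (2 * (n + 2)) i
    have q4 : (s.std ν ^ (n + 2)) i i ^ 4 ≤ (s.std ν ^ (2 * (n + 2))) i i ^ 2 := by
      calc _ = ((s.std ν ^ (n + 2)) i i ^ 2) ^ 2 := by ring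
        _ ≤ _ := pow_le_pow_left₀ (sq_nonneg _) q2 2
    have q5 : deviation ν cs (n + 2) i s ^ 4 ≤
        8 * ((s.std ν ^ (n + 2)) i i ^ 4 + cs (n + 2) ^ 4) := by
      simp only [deviation]
      set a := (s.std ν ^ (n + 2)) i i
      set b := cs (n + 2)
      have r1 : (a - b) ^ 2 ≤ 2 * (a ^ 2 + b ^ 2) := by nlinarith [sq_nonneg (a + b)]
      calc (a - b) ^ 4 = ((a - b) ^ 2) ^ 2 := by ring
        _ ≤ (2 * (a ^ 2 + b ^ 2)) ^ 2 := pow_le_pow_left₀ (sq_nonneg _) r1 2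
        _ ≤ _ := by nlinarith [sq_nonneg (a ^ 2 - b ^ 2)]
    nlinarith [sq_nonneg ((s.std ν ^ (2 * (n + 1))) i i - deviation ν cs (n + 2) i s ^ 2)]
  · have := hC₁ N d hσ
    have := hC₂ N d hσ
    rw [integral_add t1.integrable ((Tame.const _).mul (t2.add (Tame.const _))).integrable,
      integral_const_mul, integral_add t2.integrable (integrable_const _)]
    simp only [integral_const, probReal_univ, one_smul]
    linarith

/-- `scaleSq_bounds` rewritten for θ. The last item says that the variances coming from the weights
and from the graph add up to one asymptotically; it is what makes the main terms cancel. -/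
theorem exists_scale_bounds (hν : AdmissibleWeightLaw ν) :
    ∃ c : ℝ, 0 ≤ c ∧ ∀ (N d : ℕ) [Nonempty (RegGraph N d)], 16 ≤ rowVar N d →
      0 < scaleSq N d ν ∧ (√(scaleSq N d ν))⁻¹ ≤ c * (√(rowVar N d))⁻¹ ∧
      (√(scaleSq N d ν))⁻¹ ^ 2 * (d * (∫ x, x ^ 2 ∂ν - (∫ x, x ∂ν) ^ 2)) ≤ 1 ∧
      (√(scaleSq N d ν))⁻¹ ^ 2 * rowVar N d ≤ c ∧
      |(√(scaleSq N d ν))⁻¹ ^ 2 * (d * (∫ x, x ^ 2 ∂ν - (∫ x, x ∂ν) ^ 2) +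
        (∫ x, x ∂ν) ^ 2 * rowVar N d) - 1| ≤ c * (√(rowVar N d))⁻¹ := by
  have hm2 : 0 < ∫ x, x ^ 2 ∂ν := by
    have := (hν 1 le_rfl).2
    simpa using this
  set m2 := ∫ x, x ^ 2 ∂ν
  set m := ∫ x, x ∂ν
  refine ⟨√(2 / m2) + 2 / m2 + 2 / m2 * m ^ 2, by positivity, fun N d _ hσ => ?_⟩
  obtain ⟨b1, b2, b3⟩ := scaleSq_bounds (N := N) (d := d) hν.tame hσ
  have hρ : 0 < √(rowVar N d) := Real.sqrt_pos.2 (by linarith)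
  have hρ2 : √(rowVar N d) ^ 2 = rowVar N d := Real.sq_sqrt (by linarith)
  have hρ1 : 1 ≤ √(rowVar N d) := Real.one_le_sqrt.2 (by linarith)
  have hτ : 0 < scaleSq N d ν := by nlinarith
  have hθ2 : (√(scaleSq N d ν))⁻¹ ^ 2 = (scaleSq N d ν)⁻¹ := by rw [inv_pow, Real.sq_sqrt hτ.le]
  have hle : (scaleSq N d ν)⁻¹ ≤ 2 / m2 * (rowVar N d)⁻¹ := by
    rw [inv_le_comm₀ hτ (by positivity), mul_inv, inv_inv, inv_div, div_mul_eq_mul_div,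
      div_le_iff₀ (by norm_num)]
    linarith
  have hρi : (rowVar N d)⁻¹ ≤ (√(rowVar N d))⁻¹ :=
    inv_anti₀ hρ (by nlinarith)
  have hρi0 : 0 ≤ (√(rowVar N d))⁻¹ := by positivity
  rw [hθ2]
  refine ⟨hτ, ?_, ?_, ?_, ?_⟩
  · have : (√(scaleSq N d ν))⁻¹ ≤ √(2 / m2) * (√(rowVar N d))⁻¹ := by
      rw [← Real.sqrt_inv, ← Real.sqrt_inv, ← Real.sqrt_mul (by positivity)]
      exact Real.sqrt_le_sqrt hle
    refine this.trans (mul_le_mul_of_nonneg_right ?_ hρi0)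
    have : 0 ≤ 2 / m2 + 2 / m2 * m ^ 2 := by positivity
    linarith
  · rw [inv_mul_le_iff₀ hτ, mul_one]; exact b1
  · have h := mul_le_mul_of_nonneg_right hle (by linarith : 0 ≤ rowVar N d)
    rw [mul_assoc, inv_mul_cancel₀ (by linarith), mul_one] at h
    have : 0 ≤ √(2 / m2) + 2 / m2 * m ^ 2 := by positivity
    linarith
  · have e : (scaleSq N d ν)⁻¹ * (d * (m2 - m ^ 2) + m ^ 2 * rowVar N d) - 1 =
        (scaleSq N d ν)⁻¹ * (d * (m2 - m ^ 2) + m ^ 2 * rowVar N d - scaleSq N d ν) := by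
      field_simp
    rw [e, abs_mul, abs_of_nonneg (by positivity)]
    calc _ ≤ 2 / m2 * (√(rowVar N d))⁻¹ * m ^ 2 :=
          mul_le_mul (hle.trans (mul_le_mul_of_nonneg_left hρi (by positivity))) b3 (abs_nonneg _)
            (by positivity)
      _ = 2 / m2 * m ^ 2 * (√(rowVar N d))⁻¹ := by ring
      _ ≤ _ := by
          refine mul_le_mul_of_nonneg_right ?_ hρi0
          have : 0 ≤ √(2 / m2) + 2 / m2 := by positivity
          linarith

/-- The effect of an exchange on the deviations. -/
theorem Exchange.exists_abs_average_deviation_sub_le (hν : AdmissibleWeightLaw ν) (κ ι : Type)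
    [Fintype κ] [DecidableEq κ] [Fintype ι] (cs : ℕ → ℝ) (m : ℕ) (hm : 1 ≤ m) {D : ℝ}
    (hD : 0 ≤ D) :
    ∃ C : ℝ, 0 ≤ C ∧ ∀ (N d : ℕ) [Nonempty (RegGraph N d)], 16 ≤ rowVar N d →
      ∀ (Q : Type) [Fintype Q] (E : Exchange N d Q κ ι) (A B : ℝ), E.IsAdmissible ν A B D →
      ∀ (ψ : Q → Sample N d → ℝ) (b : ℝ), 0 ≤ b → (∀ q, Tame (ψ q) (sampleLaw N d ν)) →
      (∀ q s, |ψ q s| ≤ b * E.size q s ^ 2) →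
      |E.average ν (fun q s => ψ q s *
          (deviation ν cs m (E.corner q (E.fst E.main)) (E.move q s) -
          deviation ν cs m (E.corner q (E.fst E.main)) s))| ≤
      C * b * (√(scaleSq N d ν))⁻¹ * (A * N) := by
  have hx := hν.tame
  obtain ⟨Ce, hCe0, hCe⟩ := exists_average_energy_le hν κ ι m hD
  refine ⟨m * Fintype.card ι * 2 ^ 8 * Ce, by positivity, ?_⟩
  intro N d _ hσ Q _ E A B hE ψ b hb hψ hψs
  set θ := (√(scaleSq N d ν))⁻¹ with hθ
  have hθ0 : 0 ≤ θ := by positivity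
  have tG := fun (i : Fin N) => tame_deviation (N := N) (d := d) hx cs m i
  refine (hE.abs_average_le (g := fun q s => m * Fintype.card ι * 2 ^ 8 * b * θ * E.energy ν m q s)
    (fun q => (hψ q).mul (((tG _).comp (hE.preserving q)).sub (tG _)))
    (fun q => (Tame.const _).mul (hE.tame_energy hx m q)) fun q s hq => ?_).trans ?_
  · obtain ⟨L, hL, hL1, hL2, hL8⟩ := exists_entries_bound (standardized_isSymm ν s)
      (standardized_isSymm ν (E.move q s)) (E.corner q) hm le_rfl
    have h1 := abs_pow_sub_pow_apply_le_of_entries_le (hE.std_move_sub q s hq)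
      (hE.abs_coef_le q s hq) le_rfl hL1 hL2 (E.fst E.main) (E.fst E.main)
    have hω := hE.one_le_size q s
    set ω := E.size q s with hωdef
    have e : deviation ν cs m (E.corner q (E.fst E.main)) (E.move q s) -
          deviation ν cs m (E.corner q (E.fst E.main)) s =
        ((E.move q s).std ν ^ m) (E.corner q (E.fst E.main)) (E.corner q (E.fst E.main)) -
        (s.std ν ^ m) (E.corner q (E.fst E.main)) (E.corner q (E.fst E.main)) := by
      simp only [deviation]; ring
    rw [abs_mul, e]
    have hen : ω ^ 4 * L ^ 4 ≤ 2 ^ 8 * E.energy ν m q s := by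
      refine (pow_four_mul_pow_four_le ω L).trans ?_
      rw [hL8, Exchange.energy, ← hωdef, mul_one]
      have : 0 ≤ ω ^ 8 := by positivity
      linarith
    have h34 : ω ^ 3 * L ^ 2 ≤ ω ^ 4 * L ^ 4 :=
      mul_le_mul (pow_le_pow_right₀ hω (by norm_num)) (pow_le_pow_right₀ hL (by norm_num))
        (by positivity) (by positivity)
    calc _ ≤ b * ω ^ 2 * (m * Fintype.card ι * (θ * ω * L ^ 2)) :=
          mul_le_mul (hψs q s) h1 (abs_nonneg _) (by positivity)
      _ = m * Fintype.card ι * b * θ * (ω ^ 3 * L ^ 2) := by ring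
      _ ≤ m * Fintype.card ι * b * θ * (2 ^ 8 * E.energy ν m q s) :=
          mul_le_mul_of_nonneg_left (h34.trans hen) (by positivity)
      _ = _ := by ring
  · rw [average_const_mul]
    calc _ ≤ m * Fintype.card ι * 2 ^ 8 * b * θ * (Ce * (A * N)) :=
          mul_le_mul_of_nonneg_left (hCe N d hσ Q E A B hE) (by positivity)
      _ = _ := by ring

end Bounds

/-! ### Contribution of the centered weights. -/

section Noise

variable {N d : ℕ} {ν : Measure ℝ} [IsProbabilityMeasure ν] [Nonempty (RegGraph N d)]

omit [IsProbabilityMeasure ν] [Nonempty (RegGraph N d)] in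
theorem deviation_congr (cs : ℕ → ℝ) (a : ℕ) (i : Fin N) (s t : Sample N d) (h : s.1 = t.1)
    (h' : ∀ e, s.wt e = t.wt e) : deviation ν cs a i s = deviation ν cs a i t := by
  have : s.wt = t.wt := funext h'
  simp only [deviation, Sample.std, h, this]

omit [IsProbabilityMeasure ν] [Nonempty (RegGraph N d)] in
theorem testEntry_congr (cs : ℕ → ℝ) (n : ℕ) (i j : Fin N) (s t : Sample N d) (h : s.1 = t.1)
    (h' : ∀ e, s.wt e = t.wt e) : testEntry ν cs n i j s = testEntry ν cs n i j t := by
  have : s.wt = t.wt := funext h'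
  simp only [testEntry, deviation, Sample.std, h, this]

/-- The main increment carries w(z − w) with z the spare weight, and w is not independent of G.
Exchanging w with z moves the powers to z, which is independent of G, at the cost of the increment
of G under the exchange. -/
theorem integral_adj_mul_wt_mul_spare_sub (hx : Tame (fun x : ℝ => x) ν) {G : Sample N d → ℝ}
    (hG : Tame G (sampleLaw N d ν))
    (hG' : ∀ (s t : Sample N d), s.1 = t.1 → (∀ e, s.wt e = t.wt e) → G s = G t)
    (g : RegGraph N d → ℝ) (e : Sym2 (Fin N)) :
    ∫ s : Sample N d, g s.1 * (s.wt e * (s.spare - s.wt e) * G s) ∂sampleLaw N d ν =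
      -((∫ x, x ^ 2 ∂ν - (∫ x, x ∂ν) ^ 2) * ∫ s : Sample N d, g s.1 * G s ∂sampleLaw N d ν +
        ∫ s : Sample N d, g s.1 * ((s.spare ^ 2 - (∫ x, x ∂ν) * s.spare) *
          (G (s.resample e) - G s)) ∂sampleLaw N d ν) := by
  have tg := tame_graph (ν := ν) g
  have tw : Tame (fun s : Sample N d => s.wt e) (sampleLaw N d ν) := tame_weight_comp hx (some e)
  have tz : Tame (fun s : Sample N d => s.spare) (sampleLaw N d ν) := tame_weight_comp hx none
  have hT := measurePreserving_resample (d := d) (ν := ν) e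
  have tGT := hG.comp hT
  have h1 : ∫ s : Sample N d, s.wt e ^ 2 * (g s.1 * G s) ∂sampleLaw N d ν =
      ∫ s : Sample N d, s.spare ^ 2 * (g s.1 * G (s.resample e)) ∂sampleLaw N d ν := by
    rw [← integral_comp_preserving ((tw.pow 2).mul (tg.mul hG)).1 hT]
    simp only [Sample.resample_wt_self]
    rfl
  have h2 : ∫ s : Sample N d, s.wt e * (g s.1 * G s) ∂sampleLaw N d ν =
      ∫ s : Sample N d, s.spare * (g s.1 * G (s.resample e)) ∂sampleLaw N d ν := by
    rw [← integral_comp_preserving (tw.mul (tg.mul hG)).1 hT]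
    simp only [Sample.resample_wt_self]
    rfl
  have h3 : ∫ s : Sample N d, s.spare * (s.wt e * (g s.1 * G s)) ∂sampleLaw N d ν =
      (∫ x, x ∂ν) * ∫ s : Sample N d, s.wt e * (g s.1 * G s) ∂sampleLaw N d ν :=
    integral_spare_mul hx (tw.mul (tg.mul hG)) fun s t h h' => by rw [h, h' e, hG' s t h h']
  have h4 : ∫ s : Sample N d, s.spare * (g s.1 * G s) ∂sampleLaw N d ν =
      (∫ x, x ∂ν) * ∫ s : Sample N d, g s.1 * G s ∂sampleLaw N d ν :=
    integral_spare_mul hx (tg.mul hG) fun s t h h' => by rw [h, hG' s t h h']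
  have h5 : ∫ s : Sample N d, s.spare ^ 2 * (g s.1 * G s) ∂sampleLaw N d ν =
      (∫ x, x ^ 2 ∂ν) * ∫ s : Sample N d, g s.1 * G s ∂sampleLaw N d ν :=
    integral_spare_mul (hx.pow 2) (tg.mul hG) fun s t h h' => by rw [h, hG' s t h h']
  have e1 : ∀ s : Sample N d, g s.1 * (s.wt e * (s.spare - s.wt e) * G s) =
      s.spare * (s.wt e * (g s.1 * G s)) - s.wt e ^ 2 * (g s.1 * G s) := fun s => by ring
  have e2 : ∀ s : Sample N d, g s.1 * ((s.spare ^ 2 - (∫ x, x ∂ν) * s.spare) *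
      (G (s.resample e) - G s)) = (s.spare ^ 2 * (g s.1 * G (s.resample e)) -
        s.spare ^ 2 * (g s.1 * G s)) - (∫ x, x ∂ν) * (s.spare * (g s.1 * G (s.resample e)) -
        s.spare * (g s.1 * G s)) := fun s => by ring
  simp only [e1, e2]
  have i1 := (tz.pow 2).mul (tg.mul tGT)
  have i2 := (tz.pow 2).mul (tg.mul hG)
  have i3 := tz.mul (tg.mul tGT)
  have i4 := tz.mul (tg.mul hG)
  rw [integral_sub (tz.mul (tw.mul (tg.mul hG))).integrable ((tw.pow 2).mul (tg.mul hG)).integrable,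
    integral_sub (i1.sub i2).integrable ((Tame.const _).mul (i3.sub i4)).integrable,
    integral_sub i1.integrable i2.integrable, integral_const_mul,
    integral_sub i3.integrable i4.integrable, h3, h1, h2, h4, h5]
  ring

/-- `integral_resample` at each ordered pair. The minus sign is compensated by the one in
`resampleExchange_average_main`. -/
theorem integral_sum_noise_mul_testEntry (hx : Tame (fun x : ℝ => x) ν) (cs : ℕ → ℝ) (n : ℕ) :
    ∫ s : Sample N d, ∑ i, ∑ j, noise (∫ x, x ∂ν) s i j * testEntry ν cs n i j s
        ∂sampleLaw N d ν =
      -(resampleExchange N d ν).average ν (fun q s => s.wt s(q.1, q.2) *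
        (testEntry ν cs n q.1 q.2 ((resampleExchange N d ν).move q s) -
          testEntry ν cs n q.1 q.2 s)) := by
  have tF := fun i j : Fin N => tame_testEntry (d := d) hx cs n i j
  have tw := fun e : Sym2 (Fin N) => tame_weight_comp (N := N) (d := d) hx (some e)
  have tX := fun i j : Fin N => tame_adj (N := N) (d := d) (ν := ν) i j
  have tZ := fun i j : Fin N => tame_noise (N := N) (d := d) hx (∫ x, x ∂ν) i j
  have tFT := fun i j : Fin N => (tF i j).comp (measurePreserving_resample (d := d) (ν := ν) s(i, j))
  simp only [Exchange.average, resampleExchange]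
  rw [integral_finsetSum _ fun i _ => (Tame.sum _ fun j => (tZ i j).mul (tF i j)).integrable,
    integral_finsetSum _ fun (q : Fin N × Fin N) _ => ((tX q.1 q.2).mul ((tw s(q.1, q.2)).mul
      ((tFT q.1 q.2).sub (tF q.1 q.2)))).integrable, Fintype.sum_prod_type, ← Finset.sum_neg_distrib]
  refine Finset.sum_congr rfl fun i _ => ?_
  rw [integral_finsetSum _ fun j _ => ((tZ i j).mul (tF i j)).integrable, ← Finset.sum_neg_distrib]
  refine Finset.sum_congr rfl fun j _ => ?_
  simp only [noise_apply]
  rw [integral_resample s(i, j) (tF i j) (testEntry_congr cs n i j)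
    (fun H => adj H.1 i j) hx, ← integral_neg]
  refine integral_congr_ae (ae_of_all _ fun s => ?_)
  ring

theorem resampleExchange_average_main (hx : Tame (fun x : ℝ => x) ν) (cs : ℕ → ℝ) (a : ℕ) :
    (resampleExchange N d ν).average ν (fun q s => s.wt s(q.1, q.2) *
        (resampleExchange N d ν).coef q 0 s * deviation ν cs a q.1 s) =
      -((√(scaleSq N d ν))⁻¹ * ((∫ x, x ^ 2 ∂ν - (∫ x, x ∂ν) ^ 2) *
        (d * ∫ s : Sample N d, ∑ i, deviation ν cs a i s ∂sampleLaw N d ν) +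
        (resampleExchange N d ν).average ν (fun q s => (s.spare ^ 2 - (∫ x, x ∂ν) * s.spare) *
          (deviation ν cs a q.1 ((resampleExchange N d ν).move q s) - deviation ν cs a q.1 s)))) := by
  have tG := fun i : Fin N => tame_deviation (d := d) hx cs a i
  have tw := fun o => tame_weight_comp (N := N) (d := d) hx o
  have tX := fun i j : Fin N => tame_adj (N := N) (d := d) (ν := ν) i j
  have tGT := fun i j : Fin N => (tG i).comp (measurePreserving_resample (d := d) (ν := ν) s(i, j))
  have t1 := fun i j : Fin N => (tX i j).mul (((tw (some s(i, j))).mul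
    ((tw none).sub (tw (some s(i, j))))).mul (tG i))
  have t2 := fun i j : Fin N => (tX i j).mul ((((tw none).pow 2).sub ((Tame.const (∫ x, x ∂ν)).mul
    (tw none))).mul ((tGT i j).sub (tG i)))
  have t3 := fun i j : Fin N => (tX i j).mul (tG i)
  have e0 : d * ∫ s : Sample N d, ∑ i, deviation ν cs a i s ∂sampleLaw N d ν =
      ∑ i, ∑ j, ∫ s : Sample N d, s.adj i j * deviation ν cs a i s ∂sampleLaw N d ν := by
    rw [← integral_const_mul, integral_congr_ae (g := fun s : Sample N d =>
      ∑ i, ∑ j, s.adj i j * deviation ν cs a i s) (ae_of_all _ fun s => ?_),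
      integral_finsetSum _ fun i _ => (Tame.sum _ fun j => t3 i j).integrable]
    · exact Finset.sum_congr rfl fun i _ => integral_finsetSum _ fun j _ => (t3 i j).integrable
    · simp only [← Finset.sum_mul, s.isRegularAdj.row_sum, Finset.mul_sum]
  have e1 : (resampleExchange N d ν).average ν (fun q s => s.wt s(q.1, q.2) *
      (resampleExchange N d ν).coef q 0 s * deviation ν cs a q.1 s) =
      (√(scaleSq N d ν))⁻¹ * ∑ i, ∑ j, ∫ s : Sample N d, s.adj i j * (s.wt s(i, j) *
        (s.spare - s.wt s(i, j)) * deviation ν cs a i s) ∂sampleLaw N d ν := by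
    rw [Finset.sum_congr rfl fun i _ => (integral_finsetSum _ fun j _ => (t1 i j).integrable).symm,
      ← integral_finsetSum _ fun i _ => (Tame.sum _ fun j => t1 i j).integrable,
      ← integral_const_mul]
    refine integral_congr_ae (ae_of_all _ fun s => ?_)
    simp only [resampleExchange, Fintype.sum_prod_type, Finset.mul_sum]
    refine Finset.sum_congr rfl fun i _ => Finset.sum_congr rfl fun j _ => ?_
    rcases s.isRegularAdj.zero_or_one i j with h | h <;> rw [h] <;> ring
  have e2 : (resampleExchange N d ν).average ν (fun q s =>
      (s.spare ^ 2 - (∫ x, x ∂ν) * s.spare) *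
        (deviation ν cs a q.1 ((resampleExchange N d ν).move q s) - deviation ν cs a q.1 s)) =
      ∑ i, ∑ j, ∫ s : Sample N d, s.adj i j * ((s.spare ^ 2 - (∫ x, x ∂ν) * s.spare) *
        (deviation ν cs a i (s.resample s(i, j)) - deviation ν cs a i s)) ∂sampleLaw N d ν := by
    rw [Finset.sum_congr rfl fun i _ => (integral_finsetSum _ fun j _ => (t2 i j).integrable).symm,
      ← integral_finsetSum _ fun i _ => (Tame.sum _ fun j => t2 i j).integrable]
    refine integral_congr_ae (ae_of_all _ fun s => ?_)
    simp only [resampleExchange, Fintype.sum_prod_type]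
  rw [e0, e1, e2]
  rw [Finset.sum_congr rfl fun i _ => Finset.sum_congr rfl fun j _ =>
    integral_adj_mul_wt_mul_spare_sub hx (tG i) (deviation_congr cs a i)
      (fun H : RegGraph N d => adj H.1 i j) s(i, j)]
  simp only [Finset.sum_neg_distrib, Finset.sum_add_distrib, ← Finset.mul_sum]
  ring

end Noise

set_option maxHeartbeats 1000000 in
/-- The contribution of the centered weights to the recursion for the moments. -/
theorem exists_abs_integral_noise_mul_testEntry_sub_le {ν : Measure ℝ} [IsProbabilityMeasure ν]
    (hν : AdmissibleWeightLaw ν) (cs : ℕ → ℝ) (n : ℕ) :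
    ∃ C : ℝ, 0 ≤ C ∧ ∀ (N d : ℕ) [Nonempty (RegGraph N d)], 16 ≤ rowVar N d → ∀ δ : ℝ, 0 < δ →
      |(√(scaleSq N d ν))⁻¹ * ∫ s : Sample N d, ∑ i, ∑ j, noise (∫ x, x ∂ν) s i j *
          testEntry ν cs n i j s ∂sampleLaw N d ν -
        (√(scaleSq N d ν))⁻¹ ^ 2 * (d * (∫ x, x ^ 2 ∂ν - (∫ x, x ∂ν) ^ 2)) *
          ((∑ a ∈ Finset.range (n + 1), cs a * cs (n - a)) *
            ∫ s : Sample N d, ∑ i, deviation ν cs (n + 2) i s ∂sampleLaw N d ν)| ≤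
      C * (N * ((√(rowVar N d))⁻¹ + δ) +
        δ⁻¹ * ∑ a ∈ Finset.range (n + 1), fluctuation N d ν cs a) := by
  have hx := hν.tame
  set m := ∫ x, x ∂ν with hm
  set v := ∫ x, x ^ 2 ∂ν - m ^ 2 with hv
  have hv0 : 0 ≤ v := variance_nonneg hx
  have hS0 : ∀ (N d : ℕ), 0 ≤ ∑ a ∈ Finset.range (n + 1), fluctuation N d ν cs a := fun N d =>
    Finset.sum_nonneg fun a _ => integral_nonneg fun s => Finset.sum_nonneg fun i _ => sq_nonneg _
  -- For v = 0 the noise vanishes almost surely. For v > 0, θ²dv ≤ 1 yields θ²d ≤ 1/v, which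
  -- compensates the vertex rate d.
  rcases hv0.eq_or_lt with h0 | hvpos
  · refine ⟨0, le_rfl, fun N d _ hσ δ hδ => ?_⟩
    rw [← h0, mul_zero, mul_zero, zero_mul, sub_zero, zero_mul]
    refine le_of_eq ?_
    rw [integral_eq_zero_of_ae, mul_zero, abs_zero]
    filter_upwards [ae_noise_eq_zero (N := N) (d := d) hx h0.symm] with s hs
    simp only [noise_apply, hs, ← hm]
    simp
  set S := ∑ a ∈ Finset.range (n + 1), cs a * cs (n - a)
  obtain ⟨c, hc0, hc⟩ := exists_scale_bounds hν
  have hD : 0 ≤ 3 ^ 8 * (1 + 2 * ∫ x, |x| ^ 8 ∂ν) := by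
    have : 0 ≤ ∫ x, |x| ^ 8 ∂ν := integral_nonneg fun x => by positivity
    positivity
  obtain ⟨C₁, hC₁0, hC₁⟩ := Exchange.exists_abs_average_sub_le hν (Fin 2) (Fin 2) cs n hD
  obtain ⟨C₂, hC₂0, hC₂⟩ := Exchange.exists_abs_average_deviation_sub_le hν (Fin 2) (Fin 2) cs
    (n + 2) (by omega) hD
  refine ⟨C₁ * (v⁻¹ * (1 + c) + c * c + v⁻¹) + |S| * C₂ * (1 + |m|) * v⁻¹ * c, by positivity, ?_⟩
  intro N d _ hσ δ hδ
  obtain ⟨hτ, hc1, hc2, hc3, hc4⟩ := hc N d hσ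
  have hE := resampleExchange_isAdmissible (N := N) (d := d) hx
  set E := resampleExchange N d ν with hEdef
  set ρ := √(rowVar N d) with hρ
  have hρ0 : 0 < ρ := Real.sqrt_pos.2 (by linarith)
  set θ := (√(scaleSq N d ν))⁻¹ with hθ
  have hθ0 : 0 ≤ θ := by positivity
  set T := ∫ s : Sample N d, ∑ i, deviation ν cs (n + 2) i s ∂sampleLaw N d ν
  set F := ∑ a ∈ Finset.range (n + 1), fluctuation N d ν cs a with hF
  have hF0 : 0 ≤ F := hS0 N d
  have tw := fun o => tame_weight_comp (N := N) (d := d) hx o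
  have h1 := hC₁ N d hσ _ E _ _ hE (fun q s => s.wt s(q.1, q.2)) (fun q => tw _)
    (fun q s => by
      simp only [hEdef, resampleExchange]
      linarith [abs_nonneg (s.wt s(q.1, q.2)), abs_nonneg s.spare]) δ ρ hδ hρ0
  have h2 := resampleExchange_average_main (N := N) (d := d) hx cs (n + 2)
  have h3 := hC₂ N d hσ _ E _ _ hE (fun q s => s.spare ^ 2 - m * s.spare) (1 + |m|)
    (by positivity) (fun q => ((tw none).pow 2).sub ((Tame.const _).mul (tw none)))
    (fun q s => by
      simp only [hEdef, resampleExchange]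
      have a1 := abs_nonneg (s.wt s(q.1, q.2))
      have a2 := abs_nonneg s.spare
      have a3 := abs_nonneg m
      refine (abs_sub _ _).trans ?_
      rw [abs_mul, abs_pow]
      set w := |s.wt s(q.1, q.2)|
      set z := |s.spare|
      have : z ≤ (1 + w + z) ^ 2 := by nlinarith
      have h4 : z ^ 2 ≤ (1 + w + z) ^ 2 := by nlinarith
      nlinarith)
  rw [integral_sum_noise_mul_testEntry hx]
  set I := E.average ν fun q s => s.wt s(q.1, q.2) *
        (testEntry ν cs n q.1 q.2 (E.move q s) - testEntry ν cs n q.1 q.2 s) with hI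
  set R := E.average ν fun q s => (s.spare ^ 2 - m * s.spare) *
          (deviation ν cs (n + 2) q.1 (E.move q s) - deviation ν cs (n + 2) q.1 s) with hR
  have h1' : |I - S * E.average ν (fun q s => s.wt s(q.1, q.2) * E.coef q 0 s *
      deviation ν cs (n + 2) q.1 s)| ≤ C₁ * θ * (d * N * (ρ⁻¹ + θ + δ) + ρ * (1 * N) +
        δ⁻¹ * (d * F)) := h1
  have h3' : |R| ≤ C₂ * (1 + |m|) * θ * (d * N) := h3
  rw [h2, ← hv] at h1'
  change θ ^ 2 * (d * v) ≤ 1 at hc2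
  have hdv : θ ^ 2 * d ≤ v⁻¹ := by
    rw [← one_div, le_div_iff₀ hvpos]; linarith
  have hvi : 0 ≤ v⁻¹ := by positivity
  have hρi : 0 ≤ ρ⁻¹ := by positivity
  have hδi : 0 ≤ δ⁻¹ := by positivity
  have hN0 : (0 : ℝ) ≤ N := Nat.cast_nonneg _
  -- The pair rate is 1, so with ρ = √σ the off-diagonal term costs θ²ρ = O(1/ρ).
  have hθρ : θ ^ 2 * ρ ≤ c * c * ρ⁻¹ := by
    calc θ ^ 2 * ρ ≤ (c * ρ⁻¹) ^ 2 * ρ := by gcongr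
      _ = _ := by field_simp
  have e : θ * -I - θ ^ 2 * (d * v) * (S * T) =
      -(θ * (I - S * -(θ * (v * (d * T) + R)))) + S * θ ^ 2 * R := by ring
  rw [e]
  refine (abs_add_le _ _).trans ?_
  rw [abs_neg, abs_mul, abs_mul, abs_mul, abs_of_nonneg hθ0, abs_of_nonneg (sq_nonneg θ)]
  have k1 := mul_le_mul_of_nonneg_left h1' hθ0
  have k2 := mul_le_mul_of_nonneg_left h3' (by positivity : 0 ≤ |S| * θ ^ 2)
  refine (add_le_add k1 k2).trans ?_
  have g1 : θ ^ 2 * d * (N * (ρ⁻¹ + θ + δ)) ≤ v⁻¹ * (N * (ρ⁻¹ + c * ρ⁻¹ + δ)) := by gcongr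
  have g2 : θ ^ 2 * ρ * N ≤ c * c * ρ⁻¹ * N := by gcongr
  have g3 : θ ^ 2 * d * (δ⁻¹ * F) ≤ v⁻¹ * (δ⁻¹ * F) := by gcongr
  have g4 : θ ^ 2 * d * (θ * N) ≤ v⁻¹ * (c * ρ⁻¹ * N) := by gcongr
  have z1 : 0 ≤ N * δ := by positivity
  have z2 : 0 ≤ N * ρ⁻¹ := by positivity
  have z3 : 0 ≤ δ⁻¹ * F := by positivity
  calc _ = C₁ * (θ ^ 2 * d * (N * (ρ⁻¹ + θ + δ)) + θ ^ 2 * ρ * N + θ ^ 2 * d * (δ⁻¹ * F)) +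
        |S| * C₂ * (1 + |m|) * (θ ^ 2 * d * (θ * N)) := by ring
    _ ≤ C₁ * (v⁻¹ * (N * (ρ⁻¹ + c * ρ⁻¹ + δ)) + c * c * ρ⁻¹ * N + v⁻¹ * (δ⁻¹ * F)) +
        |S| * C₂ * (1 + |m|) * (v⁻¹ * (c * ρ⁻¹ * N)) := by gcongr
    _ = C₁ * (v⁻¹ * (1 + c) * (N * ρ⁻¹) + v⁻¹ * (N * δ) + c * c * (N * ρ⁻¹) + v⁻¹ * (δ⁻¹ * F)) +
        |S| * C₂ * (1 + |m|) * v⁻¹ * c * (N * ρ⁻¹) := by ring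
    _ ≤ C₁ * ((v⁻¹ * (1 + c) + c * c + v⁻¹) * (N * (ρ⁻¹ + δ) + δ⁻¹ * F)) +
        |S| * C₂ * (1 + |m|) * v⁻¹ * c * (N * (ρ⁻¹ + δ) + δ⁻¹ * F) := by
        have w0 : 0 ≤ v⁻¹ * c := by positivity
        have w1 : 0 ≤ c * c := by positivity
        refine add_le_add (mul_le_mul_of_nonneg_left ?_ hC₁0)
          (mul_le_mul_of_nonneg_left (by linarith) (by positivity))
        have w2 : (v⁻¹ * c + c * c) * (N * ρ⁻¹) ≤
            (v⁻¹ * c + c * c) * (N * (ρ⁻¹ + δ) + δ⁻¹ * F) :=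
          mul_le_mul_of_nonneg_left (by linarith) (by positivity)
        have w3 : 0 ≤ v⁻¹ * (N * (ρ⁻¹ + δ) + δ⁻¹ * F) := by positivity
        linarith
    _ = _ := by ring

/-! ### Contribution of the graph. -/

section Switch

variable {N d : ℕ} {ν : Measure ℝ} [IsProbabilityMeasure ν] [Nonempty (RegGraph N d)]

omit [IsProbabilityMeasure ν] [Nonempty (RegGraph N d)] in
theorem std_resample_of_adj_eq_zero {s : Sample N d} {i j : Fin N} (h : s.adj i j = 0) :
    (s.resample s(i, j)).std ν = s.std ν := by
  have := standardized_resample_sub ν s i j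
  rw [h] at this
  simp only [zero_mul, mul_zero, Matrix.single_zero, Finset.sum_const_zero] at this
  exact sub_eq_zero.1 this

omit [IsProbabilityMeasure ν] [Nonempty (RegGraph N d)] in
theorem adj_eq_zero_of_altWeight_flip_ne_zero {s : Sample N d} {q : Fin N × Fin N × Fin N × Fin N}
    (h : altWeight s.adj (flip q) ≠ 0) : s.adj q.1 q.2.1 = 0 := by
  obtain ⟨i, j, k, l⟩ := q
  have h1 := (altWeight_zero_or_one s.1.1 _).resolve_left h
  have h2 := ((altWeight_eq_one_iff s.1.1 i l k j).1 h1).2.2.2.1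
  have h3 : ¬ s.1.1.Adj i j := fun h => h2 h.symm
  simp [adj, h3]

/-- When the switching would create ij, this pair is not an edge yet, so M does not involve its
weight. The weight is then effectively independent of the deviation and can be replaced by its mean.
-/
theorem integral_altWeight_mul_wt (hx : Tame (fun x : ℝ => x) ν) (cs : ℕ → ℝ) (a : ℕ)
    (q : Fin N × Fin N × Fin N × Fin N) :
    ∫ s : Sample N d, altWeight s.adj (flip q) * (s.wt s(q.1, q.2.1) * deviation ν cs a q.1 s)
        ∂sampleLaw N d ν =
      (∫ x, x ∂ν) * ∫ s : Sample N d, altWeight s.adj (flip q) * deviation ν cs a q.1 s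
        ∂sampleLaw N d ν := by
  have tG := tame_deviation (d := d) hx cs a q.1
  have tA := tame_altWeight (d := d) (ν := ν) (flip q)
  have tw := tame_weight_comp (N := N) (d := d) hx (some s(q.1, q.2.1))
  have h := integral_resample s(q.1, q.2.1) tG (deviation_congr cs a q.1)
    (fun H : RegGraph N d => altWeight (adj H.1) (flip q)) hx
  have h0 : ∫ s : Sample N d, altWeight (adj s.1.1) (flip q) * s.wt s(q.1, q.2.1) *
      (deviation ν cs a q.1 s - deviation ν cs a q.1 (s.resample s(q.1, q.2.1)))
      ∂sampleLaw N d ν = 0 := by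
    refine integral_eq_zero_of_ae (ae_of_all _ fun s => ?_)
    by_cases h : altWeight s.adj (flip q) = 0
    · simp [h]
    · have := std_resample_of_adj_eq_zero (ν := ν) (adj_eq_zero_of_altWeight_flip_ne_zero h)
      simp only [deviation, this]
      simp
  rw [h0] at h
  have e : ∀ s : Sample N d, altWeight (adj s.1.1) (flip q) * (s.wt s(q.1, q.2.1) - ∫ x, x ∂ν) *
      deviation ν cs a q.1 s = altWeight s.adj (flip q) *
        (s.wt s(q.1, q.2.1) * deviation ν cs a q.1 s) -
        (∫ x, x ∂ν) * (altWeight s.adj (flip q) * deviation ν cs a q.1 s) := fun s => by ring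
  simp only [e] at h
  rw [integral_sub (tA.mul (tw.mul tG)).integrable ((Tame.const _).mul (tA.mul tG)).integrable,
    integral_const_mul] at h
  linarith

theorem switchExchange_average_main (hx : Tame (fun x : ℝ => x) ν) (cs : ℕ → ℝ) (a : ℕ) :
    (switchExchange N d ν).average ν (fun q s => 1 * (switchExchange N d ν).coef q (0, true) s *
        deviation ν cs a q.1 s) =
      (√(scaleSq N d ν))⁻¹ * ((∫ x, x ∂ν) * ∫ s : Sample N d, ∑ i,
        (∑ j, ∑ k, ∑ l, altCycle s.adj i j k l) * deviation ν cs a i s ∂sampleLaw N d ν) := by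
  have tG := fun i : Fin N => tame_deviation (d := d) hx cs a i
  have tA := fun q : Fin N × Fin N × Fin N × Fin N => tame_altWeight (d := d) (ν := ν) (flip q)
  have tw := fun o => tame_weight_comp (N := N) (d := d) hx o
  have e1 : ∀ s : Sample N d, ∑ i, (∑ j, ∑ k, ∑ l, altCycle s.adj i j k l) *
      deviation ν cs a i s = ∑ q : Fin N × Fin N × Fin N × Fin N,
        altWeight s.adj (flip q) * deviation ν cs a q.1 s := fun s => by
    rw [← (flipEquiv N).sum_comp]
    change _ = ∑ q : Fin N × Fin N × Fin N × Fin N,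
      altWeight s.adj (flip (flip q)) * deviation ν cs a q.1 s
    simp only [flip_flip, Fintype.sum_prod_type, altWeight, Finset.sum_mul]
  have e2 : (switchExchange N d ν).average ν (fun q s => 1 *
      (switchExchange N d ν).coef q (0, true) s * deviation ν cs a q.1 s) =
      ∫ s : Sample N d, (√(scaleSq N d ν))⁻¹ * ∑ q : Fin N × Fin N × Fin N × Fin N,
        altWeight s.adj (flip q) * (s.wt s(q.1, q.2.1) * deviation ν cs a q.1 s)
        ∂sampleLaw N d ν := by
    refine integral_congr_ae (ae_of_all _ fun s => ?_)
    simp only [Finset.mul_sum]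
    refine Finset.sum_congr rfl fun q _ => ?_
    simp only [switchExchange, sideFst, sideSnd, corner]
    simp
    ring
  rw [e2, integral_const_mul, integral_finsetSum _ fun q _ => ((tA q).mul ((tw _).mul
    (tG _))).integrable, Finset.sum_congr rfl fun q _ => integral_altWeight_mul_wt hx cs a q,
    ← Finset.mul_sum, ← integral_finsetSum _ fun q _ => ((tA q).mul (tG _)).integrable]
  simp only [e1]

theorem integral_sum_centered_mul_testEntry (hx : Tame (fun x : ℝ => x) ν) (cs : ℕ → ℝ) (n : ℕ) :
    ∫ s : Sample N d, ∑ i, ∑ j, (∑ k, ∑ l, (altCycle s.adj i j k l - altCycle s.adj i l k j)) *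
        testEntry ν cs n i j s ∂sampleLaw N d ν =
      (switchExchange N d ν).average ν (fun q s => 1 *
        (testEntry ν cs n q.1 q.2.1 ((switchExchange N d ν).move q s) -
          testEntry ν cs n q.1 q.2.1 s)) := by
  rw [integral_sum_altCycle_sub_mul fun i j => tame_testEntry hx cs n i j]
  simp only [one_mul]
  rfl

end Switch

/-- The kernel differs from NσY by (d + σ − 1)Y, Y³ and the bounded defect. Young's parameters ρ and
ρ³ are matched to tr Y² and tr Y⁶, of orders Nσ and Nσ³ on average; the choice will be ρ = √σ. -/
theorem IsRegularAdj.abs_sum_centered_mul_sub_le {N : ℕ} {X : Matrix (Fin N) (Fin N) ℝ} {d : ℝ}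
    (h : IsRegularAdj X d) (hσ : 1 ≤ rowVar N d) {ρ : ℝ} (hρ : 0 < ρ) (F : Fin N → Fin N → ℝ) :
    |N * rowVar N d * ∑ i, ∑ j, centered d X i j * F i j -
        ∑ i, ∑ j, (∑ k, ∑ l, (altCycle X i j k l - altCycle X i l k j)) * F i j| ≤
      2 * d * (ρ⁻¹ * (centered d X ^ (2 * 1)).trace + ρ * ∑ i, ∑ j, F i j ^ 2) +
        ((ρ ^ 3)⁻¹ * (centered d X ^ (2 * 3)).trace + ρ ^ 3 * ∑ i, ∑ j, F i j ^ 2) +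
        6 * rowVar N d * (2 * N ^ 2 + 2 * N * ∑ i, ∑ j, F i j ^ 2) := by
  set Y := centered d X with hY
  have hs : Y.IsSymm := h.centered_isSymm
  have e1 := sum_sum_sq_pow_apply hs 1
  have e3 := sum_sum_sq_pow_apply hs 3
  rw [pow_one] at e1
  have e0 : ∑ i : Fin N, ∑ j : Fin N, ((1 : ℝ) + if i = j then (N : ℝ) else 0) = 2 * N ^ 2 := by
    simp only [Finset.sum_add_distrib, Finset.sum_ite_eq, Finset.mem_univ, if_true,
      Finset.sum_const, Finset.card_univ, Fintype.card_fin, nsmul_eq_mul]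
    ring
  have hR : 2 * d * (ρ⁻¹ * (Y ^ (2 * 1)).trace + ρ * ∑ i, ∑ j, F i j ^ 2) +
      ((ρ ^ 3)⁻¹ * (Y ^ (2 * 3)).trace + ρ ^ 3 * ∑ i, ∑ j, F i j ^ 2) +
      6 * rowVar N d * (2 * N ^ 2 + 2 * N * ∑ i, ∑ j, F i j ^ 2) =
      ∑ i, ∑ j, (2 * d * (ρ⁻¹ * Y i j ^ 2 + ρ * F i j ^ 2) +
        ((ρ ^ 3)⁻¹ * (Y ^ 3) i j ^ 2 + ρ ^ 3 * F i j ^ 2) +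
        6 * rowVar N d * (((1 : ℝ) + if i = j then (N : ℝ) else 0) + 2 * N * F i j ^ 2)) := by
    rw [← e1, ← e3, ← e0]
    simp only [Finset.mul_sum, mul_add, Finset.sum_add_distrib]
  rw [hR, Finset.mul_sum, ← Finset.sum_sub_distrib]
  refine (Finset.abs_sum_le_sum_abs _ _).trans (Finset.sum_le_sum fun i _ => ?_)
  rw [Finset.mul_sum, ← Finset.sum_sub_distrib]
  refine (Finset.abs_sum_le_sum_abs _ _).trans (Finset.sum_le_sum fun j _ => ?_)
  have hN := i.pos
  have hN' : (1 : ℝ) ≤ N := by exact_mod_cast hN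
  have hd0 := h.d_nonneg hN
  have hσd := h.rowVar_le hN
  have hD := h.abs_sum_altCycle_sub_le hσ i j
  rw [← hY] at hD
  set D := ∑ k, ∑ l, (altCycle X i j k l - altCycle X i l k j)
  set w : ℝ := 1 + if i = j then (N : ℝ) else 0 with hw
  have hw0 : 0 ≤ w := by rw [hw]; split_ifs <;> linarith
  have hw1 : w ≤ 2 * N := by rw [hw]; split_ifs <;> linarith
  have e : N * rowVar N d * (Y i j * F i j) - D * F i j =
      (d + rowVar N d - 1) * (F i j * Y i j) - F i j * (Y ^ 3) i j -
      (D - ((N * rowVar N d + 1 - d - rowVar N d) * Y i j + (Y ^ 3) i j)) * F i j := by ring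
  have q1 : |F i j * Y i j| ≤ ρ⁻¹ * Y i j ^ 2 + ρ * F i j ^ 2 := by
    rw [abs_mul, ← sq_abs (Y i j), ← sq_abs (F i j)]
    linarith [mul_le_mul_sq_add_inv_mul_sq (a := |F i j|) (b := |Y i j|) hρ]
  have q2 : |F i j * (Y ^ 3) i j| ≤ (ρ ^ 3)⁻¹ * (Y ^ 3) i j ^ 2 + ρ ^ 3 * F i j ^ 2 := by
    rw [abs_mul, ← sq_abs ((Y ^ 3) i j), ← sq_abs (F i j)]
    linarith [mul_le_mul_sq_add_inv_mul_sq (a := |F i j|) (b := |(Y ^ 3) i j|)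
      (pow_pos hρ 3)]
  have q3 : |F i j| ≤ 1 + F i j ^ 2 := by
    rw [← sq_abs (F i j)]; nlinarith [sq_nonneg (|F i j| - 1)]
  rw [e]
  refine (abs_sub _ _).trans (add_le_add ((abs_sub _ _).trans (add_le_add ?_ q2)) ?_)
  · rw [abs_mul, abs_of_nonneg (by linarith)]
    exact mul_le_mul (by linarith) q1 (abs_nonneg _) (by linarith)
  · rw [abs_mul]
    calc _ ≤ 6 * rowVar N d * w * (1 + F i j ^ 2) :=
          mul_le_mul hD q3 (abs_nonneg _) (by positivity)
      _ = 6 * rowVar N d * (w + w * F i j ^ 2) := by ring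
      _ ≤ _ := by gcongr

variable {ν : Measure ℝ} [IsProbabilityMeasure ν]

theorem rowVar_le_natCast {N d : ℕ} [Nonempty (RegGraph N d)] (hσ : 16 ≤ rowVar N d) :
    1 ≤ √(rowVar N d) ∧ √(rowVar N d) ^ 2 = rowVar N d ∧ rowVar N d ≤ d ∧ (d : ℝ) ≤ N ∧
      √(rowVar N d) ≤ N := by
  obtain ⟨hN, -, -⟩ := mem_bounds_of_rowVar (d := d) hσ
  have hreg : IsRegularAdj (adj (Classical.arbitrary (RegGraph N d)).1) d :=
    (isRegularAdj_iff _).2 (Classical.arbitrary (RegGraph N d)).2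
  have h1 : 1 ≤ √(rowVar N d) := Real.one_le_sqrt.2 (by linarith)
  have h2 : √(rowVar N d) ^ 2 = rowVar N d := Real.sq_sqrt (by linarith)
  have h3 := hreg.rowVar_le hN
  have h4 := hreg.d_le hN
  exact ⟨h1, h2, h3, h4, by nlinarith⟩

/-- An error of order N²σ is harmless: it will be multiplied by θ/(Nσ), which leaves O(N/√σ). -/
theorem exists_abs_integral_centered_sub_le (hν : AdmissibleWeightLaw ν) (cs : ℕ → ℝ) (n : ℕ) :
    ∃ C : ℝ, 0 ≤ C ∧ ∀ (N d : ℕ) [Nonempty (RegGraph N d)], 16 ≤ rowVar N d →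
      |N * rowVar N d * ∫ s : Sample N d, ∑ i, ∑ j, centered d s.adj i j * testEntry ν cs n i j s
          ∂sampleLaw N d ν -
        ∫ s : Sample N d, ∑ i, ∑ j, (∑ k, ∑ l, (altCycle s.adj i j k l - altCycle s.adj i l k j)) *
          testEntry ν cs n i j s ∂sampleLaw N d ν| ≤ C * (N ^ 2 * rowVar N d) := by
  obtain ⟨C, hC0, hC⟩ := exists_integral_sum_testEntry_sq_le hν cs n
  refine ⟨2 * ((2 ^ 14 * (1 : ℕ)) ^ 1 + C) + ((2 ^ 14 * (3 : ℕ)) ^ 3 + C) + 12 * (1 + C),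
    by positivity, fun N d _ hσ => ?_⟩
  obtain ⟨hρ1, hρ2, hσd, hdN, hρN⟩ := rowVar_le_natCast hσ
  set ρ := √(rowVar N d) with hρ
  have hρ0 : 0 < ρ := by linarith
  have hN0 : (0 : ℝ) ≤ N := Nat.cast_nonneg _
  have hd0 : (0 : ℝ) ≤ d := Nat.cast_nonneg _
  have tF := fun i j : Fin N => tame_testEntry (d := d) hν.tame cs n i j
  have tY := tame_centered (N := N) (d := d) (ν := ν)
  have tc : ∀ i j k l, Tame (fun s : Sample N d => altCycle s.adj i j k l) (sampleLaw N d ν) :=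
    fun i j k l => tame_altWeight (i, j, k, l)
  have tD : ∀ i j, Tame (fun s : Sample N d => (∑ k, ∑ l, (altCycle s.adj i j k l -
      altCycle s.adj i l k j)) * testEntry ν cs n i j s) (sampleLaw N d ν) := fun i j =>
    (Tame.sum _ fun k => Tame.sum _ fun l => (tc i j k l).sub (tc i l k j)).mul (tF i j)
  have tDs := Tame.sum (μ := sampleLaw N d ν) Finset.univ fun i => Tame.sum Finset.univ (tD i)
  have tYF := Tame.sum (μ := sampleLaw N d ν) Finset.univ fun i => Tame.sum Finset.univ
    fun j => (tY i j).mul (tF i j)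
  have tFF := Tame.sum (μ := sampleLaw N d ν) Finset.univ fun i => Tame.sum Finset.univ
    fun j => (tF i j).pow 2
  have t2 := Tame.trace_matrix_pow tY (2 * 1)
  have t6 := Tame.trace_matrix_pow tY (2 * 3)
  have hF := hC N d hσ
  have h2 := integral_trace_centered_pow_le (N := N) (d := d) (ν := ν) (n := 1) le_rfl hσ
  have h6 := integral_trace_centered_pow_le (N := N) (d := d) (ν := ν) (n := 3) (by omega) hσ
  rw [← hρ2] at h2 h6
  have i1 := ((Tame.const (2 * d : ℝ)).mul (((Tame.const ρ⁻¹).mul t2).add ((Tame.const ρ).mul tFF)))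
  have i2 := (((Tame.const (ρ ^ 3)⁻¹).mul t6).add ((Tame.const (ρ ^ 3)).mul tFF))
  have i3 := ((Tame.const (6 * rowVar N d)).mul ((Tame.const (2 * (N : ℝ) ^ 2)).add
    ((Tame.const (2 * (N : ℝ))).mul tFF)))
  rw [← integral_const_mul, ← integral_sub ((Tame.const _).mul tYF).integrable tDs.integrable]
  refine abs_integral_le_integral_abs.trans ((integral_mono
    (((Tame.const _).mul tYF).sub tDs).abs.integrable ((i1.add i2).add i3).integrable
    fun s => s.isRegularAdj.abs_sum_centered_mul_sub_le (by linarith) hρ0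
      fun i j => testEntry ν cs n i j s).trans ?_)
  rw [integral_add (i1.add i2).integrable i3.integrable, integral_add i1.integrable i2.integrable,
    integral_const_mul, integral_add ((Tame.const _).mul t2).integrable
      ((Tame.const _).mul tFF).integrable, integral_const_mul, integral_const_mul,
    integral_add ((Tame.const _).mul t6).integrable ((Tame.const _).mul tFF).integrable,
    integral_const_mul, integral_const_mul, integral_const_mul, integral_add (integrable_const _)
      ((Tame.const _).mul tFF).integrable, integral_const_mul (2 * (N : ℝ))]
  simp only [integral_const, probReal_univ, one_smul]
  set A2 : ℝ := (2 ^ 14 * (1 : ℕ)) ^ 1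
  set A6 : ℝ := (2 ^ 14 * (3 : ℕ)) ^ 3
  have hA2 : 0 ≤ A2 := by positivity
  have hA6 : 0 ≤ A6 := by positivity
  set FF := ∫ s : Sample N d, ∑ i, ∑ j, testEntry ν cs n i j s ^ 2 ∂sampleLaw N d ν
  calc _ ≤ 2 * d * (ρ⁻¹ * (A2 * (N * (ρ ^ 2) ^ 1)) + ρ * (C * N)) +
        ((ρ ^ 3)⁻¹ * (A6 * (N * (ρ ^ 2) ^ 3)) + ρ ^ 3 * (C * N)) +
        6 * rowVar N d * (2 * N ^ 2 + 2 * N * (C * N)) := by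
        have : 0 ≤ rowVar N d := by linarith
        gcongr
    _ = 2 * (A2 + C) * (d * N * ρ) + (A6 + C) * (N * ρ * ρ ^ 2) +
        12 * (1 + C) * (N ^ 2 * ρ ^ 2) := by
        rw [← hρ2]; field_simp; ring
    _ ≤ 2 * (A2 + C) * (N * N * ρ ^ 2) + (A6 + C) * (N * N * ρ ^ 2) +
        12 * (1 + C) * (N ^ 2 * ρ ^ 2) := by
        have : ρ ≤ ρ ^ 2 := by nlinarith
        gcongr
    _ = _ := by rw [hρ2]; ring

/-- The number of alternating cycles at a vertex is almost constant: the defect is O(Nσ) + 2(Y⁴)_ii,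
the square of (Y⁴)_ii is at most (Y⁸)_ii, and tr Y⁸ is O(Nσ⁴) on average. -/
theorem exists_abs_integral_altCycle_sub_le (hν : AdmissibleWeightLaw ν) (cs : ℕ → ℝ) (a : ℕ) :
    ∃ C : ℝ, 0 ≤ C ∧ ∀ (N d : ℕ) [Nonempty (RegGraph N d)], 16 ≤ rowVar N d →
      |∫ s : Sample N d, ∑ i, (∑ j, ∑ k, ∑ l, altCycle s.adj i j k l) * deviation ν cs a i s
          ∂sampleLaw N d ν -
        N * rowVar N d ^ 2 * ∫ s : Sample N d, ∑ i, deviation ν cs a i s ∂sampleLaw N d ν| ≤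
      C * (N ^ 2 * rowVar N d) := by
  obtain ⟨C, hC0, hC⟩ := exists_fluctuation_le hν cs a
  refine ⟨5 * (1 + C) + 2 * ((2 ^ 14 * (4 : ℕ)) ^ 4 + C), by positivity, fun N d _ hσ => ?_⟩
  obtain ⟨hρ1, hρ2, hσd, hdN, hρN⟩ := rowVar_le_natCast hσ
  have hN0 : (0 : ℝ) ≤ N := Nat.cast_nonneg _
  set σ := rowVar N d with hσdef
  have hσ0 : 0 < σ := by linarith
  have tG := fun i : Fin N => tame_deviation (d := d) hν.tame cs a i
  have tc : ∀ i j k l, Tame (fun s : Sample N d => altCycle s.adj i j k l) (sampleLaw N d ν) :=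
    fun i j k l => tame_altWeight (i, j, k, l)
  have t8 := Tame.trace_matrix_pow (tame_centered (N := N) (d := d) (ν := ν)) (2 * 4)
  have t1 := Tame.sum (μ := sampleLaw N d ν) Finset.univ fun i =>
    (Tame.sum Finset.univ fun j => Tame.sum Finset.univ fun k => Tame.sum Finset.univ fun l =>
      tc i j k l).mul (tG i)
  have t2 := Tame.sum (μ := sampleLaw N d ν) Finset.univ tG
  have t3 := Tame.sum (μ := sampleLaw N d ν) Finset.univ fun i => (tG i).pow 2
  have h8 := integral_trace_centered_pow_le (N := N) (d := d) (ν := ν) (n := 4) (by omega) hσ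
  have hfl := hC N d hσ
  have i1 := (Tame.const (5 * (N * σ))).mul ((Tame.const (N : ℝ)).add t3)
  have i2 := (Tame.const (2 : ℝ)).mul (((Tame.const (σ ^ 2)⁻¹).mul t8).add
    ((Tame.const (σ ^ 2)).mul t3))
  rw [← integral_const_mul, ← integral_sub t1.integrable ((Tame.const _).mul t2).integrable]
  refine abs_integral_le_integral_abs.trans ((integral_mono
    (t1.sub ((Tame.const _).mul t2)).abs.integrable (i1.add i2).integrable fun s => ?_).trans ?_)
  · have hreg := s.isRegularAdj
    have hs := hreg.centered_isSymm
    have e1 : (N : ℝ) = ∑ _i : Fin N, 1 := by simp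
    simp only
    rw [Matrix.trace, Finset.mul_sum, ← Finset.sum_sub_distrib]
    refine (Finset.abs_sum_le_sum_abs _ _).trans ?_
    have e2 : 5 * (N * σ) * (N + ∑ i, deviation ν cs a i s ^ 2) +
        2 * ((σ ^ 2)⁻¹ * ∑ i, (centered d s.adj ^ (2 * 4)).diag i +
          σ ^ 2 * ∑ i, deviation ν cs a i s ^ 2) =
        ∑ i, (5 * (N * σ) * (1 + deviation ν cs a i s ^ 2) +
          2 * ((σ ^ 2)⁻¹ * (centered d s.adj ^ (2 * 4)).diag i +
            σ ^ 2 * deviation ν cs a i s ^ 2)) := by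
      simp only [Finset.sum_add_distrib, ← Finset.mul_sum]
      simp
    rw [e2]
    refine Finset.sum_le_sum fun i _ => ?_
    have hD := hreg.abs_sum_altCycle_sub_rowVar_sq_le (by linarith) i
    rw [← sub_mul, abs_mul]
    refine (mul_le_mul_of_nonneg_right hD (abs_nonneg _)).trans ?_
    have q1 := sq_pow_apply_le hs 4 i
    set g := deviation ν cs a i s
    set y := (centered d s.adj ^ 4) i i
    have q2 : |g| ≤ 1 + g ^ 2 := by
      rw [← sq_abs g]; nlinarith [sq_nonneg (|g| - 1)]
    have q3 := mul_le_mul_sq_add_inv_mul_sq (a := |g|) (b := y) (pow_pos hσ0 2)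
    rw [sq_abs] at q3
    have q4 := mul_le_mul_of_nonneg_left q1 (by positivity : 0 ≤ (σ ^ 2)⁻¹)
    have q5 := mul_le_mul_of_nonneg_left q2 (by positivity : 0 ≤ 5 * (N * σ))
    simp only [Matrix.diag]
    rw [add_mul]
    linarith
  · rw [integral_add i1.integrable i2.integrable, integral_const_mul,
      integral_add (integrable_const _) t3.integrable, integral_const_mul,
      integral_add ((Tame.const _).mul t8).integrable ((Tame.const _).mul t3).integrable,
      integral_const_mul, integral_const_mul]
    simp only [integral_const, probReal_univ, one_smul]
    rw [show ∫ s : Sample N d, ∑ i, deviation ν cs a i s ^ 2 ∂sampleLaw N d ν =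
      fluctuation N d ν cs a from rfl]
    set A8 : ℝ := (2 ^ 14 * (4 : ℕ)) ^ 4
    have hA8 : 0 ≤ A8 := by positivity
    calc _ ≤ 5 * (N * σ) * (N + C * N) + 2 * ((σ ^ 2)⁻¹ * (A8 * (N * σ ^ 4)) + σ ^ 2 * (C * N)) := by
          gcongr
      _ = 5 * (1 + C) * (N ^ 2 * σ) + 2 * (A8 + C) * (N * σ * σ) := by field_simp
      _ ≤ 5 * (1 + C) * (N ^ 2 * σ) + 2 * (A8 + C) * (N * N * σ) := by
          have : σ ≤ N := hσd.trans hdN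
          gcongr
      _ = _ := by ring

set_option maxHeartbeats 1000000 in
/-- The contribution of the graph to the recursion for the moments. -/
theorem exists_abs_integral_centered_mul_testEntry_sub_le
    (hν : AdmissibleWeightLaw ν) (cs : ℕ → ℝ) (n : ℕ) :
    ∃ C : ℝ, 0 ≤ C ∧ ∀ (N d : ℕ) [Nonempty (RegGraph N d)], 16 ≤ rowVar N d → ∀ δ : ℝ, 0 < δ →
      |(√(scaleSq N d ν))⁻¹ * ((∫ x, x ∂ν) * ∫ s : Sample N d, ∑ i, ∑ j, centered d s.adj i j *
          testEntry ν cs n i j s ∂sampleLaw N d ν) -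
        (√(scaleSq N d ν))⁻¹ ^ 2 * ((∫ x, x ∂ν) ^ 2 * rowVar N d) *
          ((∑ a ∈ Finset.range (n + 1), cs a * cs (n - a)) *
            ∫ s : Sample N d, ∑ i, deviation ν cs (n + 2) i s ∂sampleLaw N d ν)| ≤
      C * (N * ((√(rowVar N d))⁻¹ + δ) +
        δ⁻¹ * ∑ a ∈ Finset.range (n + 1), fluctuation N d ν cs a) := by
  have hx := hν.tame
  set m := ∫ x, x ∂ν with hm
  set S := ∑ a ∈ Finset.range (n + 1), cs a * cs (n - a)
  obtain ⟨c, hc0, hc⟩ := exists_scale_bounds hν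
  have hD : 0 ≤ 2 ^ 7 * (1 + 4 ^ 8 * ∫ x, |x| ^ 8 ∂ν) := by
    have : 0 ≤ ∫ x, |x| ^ 8 ∂ν := integral_nonneg fun x => by positivity
    positivity
  obtain ⟨C₁, hC₁0, hC₁⟩ := Exchange.exists_abs_average_sub_le hν (Fin 4) (Fin 4 × Bool) cs n hD
  obtain ⟨C₂, hC₂0, hC₂⟩ := exists_abs_integral_centered_sub_le hν cs n
  obtain ⟨C₃, hC₃0, hC₃⟩ := exists_abs_integral_altCycle_sub_le hν cs (n + 2)
  refine ⟨|m| * (C₂ * c + C₁ * (4 * c * (1 + c) + 2 * c + 4 * c) + |S| * |m| * C₃ * c),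
    by positivity, ?_⟩
  intro N d _ hσ δ hδ
  obtain ⟨hτ, hc1, -, hc3, -⟩ := hc N d hσ
  obtain ⟨hρ1, hρ2, hσd, hdN, hρN⟩ := rowVar_le_natCast hσ
  have hE := switchExchange_isAdmissible (N := N) (d := d) hx
  -- The value ρ = √σ balances the vertex rate 4Nσ² divided by ρ against the pair rate 2Nσ
  -- multiplied by ρ.
  have h1 := hC₁ N d hσ _ (switchExchange N d ν) _ _ hE (fun _ _ => 1) (fun q => Tame.const _)
    (fun q s => by rw [abs_one]; exact hE.one_le_size q s) δ (√(rowVar N d)) hδ (by linarith)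
  have h2 := hC₂ N d hσ
  have h3 := hC₃ N d hσ
  have h4 := switchExchange_average_main (N := N) (d := d) hx cs (n + 2)
  rw [integral_sum_centered_mul_testEntry hx] at h2
  set I := (switchExchange N d ν).average ν (fun q s => 1 *
        (testEntry ν cs n q.1 q.2.1 ((switchExchange N d ν).move q s) -
          testEntry ν cs n q.1 q.2.1 s)) with hI
  set J := ∫ s : Sample N d, ∑ i, ∑ j, centered d s.adj i j * testEntry ν cs n i j s
    ∂sampleLaw N d ν
  set T := ∫ s : Sample N d, ∑ i, deviation ν cs (n + 2) i s ∂sampleLaw N d ν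
  set T' := ∫ s : Sample N d, ∑ i, (∑ j, ∑ k, ∑ l, altCycle s.adj i j k l) *
    deviation ν cs (n + 2) i s ∂sampleLaw N d ν
  set F := ∑ a ∈ Finset.range (n + 1), fluctuation N d ν cs a with hF
  have hF0 : 0 ≤ F := Finset.sum_nonneg fun a _ => integral_nonneg fun s =>
    Finset.sum_nonneg fun i _ => sq_nonneg _
  set ρ := √(rowVar N d) with hρ
  set θ := (√(scaleSq N d ν))⁻¹ with hθ
  have hθ0 : 0 ≤ θ := by positivity
  have h1' : |I - S * ((switchExchange N d ν).average ν (fun q s => 1 *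
      (switchExchange N d ν).coef q (0, true) s * deviation ν cs (n + 2) q.1 s))| ≤
      C₁ * θ * (4 * (N * rowVar N d ^ 2) * N * (ρ⁻¹ + θ + δ) + ρ * (2 * (N * rowVar N d) * N) +
        δ⁻¹ * (4 * (N * rowVar N d ^ 2) * F)) := h1
  rw [h4] at h1'
  rw [← hρ2] at h1' h2 h3 hc3 ⊢
  have hρ0 : 0 < ρ := by linarith
  have hN : (0 : ℝ) < N := by linarith
  have hρi : 0 ≤ ρ⁻¹ := by positivity
  have hρi1 : ρ⁻¹ ≤ 1 := inv_le_one_of_one_le₀ hρ1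
  have hδi : 0 ≤ δ⁻¹ := by positivity
  -- Three errors: NσY replaced by the switching kernel, the first-order expansion, and the cycle
  -- count replaced by Nσ².
  have e : θ * (m * J) - θ ^ 2 * (m ^ 2 * ρ ^ 2) * (S * T) = θ * m / (N * ρ ^ 2) *
      ((N * ρ ^ 2 * J - I) + (I - S * (θ * (m * T'))) +
        S * θ * m * (T' - N * (ρ ^ 2) ^ 2 * T)) := by
    field_simp
    ring
  have h5 : |(N * ρ ^ 2 * J - I) + (I - S * (θ * (m * T'))) +
        S * θ * m * (T' - N * (ρ ^ 2) ^ 2 * T)| ≤ C₂ * (N ^ 2 * ρ ^ 2) +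
      C₁ * θ * (4 * (N * (ρ ^ 2) ^ 2) * N * (ρ⁻¹ + θ + δ) + ρ * (2 * (N * ρ ^ 2) * N) +
        δ⁻¹ * (4 * (N * (ρ ^ 2) ^ 2) * F)) + |S| * θ * |m| * (C₃ * (N ^ 2 * ρ ^ 2)) := by
    refine (abs_add_three _ _ _).trans (add_le_add (add_le_add h2 h1') ?_)
    rw [abs_mul, abs_mul, abs_mul, abs_of_nonneg hθ0]
    exact mul_le_mul_of_nonneg_left h3 (by positivity)
  rw [e, abs_mul, abs_div, abs_mul, abs_of_nonneg hθ0, abs_of_pos (by positivity : 0 < N * ρ ^ 2)]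
  have hθ2 : θ ^ 2 ≤ c * ρ⁻¹ := by
    calc θ ^ 2 ≤ θ ^ 2 * ρ ^ 2 * ρ⁻¹ := by
          have : θ ^ 2 * ρ ^ 2 * ρ⁻¹ = θ ^ 2 * ρ := by field_simp
          rw [this]; exact le_mul_of_one_le_right (sq_nonneg θ) hρ1
      _ ≤ _ := mul_le_mul_of_nonneg_right hc3 hρi
  have hθ3 : θ ^ 2 * ρ ≤ c * ρ⁻¹ := by
    calc θ ^ 2 * ρ = θ ^ 2 * ρ ^ 2 * ρ⁻¹ := by field_simp
      _ ≤ _ := mul_le_mul_of_nonneg_right hc3 hρi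
  set X := N * (ρ⁻¹ + δ) + δ⁻¹ * F with hX
  have x1 : N * ρ⁻¹ ≤ X := by
    have : 0 ≤ N * δ + δ⁻¹ * F := by positivity
    rw [hX]; linarith
  have x2 : N * (ρ⁻¹ + δ) ≤ X := by
    have : 0 ≤ δ⁻¹ * F := by positivity
    rw [hX]; linarith
  have x3 : δ⁻¹ * F ≤ X := by
    have : 0 ≤ N * (ρ⁻¹ + δ) := by positivity
    rw [hX]; linarith
  have g0 : N * (ρ⁻¹ + θ + δ) ≤ (1 + c) * X := by
    have := mul_le_mul_of_nonneg_left hc1 hN.le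
    have := mul_le_mul_of_nonneg_left x1 hc0
    linarith
  have g1 : N * θ ≤ c * X := by
    have := mul_le_mul_of_nonneg_left hc1 hN.le
    have := mul_le_mul_of_nonneg_left x1 hc0
    linarith
  have g2 : θ ^ 2 * ρ ^ 2 * (N * (ρ⁻¹ + θ + δ)) ≤ c * ((1 + c) * X) :=
    mul_le_mul hc3 g0 (by positivity) hc0
  have g3 : θ ^ 2 * ρ * N ≤ c * X := by
    have := mul_le_mul_of_nonneg_right hθ3 hN.le
    have := mul_le_mul_of_nonneg_left x1 hc0
    linarith
  have g4 : θ ^ 2 * ρ ^ 2 * (δ⁻¹ * F) ≤ c * X := mul_le_mul hc3 x3 (by positivity) hc0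
  have g5 : θ ^ 2 * N ≤ c * X := by
    have := mul_le_mul_of_nonneg_right hθ2 hN.le
    have := mul_le_mul_of_nonneg_left x1 hc0
    linarith
  calc _ ≤ θ * |m| / (N * ρ ^ 2) * _ := mul_le_mul_of_nonneg_left h5 (by positivity)
    _ = |m| * (C₂ * (N * θ) + C₁ * (4 * (θ ^ 2 * ρ ^ 2 * (N * (ρ⁻¹ + θ + δ))) +
        2 * (θ ^ 2 * ρ * N) + 4 * (θ ^ 2 * ρ ^ 2 * (δ⁻¹ * F))) +
        |S| * |m| * C₃ * (θ ^ 2 * N)) := by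
        field_simp
    _ ≤ |m| * (C₂ * (c * X) + C₁ * (4 * (c * ((1 + c) * X)) + 2 * (c * X) + 4 * (c * X)) +
        |S| * |m| * C₃ * (c * X)) := by gcongr
    _ = _ := by ring

/-! ### The recursion for the fluctuations and its limit. -/

variable {ν : Measure ℝ} [IsProbabilityMeasure ν]

/-- The absolute entries sum to O(N) and each is bounded; the factor θ multiplying this term then
makes it negligible. -/
theorem exists_abs_integral_centeringError_le (hν : AdmissibleWeightLaw ν) (cs : ℕ → ℝ) (n : ℕ)
    (m : ℝ) :
    ∃ C : ℝ, 0 ≤ C ∧ ∀ (N d : ℕ) [Nonempty (RegGraph N d)], 16 ≤ rowVar N d →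
      |∫ s : Sample N d, ∑ i, ∑ j, centeringError N d m i j * testEntry ν cs n i j s
          ∂sampleLaw N d ν| ≤ C * N := by
  obtain ⟨C, hC0, hC⟩ := exists_integral_sum_testEntry_sq_le hν cs n
  refine ⟨|m| * (2 + 2 * C), by positivity, fun N d _ hσ => ?_⟩
  obtain ⟨hN, -, -⟩ := mem_bounds_of_rowVar (d := d) hσ
  obtain ⟨hρ1, hρ2, hσd, hdN, hρN⟩ := rowVar_le_natCast hσ
  have hN16 : (16 : ℝ) ≤ N := hσ.trans (hσd.trans hdN)
  have hN2 : 2 ≤ N := by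
    have : (2 : ℝ) ≤ N := by linarith
    exact_mod_cast this
  have tF := fun i j : Fin N => tame_testEntry (d := d) hν.tame cs n i j
  have tFF := Tame.sum (μ := sampleLaw N d ν) Finset.univ fun i => Tame.sum Finset.univ
    fun j => (tF i j).pow 2
  have tE := Tame.sum (μ := sampleLaw N d ν) Finset.univ fun i => Tame.sum Finset.univ
    fun j => (Tame.const (centeringError N d m i j)).mul (tF i j)
  refine abs_integral_le_integral_abs.trans ((integral_mono (g := fun s : Sample N d =>
    |m| * (2 * N + 2 * ∑ i, ∑ j, testEntry ν cs n i j s ^ 2)) tE.abs.integrable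
    ((Tame.const _).mul ((Tame.const _).add ((Tame.const _).mul tFF))).integrable
    fun s => ?_).trans ?_)
  · have e0 : ∑ i : Fin N, ∑ j : Fin N, (1 / (N : ℝ) + if i = j then 1 else 0) = 2 * N := by
      simp only [Finset.sum_add_distrib, Finset.sum_ite_eq, Finset.mem_univ, if_true,
        Finset.sum_const, Finset.card_univ, Fintype.card_fin, nsmul_eq_mul]
      field_simp
      ring
    have e1 : |m| * (2 * N + 2 * ∑ i, ∑ j, testEntry ν cs n i j s ^ 2) =
        ∑ i, ∑ j, |m| * ((1 / (N : ℝ) + if i = j then 1 else 0) +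
          2 * testEntry ν cs n i j s ^ 2) := by
      rw [← e0]
      simp only [← Finset.mul_sum, Finset.sum_add_distrib]
    simp only
    rw [e1]
    refine (Finset.abs_sum_le_sum_abs _ _).trans (Finset.sum_le_sum fun i _ =>
      (Finset.abs_sum_le_sum_abs _ _).trans (Finset.sum_le_sum fun j _ => ?_))
    have h1 := abs_centeringError_le (d := d) hN2 m i j
    set w : ℝ := 1 / (N : ℝ) + if i = j then 1 else 0 with hw
    have hNi : 1 / (N : ℝ) ≤ 1 := by rw [div_le_one (by linarith)]; linarith
    have hNi0 : 0 ≤ 1 / (N : ℝ) := by positivity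
    have hw0 : 0 ≤ w := by rw [hw]; split_ifs <;> linarith
    have hw1 : w ≤ 2 := by rw [hw]; split_ifs <;> linarith
    set f := testEntry ν cs n i j s
    have q : |f| ≤ 1 + f ^ 2 := by
      rw [← sq_abs f]; nlinarith [sq_nonneg (|f| - 1)]
    rw [abs_mul]
    calc _ ≤ |m| * w * (1 + f ^ 2) := mul_le_mul h1 q (abs_nonneg _) (by positivity)
      _ = |m| * (w + w * f ^ 2) := by ring
      _ ≤ _ := by gcongr
  · rw [integral_const_mul, integral_add (integrable_const _)
      ((Tame.const _).mul tFF).integrable, integral_const_mul (2 : ℝ) (fun s : Sample N d =>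
        ∑ i, ∑ j, testEntry ν cs n i j s ^ 2)]
    simp only [integral_const, probReal_univ, one_smul]
    rw [mul_assoc]
    refine mul_le_mul_of_nonneg_left ?_ (abs_nonneg _)
    linarith [hC N d hσ]

omit [IsProbabilityMeasure ν] in
-- One factor of the square is written as a row of M times a column of M^{n+1}, and the explicit
-- entry of M is split into its three parts, ready for integration by parts.
theorem sum_deviation_sq_eq {N d : ℕ} (cs : ℕ → ℝ) (n : ℕ) (s : Sample N d) :
    ∑ i, deviation ν cs (n + 2) i s ^ 2 = (√(scaleSq N d ν))⁻¹ *
      (∑ i, ∑ j, noise (∫ x, x ∂ν) s i j * testEntry ν cs n i j s +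
        (∫ x, x ∂ν) * ∑ i, ∑ j, centered d s.adj i j * testEntry ν cs n i j s +
        ∑ i, ∑ j, centeringError N d (∫ x, x ∂ν) i j * testEntry ν cs n i j s) -
      cs (n + 2) * ∑ i, deviation ν cs (n + 2) i s := by
  simp only [Finset.mul_sum, ← Finset.sum_add_distrib, ← Finset.sum_sub_distrib]
  refine Finset.sum_congr rfl fun i _ => ?_
  have hM := standardized_isSymm ν s
  have e : (s.std ν ^ (n + 2)) i i = ∑ j, s.std ν i j * (s.std ν ^ (n + 1)) i j := by
    rw [show n + 2 = (n + 1) + 1 from rfl, pow_succ' (s.std ν) (n + 1), Matrix.mul_apply]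
    exact Finset.sum_congr rfl fun j _ => by rw [(isSymm_pow hM (n + 1)).apply i j]
  have e2 : ∀ i j, s.std ν i j = (√(scaleSq N d ν))⁻¹ * (noise (∫ x, x ∂ν) s i j +
      (∫ x, x ∂ν) * centered d s.adj i j + centeringError N d (∫ x, x ∂ν) i j) := fun i j => by
    rw [Sample.std, standardized_eq]; simp [Matrix.smul_apply, Matrix.add_apply]
  have e3 : deviation ν cs (n + 2) i s ^ 2 =
      (∑ j, s.std ν i j * (s.std ν ^ (n + 1)) i j) * deviation ν cs (n + 2) i s -
      cs (n + 2) * deviation ν cs (n + 2) i s := by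
    rw [← e, ← sub_mul, sq]; rfl
  rw [e3, Finset.sum_mul]
  congr 1
  refine Finset.sum_congr rfl fun j _ => ?_
  rw [e2]
  simp only [testEntry]
  ring

/-- The recursive bound for the fluctuations of the diagonal entries. -/
theorem exists_fluctuation_le_of_recursion (hν : AdmissibleWeightLaw ν) (cs : ℕ → ℝ) (n : ℕ)
    (hcs : cs (n + 2) = ∑ a ∈ Finset.range (n + 1), cs a * cs (n - a)) :
    ∃ C : ℝ, 0 ≤ C ∧ ∀ (N d : ℕ) [Nonempty (RegGraph N d)], 16 ≤ rowVar N d → ∀ δ : ℝ, 0 < δ →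
      fluctuation N d ν cs (n + 2) ≤ C * (N * ((√(rowVar N d))⁻¹ + δ) +
        δ⁻¹ * ∑ a ∈ Finset.range (n + 1), fluctuation N d ν cs a) := by
  have hx := hν.tame
  obtain ⟨c, hc0, hc⟩ := exists_scale_bounds hν
  obtain ⟨C₁, hC₁0, hC₁⟩ := exists_abs_integral_noise_mul_testEntry_sub_le hν cs n
  obtain ⟨C₂, hC₂0, hC₂⟩ := exists_abs_integral_centered_mul_testEntry_sub_le hν cs n
  obtain ⟨C₃, hC₃0, hC₃⟩ := exists_abs_integral_centeringError_le hν cs n (∫ x, x ∂ν)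
  obtain ⟨C₄, hC₄0, hC₄⟩ := exists_fluctuation_le hν cs (n + 2)
  refine ⟨C₁ + C₂ + c * C₃ + c * |cs (n + 2)| * (1 + C₄), by positivity, ?_⟩
  intro N d _ hσ δ hδ
  obtain ⟨hτ, hc1, -, -, hc4⟩ := hc N d hσ
  have h1 := hC₁ N d hσ δ hδ
  have h2 := hC₂ N d hσ δ hδ
  have h3 := hC₃ N d hσ
  have h4 := hC₄ N d hσ
  rw [← hcs] at h1 h2
  have tF := fun i j : Fin N => tame_testEntry (d := d) hx cs n i j
  have tG := fun i : Fin N => tame_deviation (d := d) hx cs (n + 2) i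
  have tGs := Tame.sum (μ := sampleLaw N d ν) Finset.univ tG
  have tG2 := Tame.sum (μ := sampleLaw N d ν) Finset.univ fun i => (tG i).pow 2
  have tZ := Tame.sum (μ := sampleLaw N d ν) Finset.univ fun i => Tame.sum Finset.univ
    fun j => (tame_noise hx (∫ x, x ∂ν) i j).mul (tF i j)
  have tY := Tame.sum (μ := sampleLaw N d ν) Finset.univ fun i => Tame.sum Finset.univ
    fun j => (tame_centered i j).mul (tF i j)
  have tE := Tame.sum (μ := sampleLaw N d ν) Finset.univ fun i => Tame.sum Finset.univ
    fun j => (Tame.const (centeringError N d (∫ x, x ∂ν) i j)).mul (tF i j)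
  have h0 : fluctuation N d ν cs (n + 2) = (√(scaleSq N d ν))⁻¹ *
      (∫ s : Sample N d, ∑ i, ∑ j, noise (∫ x, x ∂ν) s i j * testEntry ν cs n i j s
          ∂sampleLaw N d ν +
        (∫ x, x ∂ν) * ∫ s : Sample N d, ∑ i, ∑ j, centered d s.adj i j * testEntry ν cs n i j s
          ∂sampleLaw N d ν +
        ∫ s : Sample N d, ∑ i, ∑ j, centeringError N d (∫ x, x ∂ν) i j * testEntry ν cs n i j s
          ∂sampleLaw N d ν) -
      cs (n + 2) * ∫ s : Sample N d, ∑ i, deviation ν cs (n + 2) i s ∂sampleLaw N d ν := by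
    rw [fluctuation, integral_congr_ae (ae_of_all _ fun s => sum_deviation_sq_eq cs n s),
      integral_sub ((Tame.const _).mul ((tZ.add ((Tame.const _).mul tY)).add tE)).integrable
        ((Tame.const _).mul tGs).integrable, integral_const_mul, integral_const_mul,
      integral_add (tZ.add ((Tame.const _).mul tY)).integrable tE.integrable,
      integral_add tZ.integrable ((Tame.const _).mul tY).integrable, integral_const_mul]
  have hT : |∫ s : Sample N d, ∑ i, deviation ν cs (n + 2) i s ∂sampleLaw N d ν| ≤
      (1 + C₄) * N := by
    refine abs_integral_le_integral_abs.trans ((integral_mono (g := fun s : Sample N d =>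
      N + ∑ i, deviation ν cs (n + 2) i s ^ 2) tGs.abs.integrable
      ((Tame.const _).add tG2).integrable fun s => ?_).trans ?_)
    · have e1 : (N : ℝ) = ∑ _i : Fin N, 1 := by simp
      simp only
      rw [e1, ← Finset.sum_add_distrib]
      refine (Finset.abs_sum_le_sum_abs _ _).trans (Finset.sum_le_sum fun i _ => ?_)
      rw [← sq_abs (deviation ν cs (n + 2) i s)]
      nlinarith [sq_nonneg (|deviation ν cs (n + 2) i s| - 1)]
    · rw [integral_add (integrable_const _) tG2.integrable]
      simp only [integral_const, probReal_univ, one_smul]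
      rw [fluctuation] at h4
      linarith
  set Z := ∫ s : Sample N d, ∑ i, ∑ j, noise (∫ x, x ∂ν) s i j * testEntry ν cs n i j s
    ∂sampleLaw N d ν
  set Y := ∫ s : Sample N d, ∑ i, ∑ j, centered d s.adj i j * testEntry ν cs n i j s
    ∂sampleLaw N d ν
  set R := ∫ s : Sample N d, ∑ i, ∑ j, centeringError N d (∫ x, x ∂ν) i j * testEntry ν cs n i j s
    ∂sampleLaw N d ν
  set T := ∫ s : Sample N d, ∑ i, deviation ν cs (n + 2) i s ∂sampleLaw N d ν
  set θ := (√(scaleSq N d ν))⁻¹ with hθ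
  set ρ := √(rowVar N d) with hρ
  set m := ∫ x, x ∂ν
  set v := ∫ x, x ^ 2 ∂ν - m ^ 2
  set F := ∑ a ∈ Finset.range (n + 1), fluctuation N d ν cs a with hF
  have hF0 : 0 ≤ F := Finset.sum_nonneg fun a _ => integral_nonneg fun s =>
    Finset.sum_nonneg fun i _ => sq_nonneg _
  have hθ0 : 0 ≤ θ := by positivity
  set X := N * (ρ⁻¹ + δ) + δ⁻¹ * F with hX
  have x1 : N * ρ⁻¹ ≤ X := by
    have : 0 ≤ N * δ + δ⁻¹ * F := by positivity
    rw [hX]; linarith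
  -- By `hcs` the two main terms have the coefficient c_{n+2}; against the subtracted c_{n+2}T they
  -- leave only the factor θ²(dv + m²σ) − 1, which is small.
  have e : fluctuation N d ν cs (n + 2) =
      (θ * Z - θ ^ 2 * (d * v) * (cs (n + 2) * T)) +
      (θ * (m * Y) - θ ^ 2 * (m ^ 2 * rowVar N d) * (cs (n + 2) * T)) + θ * R +
      (θ ^ 2 * (d * v + m ^ 2 * rowVar N d) - 1) * (cs (n + 2) * T) := by rw [h0]; ring
  have b3 : θ * R ≤ c * C₃ * X := by
    calc θ * R ≤ θ * (C₃ * N) := mul_le_mul_of_nonneg_left ((le_abs_self _).trans h3) hθ0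
      _ ≤ c * ρ⁻¹ * (C₃ * N) := mul_le_mul_of_nonneg_right hc1 (by positivity)
      _ = c * C₃ * (N * ρ⁻¹) := by ring
      _ ≤ _ := mul_le_mul_of_nonneg_left x1 (by positivity)
  have b4 : (θ ^ 2 * (d * v + m ^ 2 * rowVar N d) - 1) * (cs (n + 2) * T) ≤
      c * |cs (n + 2)| * (1 + C₄) * X := by
    refine (le_abs_self _).trans ?_
    rw [abs_mul, abs_mul]
    calc _ ≤ c * ρ⁻¹ * (|cs (n + 2)| * ((1 + C₄) * N)) :=
          mul_le_mul hc4 (mul_le_mul_of_nonneg_left hT (abs_nonneg _)) (by positivity)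
            (by positivity)
      _ = c * |cs (n + 2)| * (1 + C₄) * (N * ρ⁻¹) := by ring
      _ ≤ _ := mul_le_mul_of_nonneg_left x1 (by positivity)
  have b1 := (le_abs_self _).trans h1
  have b2 := (le_abs_self _).trans h2
  rw [e]
  linarith

/-- σ is at least min(d, N − d)/2. -/
theorem tendsto_rowVar_atTop {d : ℕ → ℕ} (hd : Tendsto (fun N => (d N : ℝ)) atTop atTop)
    (hNd : Tendsto (fun N : ℕ => (N : ℝ) - (d N : ℝ)) atTop atTop) :
    Tendsto (fun N => rowVar N (d N)) atTop atTop := by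
  rw [tendsto_atTop]
  intro K
  filter_upwards [hd.eventually_ge_atTop (2 * |K| + 1), hNd.eventually_ge_atTop (2 * |K| + 1)]
    with N h1 h2
  have hK := abs_nonneg K
  refine (le_abs_self K).trans ?_
  rw [rowVar, le_div_iff₀ (by linarith)]
  rcases le_total (d N : ℝ) (N - d N) with h | h <;> nlinarith

-- Both the weighted adjacency matrix and `offDiagOnes` have zero diagonal.
omit [IsProbabilityMeasure ν] in
theorem fluctuation_one_eq_zero {cs : ℕ → ℝ} (h1 : cs 1 = 0) (N d : ℕ) :
    fluctuation N d ν cs 1 = 0 := by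
  have : ∀ (s : Sample N d) i, deviation ν cs 1 i s = 0 := fun s i => by
    simp [deviation, h1, Sample.std, standardized, weightedAdj, offDiagOnes]
  simp [fluctuation, this]

/-- Strong induction; exponents 0 and 1 have no fluctuation at all. In the step δ is fixed first,
proportional to ε, and only then N grows, which eliminates 1/√σ and δ⁻¹ times the earlier
fluctuations. -/
theorem tendsto_fluctuation_div {d : ℕ → ℕ} (hν : AdmissibleWeightLaw ν)
    (hd : Tendsto (fun N => rowVar N (d N)) atTop atTop)
    (hne : ∀ᶠ N in atTop, Nonempty (RegGraph N (d N))) {cs : ℕ → ℝ} (h0 : cs 0 = 1) (h1 : cs 1 = 0)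
    (h2 : ∀ n, cs (n + 2) = ∑ a ∈ Finset.range (n + 1), cs a * cs (n - a)) (a : ℕ) :
    Tendsto (fun N => fluctuation N (d N) ν cs a / N) atTop (𝓝 0) := by
  induction a using Nat.strong_induction_on with
  | _ a ih =>
    match a with
    | 0 =>
      have : ∀ N, fluctuation N (d N) ν cs 0 = 0 := fun N => by
        simp [fluctuation, deviation, h0]
      simp [this]
    | 1 => simp [fluctuation_one_eq_zero h1]
    | n + 2 =>
      obtain ⟨C, hC0, hC⟩ := exists_fluctuation_le_of_recursion hν cs n (h2 n)
      have hnn : ∀ N, 0 ≤ fluctuation N (d N) ν cs (n + 2) / N := fun N =>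
        div_nonneg (integral_nonneg fun s => Finset.sum_nonneg fun i _ => sq_nonneg _)
          (Nat.cast_nonneg _)
      have hρ : Tendsto (fun N => (√(rowVar N (d N)))⁻¹) atTop (𝓝 0) :=
        (Real.tendsto_sqrt_atTop.comp hd).inv_tendsto_atTop
      have hS : Tendsto (fun N => ∑ a ∈ Finset.range (n + 1), fluctuation N (d N) ν cs a / N)
          atTop (𝓝 0) := by
        have := tendsto_finsetSum (Finset.range (n + 1)) fun a ha =>
          ih a (by have := Finset.mem_range.1 ha; omega)
        simpa using this
      rw [Metric.tendsto_atTop']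
      intro ε hε
      -- The denominator C + 1 covers the case C = 0 and keeps Cδ strictly below ε/2.
      set δ := ε / (2 * (C + 1)) with hδ
      have hδ0 : 0 < δ := by positivity
      have hCδ : C * δ < ε / 2 + 0 := by
        have : (C + 1) * δ = ε / 2 := by rw [hδ]; field_simp
        nlinarith
      have hlim : Tendsto (fun N => C * ((√(rowVar N (d N)))⁻¹ +
          δ⁻¹ * ∑ a ∈ Finset.range (n + 1), fluctuation N (d N) ν cs a / N)) atTop (𝓝 0) := by
        simpa using (hρ.add (hS.const_mul δ⁻¹)).const_mul C
      have hev := (hlim.eventually_lt_const (half_pos hε)).and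
        ((hd.eventually_ge_atTop 16).and (hne.and (eventually_gt_atTop 0)))
      obtain ⟨N₀, hN₀⟩ := eventually_atTop.1 hev
      refine ⟨N₀, fun N hN => ?_⟩
      obtain ⟨k1, k2, k3, k4⟩ := hN₀ N hN.le
      have hN' : (0 : ℝ) < N := by exact_mod_cast k4
      rw [Real.dist_eq, sub_zero, abs_of_nonneg (hnn N)]
      have := hC N (d N) k2 δ hδ0
      have k5 : fluctuation N (d N) ν cs (n + 2) / N ≤ C * ((√(rowVar N (d N)))⁻¹ + δ +
          δ⁻¹ * ∑ a ∈ Finset.range (n + 1), fluctuation N (d N) ν cs a / N) := by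
        rw [div_le_iff₀ hN', ← Finset.sum_div]
        refine this.trans (le_of_eq ?_)
        field_simp
      linarith

/-- The squared mean of the averaged deviation is at most its second moment, which Cauchy–Schwarz
over the vertices bounds by the fluctuation divided by N. -/
theorem tendsto_integral_trace_div {d : ℕ → ℕ} (hν : AdmissibleWeightLaw ν)
    (hd : Tendsto (fun N => rowVar N (d N)) atTop atTop)
    (hne : ∀ᶠ N in atTop, Nonempty (RegGraph N (d N))) {cs : ℕ → ℝ} (h0 : cs 0 = 1) (h1 : cs 1 = 0)
    (h2 : ∀ n, cs (n + 2) = ∑ a ∈ Finset.range (n + 1), cs a * cs (n - a)) (a : ℕ) :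
    Tendsto (fun N : ℕ => 1 / (N : ℝ) * ∫ s : Sample N (d N), (s.std ν ^ a).trace
      ∂sampleLaw N (d N) ν) atTop (𝓝 (cs a)) := by
  have hfl := tendsto_fluctuation_div hν hd hne h0 h1 h2 a
  rw [tendsto_iff_dist_tendsto_zero]
  have hs : Tendsto (fun N => √(fluctuation N (d N) ν cs a / N)) atTop (𝓝 0) := by
    simpa using hfl.sqrt
  refine squeeze_zero' (Eventually.of_forall fun _ => dist_nonneg) ?_ hs
  filter_upwards [hne, eventually_gt_atTop 0] with N _ hN
  have hN' : (0 : ℝ) < N := by exact_mod_cast hN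
  have tG := fun i : Fin N => tame_deviation (d := d N) hν.tame cs a i
  have tT := Tame.trace_matrix_pow (tame_standardized (N := N) (d := d N) hν.tame) a
  have tG2 := Tame.sum (μ := sampleLaw N (d N) ν) Finset.univ fun i => (tG i).pow 2
  set e := 1 / (N : ℝ) * ∫ s : Sample N (d N), (s.std ν ^ a).trace ∂sampleLaw N (d N) ν - cs a
    with he
  have e1 : e = ∫ s : Sample N (d N), 1 / (N : ℝ) * ∑ i, deviation ν cs a i s
      ∂sampleLaw N (d N) ν := by
    have : ∀ s : Sample N (d N), 1 / (N : ℝ) * ∑ i, deviation ν cs a i s =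
        1 / (N : ℝ) * (s.std ν ^ a).trace - cs a := fun s => by
      simp only [deviation, Finset.sum_sub_distrib, Matrix.trace, Matrix.diag]
      simp
      field_simp
    simp only [this]
    rw [integral_sub ((Tame.const _).mul tT).integrable (integrable_const _), integral_const_mul]
    simp [he]
  rw [Real.dist_eq]
  refine Real.abs_le_sqrt ?_
  have tA := (Tame.const (μ := sampleLaw N (d N) ν) (1 / (N : ℝ))).mul (Tame.sum Finset.univ tG)
  have e2 : 0 ≤ ∫ s : Sample N (d N), (1 / (N : ℝ) * ∑ i, deviation ν cs a i s - e) ^ 2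
      ∂sampleLaw N (d N) ν := integral_nonneg fun s => sq_nonneg _
  have e3 : ∀ s : Sample N (d N), (1 / (N : ℝ) * ∑ i, deviation ν cs a i s - e) ^ 2 =
      (1 / (N : ℝ) * ∑ i, deviation ν cs a i s) ^ 2 -
        2 * e * (1 / (N : ℝ) * ∑ i, deviation ν cs a i s) + e ^ 2 := fun s => by ring
  simp only [e3] at e2
  rw [integral_add ((tA.pow 2).sub ((Tame.const _).mul tA)).integrable (integrable_const _),
    integral_sub (tA.pow 2).integrable ((Tame.const _).mul tA).integrable,
    integral_const_mul (2 * e), ← e1] at e2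
  simp only [integral_const, probReal_univ, one_smul] at e2
  have e4 : ∫ s : Sample N (d N), (1 / (N : ℝ) * ∑ i, deviation ν cs a i s) ^ 2
      ∂sampleLaw N (d N) ν ≤ fluctuation N (d N) ν cs a / N := by
    have : fluctuation N (d N) ν cs a / N = ∫ s : Sample N (d N),
        (N : ℝ)⁻¹ * ∑ i, deviation ν cs a i s ^ 2 ∂sampleLaw N (d N) ν := by
      rw [integral_const_mul, fluctuation, div_eq_inv_mul]
    rw [this]
    refine integral_mono (tA.pow 2).integrable ((Tame.const _).mul tG2).integrable fun s => ?_
    have := sq_sum_le_card_mul_sum_sq (s := Finset.univ) (f := fun i => deviation ν cs a i s)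
    rw [Finset.card_univ, Fintype.card_fin] at this
    simp only
    rw [mul_pow]
    calc _ ≤ (1 / (N : ℝ)) ^ 2 * (N * ∑ i, deviation ν cs a i s ^ 2) := by gcongr
      _ = _ := by field_simp
  linarith

/-! ### Moments of the semicircle law and Catalan numbers. -/

/-- The moments of the semicircle law on `[-2, 2]`. -/
noncomputable def semicircleMoment (a : ℕ) : ℝ :=
  ∫ t in (-2 : ℝ)..2, t ^ a * (1 / (2 * Real.pi) * √(4 - t ^ 2))

theorem integral_cos_pow_add_two (a : ℕ) :
    ∫ x in (0 : ℝ)..Real.pi, Real.cos x ^ (a + 2) =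
      (a + 1) / (a + 2) * ∫ x in (0 : ℝ)..Real.pi, Real.cos x ^ a := by
  rw [integral_cos_pow]
  simp

/-- The substitution t = 2 cos x turns the density into a multiple of sin² x = 1 − cos² x, which
leaves two consecutive Wallis integrals. -/
theorem semicircleMoment_eq_integral_cos (a : ℕ) :
    semicircleMoment a =
      2 ^ (a + 1) / (Real.pi * (a + 2)) * ∫ x in (0 : ℝ)..Real.pi, Real.cos x ^ a := by
  have hsub := intervalIntegral.integral_comp_mul_deriv (a := 0) (b := Real.pi)
    (f := fun x => 2 * Real.cos x) (f' := fun x => 2 * -Real.sin x)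
    (g := fun t : ℝ => t ^ a * (1 / (2 * Real.pi) * √(4 - t ^ 2)))
    (fun x _ => (Real.hasDerivAt_cos x).const_mul 2) (by fun_prop) (by fun_prop)
  simp only [Function.comp_def, Real.cos_zero, Real.cos_pi, mul_one, mul_neg] at hsub
  rw [semicircleMoment, intervalIntegral.integral_symm, ← hsub, ← intervalIntegral.integral_neg]
  have hcongr : ∀ x ∈ Set.uIcc (0 : ℝ) Real.pi,
      - -((2 * Real.cos x) ^ a * (1 / (2 * Real.pi) * √(4 - (2 * Real.cos x) ^ 2)) *
        (2 * Real.sin x)) =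
      2 ^ (a + 1) / Real.pi * (Real.cos x ^ a - Real.cos x ^ (a + 2)) := by
    intro x hx
    rw [Set.uIcc_of_le Real.pi_pos.le] at hx
    have h0 := Real.sin_nonneg_of_mem_Icc hx
    have : √(4 - (2 * Real.cos x) ^ 2) = 2 * Real.sin x := by
      rw [show 4 - (2 * Real.cos x) ^ 2 = (2 * Real.sin x) ^ 2 by
        nlinarith [Real.sin_sq_add_cos_sq x], Real.sqrt_sq (by positivity)]
    have hs : Real.sin x ^ 2 = 1 - Real.cos x ^ 2 := Real.sin_sq x
    rw [this]
    field_simp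
    rw [hs]
    ring
  rw [intervalIntegral.integral_congr hcongr, intervalIntegral.integral_const_mul,
    intervalIntegral.integral_sub (Continuous.intervalIntegrable (by fun_prop) _ _)
      (Continuous.intervalIntegrable (by fun_prop) _ _), integral_cos_pow_add_two]
  have := Real.pi_pos
  field_simp
  ring

theorem semicircleMoment_zero : semicircleMoment 0 = 1 := by
  rw [semicircleMoment_eq_integral_cos]
  have := Real.pi_pos
  simp
  field_simp

theorem semicircleMoment_one : semicircleMoment 1 = 0 := by
  rw [semicircleMoment_eq_integral_cos]
  simp

theorem semicircleMoment_add_two (a : ℕ) :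
    semicircleMoment (a + 2) = 4 * (a + 1) / (a + 4) * semicircleMoment a := by
  simp only [semicircleMoment_eq_integral_cos]
  rw [integral_cos_pow_add_two]
  have := Real.pi_pos
  push_cast
  field_simp
  ring

theorem semicircleMoment_odd (k : ℕ) : semicircleMoment (2 * k + 1) = 0 := by
  induction k with
  | zero => exact semicircleMoment_one
  | succ k ih => rw [show 2 * (k + 1) + 1 = 2 * k + 1 + 2 by ring, semicircleMoment_add_two, ih,
      mul_zero]

/-- The ratio of consecutive even moments is that of consecutive Catalan numbers, read off from the
central binomial coefficients. -/
theorem semicircleMoment_even (k : ℕ) : semicircleMoment (2 * k) = catalan k := by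
  induction k with
  | zero => simpa using semicircleMoment_zero
  | succ k ih =>
    rw [show 2 * (k + 1) = 2 * k + 2 by ring, semicircleMoment_add_two, ih]
    have h1 : ((k : ℝ) + 1) * catalan k = k.centralBinom := by
      exact_mod_cast succ_mul_catalan_eq_centralBinom k
    have h2 : ((k : ℝ) + 1 + 1) * catalan (k + 1) = (k + 1).centralBinom := by
      exact_mod_cast succ_mul_catalan_eq_centralBinom (k + 1)
    have h3 : ((k : ℝ) + 1) * (k + 1).centralBinom = 2 * (2 * k + 1) * k.centralBinom := by
      exact_mod_cast Nat.succ_mul_centralBinom_succ k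
    rw [← h1, ← h2] at h3
    have hk : (k : ℝ) + 1 ≠ 0 := by positivity
    have h4 : ((k : ℝ) + 1 + 1) * catalan (k + 1) = 2 * (2 * k + 1) * catalan k :=
      mul_left_cancel₀ hk (by linarith)
    push_cast
    rw [div_mul_eq_mul_div, div_eq_iff (by positivity)]
    linarith

theorem sum_range_two_mul_succ {M : Type*} [AddCommMonoid M] (f : ℕ → M) (k : ℕ) :
    ∑ a ∈ Finset.range (2 * k + 1), f a =
      ∑ j ∈ Finset.range (k + 1), f (2 * j) + ∑ j ∈ Finset.range k, f (2 * j + 1) := by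
  induction k with
  | zero => simp
  | succ k ih =>
    rw [show 2 * (k + 1) + 1 = 2 * k + 1 + 1 + 1 by ring, Finset.sum_range_succ,
      Finset.sum_range_succ, ih, Finset.sum_range_succ _ (k + 1),
      Finset.sum_range_succ (fun j => f (2 * j + 1)) k, show 2 * (k + 1) = 2 * k + 1 + 1 by ring]
    abel_nf
    simp only [smul_eq_mul, mul_one, add_assoc, add_left_comm, add_comm]

/-- For even n the odd indices drop out and the convolution formula for Catalan numbers remains. For
odd n one of a and n − a is odd in every term. -/
theorem semicircleMoment_recursion (n : ℕ) :
    semicircleMoment (n + 2) =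
      ∑ a ∈ Finset.range (n + 1), semicircleMoment a * semicircleMoment (n - a) := by
  obtain ⟨k, rfl | rfl⟩ := n.even_or_odd'
  · rw [sum_range_two_mul_succ, show 2 * k + 2 = 2 * (k + 1) by ring, semicircleMoment_even,
      catalan_succ]
    simp only [semicircleMoment_odd, zero_mul, Finset.sum_const_zero, add_zero]
    rw [Fin.sum_univ_eq_sum_range (fun i => catalan i * catalan (k - i))]
    push_cast
    refine Finset.sum_congr rfl fun j _ => ?_
    rw [← Nat.mul_sub, semicircleMoment_even, semicircleMoment_even]
  · rw [show 2 * k + 1 + 2 = 2 * (k + 1) + 1 by ring, semicircleMoment_odd]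
    refine (Finset.sum_eq_zero fun a ha => ?_).symm
    rw [Finset.mem_range] at ha
    obtain ⟨j, rfl | rfl⟩ := a.even_or_odd'
    · rw [show 2 * k + 1 - 2 * j = 2 * (k - j) + 1 by omega, semicircleMoment_odd, mul_zero]
    · rw [semicircleMoment_odd, zero_mul]

/-! ### Transfer to the given probability spaces and to eigenvalues. -/

section Transfer

variable {N d : ℕ}

/-- Conditioning the counting measure on the empty set gives the zero measure, which is not a
probability. -/
theorem nonempty_regGraph [IsProbabilityMeasure (uniformOn (regularGraphs N d))] :
    Nonempty (RegGraph N d) := by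
  by_contra h
  have : regularGraphs N d = ∅ := Set.not_nonempty_iff_eq_empty.1 fun ⟨H, hH⟩ => h ⟨⟨H, hH⟩⟩
  have h0 : uniformOn (regularGraphs N d) Set.univ = 0 := by
    rw [this, uniformOn_empty_meas]; rfl
  simp at h0

theorem measurePreserving_regGraph_val [Nonempty (RegGraph N d)] :
    MeasurePreserving (Subtype.val : RegGraph N d → SimpleGraph (Fin N))
      (uniformOn Set.univ) (uniformOn (regularGraphs N d)) := by
  refine ⟨measurable_subtype_coe, Measure.ext_of_singleton fun H => ?_⟩
  rw [Measure.map_apply measurable_subtype_coe (measurableSet_singleton _), uniformOn, uniformOn,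
    cond_apply MeasurableSet.univ, cond_apply (Set.toFinite _).measurableSet, Set.univ_inter]
  have hc : ∀ A : Set (RegGraph N d),
      Measure.count A = Measure.count (Subtype.val '' A : Set (SimpleGraph (Fin N))) :=
    fun A => (Measure.count_injective_image Subtype.val_injective A).symm
  rw [hc, hc, Set.image_univ, Subtype.range_coe_subtype, Subtype.image_preimage_coe]
  rfl

variable {ν : Measure ℝ} [IsProbabilityMeasure ν]

/-- Forgetting the spare weight recovers the law of the original model. -/
theorem measurePreserving_graph_weights [Nonempty (RegGraph N d)] :
    MeasurePreserving (fun s : Sample N d => (s.1.1, s.wt)) (sampleLaw N d ν)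
      ((uniformOn (regularGraphs N d)).prod (Measure.pi fun _ => ν)) := by
  have hw : MeasurePreserving (fun (w : Option (Sym2 (Fin N)) → ℝ) e => w (some e))
      (Measure.pi fun _ => ν) (Measure.pi fun _ => ν) := by
    have hmp : MeasurePreserving (MeasurableEquiv.piOptionEquivProd fun _ => ℝ).symm
        ((Measure.pi fun _ : Sym2 (Fin N) => ν).prod ν)
        (Measure.pi fun _ : Option (Sym2 (Fin N)) => ν) :=
      ⟨(MeasurableEquiv.piOptionEquivProd _).symm.measurable,
        Measure.pi_map_piOptionEquivProd fun _ : Option (Sym2 (Fin N)) => ν⟩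
    exact measurePreserving_fst.comp hmp.symm
  have : IsProbabilityMeasure (uniformOn (regularGraphs N d)) :=
    isProbabilityMeasure_uniformOn (Set.toFinite _) (Set.nonempty_coe_sort.1 ‹_›)
  exact measurePreserving_regGraph_val.prod hw

omit [IsProbabilityMeasure ν] in
theorem IsUniformRegularWeightedGraph.hasLaw {Ω : Type*} [MeasurableSpace Ω]
    {G : Ω → SimpleGraph (Fin N)} {ξ : Sym2 (Fin N) → Ω → ℝ} {μ : Measure Ω}
    [IsProbabilityMeasure μ] (h : IsUniformRegularWeightedGraph N d ν G ξ μ) :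
    HasLaw (fun ω => (G ω, fun e => ξ e ω))
      ((uniformOn (regularGraphs N d)).prod (Measure.pi fun _ => ν)) μ :=
  (indepFun_iff_hasLaw_prodMk_prod h.graph_law (h.weight_indep.hasLaw_pi h.weight_law)).1
    h.graph_indep_weight

end Transfer

section Esd

theorem trace_pow_eq_sum_eigenvalues {V : Type*} [Fintype V] [DecidableEq V] {M : Matrix V V ℝ}
    (hM : M.IsHermitian) (a : ℕ) : (M ^ a).trace = ∑ i, hM.eigenvalues i ^ a := by
  have h := congrArg (· ^ a) hM.spectral_theorem
  simp only [← map_pow, Matrix.diagonal_pow] at h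
  rw [h, Unitary.conjStarAlgAut_apply, Matrix.trace_mul_cycle, Unitary.coe_star_mul_self,
    Matrix.one_mul, Matrix.trace_diagonal]
  rfl

variable {N : ℕ} (d : ℕ) (ν : Measure ℝ)

theorem esdIntegral_eq_sum_trace (H : SimpleGraph (Fin N)) (w : Sym2 (Fin N) → ℝ) (P : ℝ[X]) :
    esdIntegral d ν H w P =
      P.sum fun a c => c * (1 / (N : ℝ) * (standardized d ν H w ^ a).trace) := by
  have htr : ∀ a : ℕ, (standardized d ν H w ^ a).trace =
      ∑ i, (standardized_isHermitian d ν H w).eigenvalues i ^ a := fun a =>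
    trace_pow_eq_sum_eigenvalues (standardized_isHermitian d ν H w) a
  simp only [htr, esdIntegral, eval_eq_sum, Polynomial.sum, Finset.mul_sum]
  rw [Finset.sum_comm]
  refine Finset.sum_congr rfl fun a _ => Finset.sum_congr rfl fun i _ => ?_
  ring

/-- There are finitely many graphs, and for each of them the trace formula is a polynomial in the
weights; so measurability of single eigenvalues is never needed. -/
theorem measurable_esdIntegral (P : ℝ[X]) :
    Measurable fun p : SimpleGraph (Fin N) × (Sym2 (Fin N) → ℝ) => esdIntegral d ν p.1 p.2 P := by
  refine measurable_from_prod_countable_right fun H => Continuous.measurable ?_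
  have hM : Continuous fun w : Sym2 (Fin N) → ℝ => standardized d ν H w := by
    refine continuous_matrix fun i j => ?_
    simp only [standardized, weightedAdj, Matrix.smul_apply, Matrix.sub_apply, Matrix.of_apply]
    split_ifs <;> fun_prop
  simp only [esdIntegral_eq_sum_trace, Polynomial.sum]
  fun_prop

end Esd

section Moments

variable {N d : ℕ} {ν : Measure ℝ} [IsProbabilityMeasure ν]

theorem tame_esdIntegral [Nonempty (RegGraph N d)] (hx : Tame (fun x : ℝ => x) ν) (P : ℝ[X]) :
    Tame (fun s : Sample N d => esdIntegral d ν s.1.1 s.wt P) (sampleLaw N d ν) := by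
  simp only [esdIntegral_eq_sum_trace, Polynomial.sum]
  exact Tame.sum _ fun a => (Tame.const _).mul
    ((Tame.const _).mul (Tame.trace_matrix_pow (tame_standardized hx) a))

theorem integral_esdIntegral [Nonempty (RegGraph N d)] (hx : Tame (fun x : ℝ => x) ν) (P : ℝ[X]) :
    ∫ s : Sample N d, esdIntegral d ν s.1.1 s.wt P ∂sampleLaw N d ν =
      P.sum fun a c => c * (1 / (N : ℝ) *
        ∫ s : Sample N d, (s.std ν ^ a).trace ∂sampleLaw N d ν) := by
  have ht := fun a => Tame.trace_matrix_pow (tame_standardized (d := d) (N := N) hx) a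
  simp only [esdIntegral_eq_sum_trace, Polynomial.sum]
  rw [integral_finsetSum _ fun a _ => ((Tame.const _).mul ((Tame.const _).mul (ht a))).integrable]
  simp only [integral_const_mul]

theorem integral_semicircle_eq_sum (P : ℝ[X]) :
    ∫ t in (-2 : ℝ)..2, P.eval t * (1 / (2 * Real.pi) * √(4 - t ^ 2)) =
      P.sum fun a c => c * semicircleMoment a := by
  simp only [eval_eq_sum, Polynomial.sum, Finset.sum_mul, mul_assoc, semicircleMoment]
  rw [intervalIntegral.integral_finsetSum
    fun a _ => Continuous.intervalIntegrable (by fun_prop) _ _]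
  simp only [intervalIntegral.integral_const_mul]

end Moments

end RegWigner

theorem theorem1p1
    {Ω : ℕ → Type*} [∀ N, MeasurableSpace (Ω N)]
    (μ : ∀ N, Measure (Ω N)) [∀ N, IsProbabilityMeasure (μ N)]
    (ν : Measure ℝ) [IsProbabilityMeasure ν] (hν : RegWigner.AdmissibleWeightLaw ν)
    (d : ℕ → ℕ)
    (G : ∀ N, Ω N → SimpleGraph (Fin N)) (ξ : ∀ N, Sym2 (Fin N) → Ω N → ℝ)
    (hG : ∀ N, 2 ≤ N →
      RegWigner.IsUniformRegularWeightedGraph N (d N) ν (G N) (ξ N) (μ N))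
    (hd : Tendsto (fun N => (d N : ℝ)) atTop atTop)
    (hNd : Tendsto (fun N : ℕ => (N : ℝ) - (d N : ℝ)) atTop atTop)
    (η : ℝ) (hη : 0 < η)
    (hηd : Tendsto (fun N : ℕ => |(N : ℝ) / 2 - (d N : ℝ) - η * √(d N : ℝ)|) atTop atTop) :
    ∀ P : ℝ[X],
      (∀ N, 2 ≤ N → Integrable
        (fun ω => RegWigner.esdIntegral (d N) ν (G N ω) (fun e => ξ N e ω) P) (μ N)) ∧
      Tendsto
        (fun N => ∫ ω, RegWigner.esdIntegral (d N) ν (G N ω) (fun e => ξ N e ω) P ∂(μ N))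
        atTop
        (𝓝 (∫ t in (-2 : ℝ)..2, P.eval t * (1 / (2 * Real.pi) * √(4 - t ^ 2)))) := by
  open RegWigner in
  have hx := hν.tame
  -- The graph has a law that is a probability measure, so at least one d-regular graph exists.
  have hne : ∀ N, 2 ≤ N → Nonempty (RegGraph N (d N)) := fun N hN => by
    have := (hG N hN).graph_law.isProbabilityMeasure_iff.1 inferInstance
    exact nonempty_regGraph
  intro P
  refine ⟨fun N hN => ?_, ?_⟩
  · have := hne N hN
    -- Integrability is pushed from the sample space to the joint law of graph and weights, and
    -- pulled back from there to the given space.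
    have hi := (measurePreserving_graph_weights (N := N) (d := d N) (ν := ν)).integrable_comp
      (measurable_esdIntegral (d N) ν P).aestronglyMeasurable |>.1 (tame_esdIntegral hx P).integrable
    have hlaw := (hG N hN).hasLaw
    rw [← hlaw.map_eq] at hi
    exact hi.comp_aemeasurable hlaw.aemeasurable
  · rw [integral_semicircle_eq_sum]
    -- A polynomial has finitely many coefficients, so convergence of each trace moment suffices.
    have hlim : Tendsto (fun N : ℕ => P.sum fun a c => c * (1 / (N : ℝ) *
        ∫ s : Sample N (d N), (s.std ν ^ a).trace ∂sampleLaw N (d N) ν)) atTop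
        (𝓝 (P.sum fun a c => c * semicircleMoment a)) :=
      tendsto_finsetSum _ fun a _ => (tendsto_integral_trace_div hν (tendsto_rowVar_atTop hd hNd)
        (eventually_atTop.2 ⟨2, hne⟩) semicircleMoment_zero semicircleMoment_one
        semicircleMoment_recursion a).const_mul _
    refine hlim.congr' (eventually_atTop.2 ⟨2, fun N hN => ?_⟩)
    have := hne N hN
    rw [← integral_esdIntegral hx, integral_comp_preserving
      (measurable_esdIntegral (d N) ν P) measurePreserving_graph_weights]
    exact ((hG N hN).hasLaw.integral_comp
      (measurable_esdIntegral (d N) ν P).aestronglyMeasurable).symm
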